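/- Let $(a_{i\ell})_{(i,\ell)\in\mathbb Z^2}$ be real numbers and let $(d_{ij})_{(i,j)\in\mathbb Z^2}$ be real-valued random variables on a probability space such that the following conditions hold. - **A1.** As $n\to\infty$, $\sum_{\ell=0}^n a_{i\ell}^2$ converges uniformly in $i\ge 1$, and $\sup_{i\ge 1}\sum_{\ell=0}^\infty a_{i\ell}^2<\infty$. - **A2.** There is $\sigma>0$ with $\sup_{(i,j)\in\mathbb Z^2}\|d_{ij}\|_2<\sigma$, and for every $\varepsilon>0$, $$\frac1{n^2}\sum_{i=1}^n\sum_{j=1}^i\mathbb E\big(d_{ij}^2\,I(|d_{ij}|>\varepsilon\sqrt n)\big)\to 0\quad\text{as } n\to\infty .$$ - **A3.** With $\mathcal F_{ij}=\sigma(d_{ik},\,k\le j)$, one has $\mathbb E(d_{ij}\mid\mathcal F_{i,j-1})=0$ a.s. for all $(i,j)\in\mathbb Z^2$, and $$\sup_{i\ge1}\sup_{j\ge n}\big\|\mathbb E(d_{ij}^2\mid\mathcal F_{i,j-n})-\mathbb E(d_{ij}^2)\big\|_1\to 0\quad\text{as } n\to\infty .$$ Assume in addition that the sequences $(d_{ij})_{j\in\mathbb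 Z}$, $i\ge1$, are mutually independent. For $i,j\ge1$ let $$X_{ij}=\sum_{\ell=0}^\infty a_{i\ell}\,d_{i,j-\ell}\qquad(\text{convergence in }\mathbb L^2),$$ and let $(Y_{ij})_{i,j\ge1}$ be a centered real-valued Gaussian random field (possibly on another probability space) with the same covariances as $(X_{ij})_{i,j\ge1}$. Let $\mathbb X_n$ be the symmetric $n\times n$ matrix with entries $(\mathbb X_n)_{ij}=(\mathbb X_n)_{ji}=n^{-1/2}X_{ij}$ for $1\le j\le i\le n$, and let $\mathbb Y_n$ be defined in the same way from $(Y_{ij})$. For a real symmetric $n\times n$ matrix $A$ and $z\in\mathbb C$ with $\operatorname{Im}z>0$, let $S^{A}(z)=\frac1n\operatorname{Tr}(A-zI_n)^{-1}$ be the Stieltjes transform of its empirical spectral distribution. Then, for every $z\in\mathbb C$ with $\operatorname{Im} z>0$, $$S^{\mathbb X_n}(z)-\mathbb E\,S^{\mathbb Y_n}(z)\longrightarrow 0\quad\text{almost surely, as } n\to\infty .$$ -/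

import Mathlib

open MeasureTheory ProbabilityTheory Filter Topology

noncomputable section

namespace LinearProcessESD

/-- The symmetric `n × n` matrix whose entries on and below the diagonal are
`x i j` (`1 ≤ j ≤ i ≤ n`), divided by `√n`. The index `k : Fin n` stands for the row number
`k + 1`. -/
def wignerMatrix (x : ℕ+ → ℕ+ → ℝ) (n : ℕ) : Matrix (Fin n) (Fin n) ℝ :=
  Matrix.of fun k l =>
    (1 / Real.sqrt n) *
      (if l ≤ k then x (Nat.succPNat k) (Nat.succPNat l) else x (Nat.succPNat l) (Nat.succPNat k))

/-- The Stieltjes transform `n⁻¹ Tr (A - z I)⁻¹` of the empirical spectral distribution of a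
real symmetric matrix `A` of order `n`. -/
def stieltjes {n : ℕ} (A : Matrix (Fin n) (Fin n) ℝ) (z : ℂ) : ℂ :=
  (1 / (n : ℂ)) *
    ((A.map (fun t : ℝ => (t : ℂ)) - z • (1 : Matrix (Fin n) (Fin n) ℂ))⁻¹).trace

/-- The random variable `X` is the sum, in the sense of convergence in `L²`, of the series
`∑_{ℓ ≥ 0} f ℓ`. This determines `X` up to almost sure equality. -/
def IsL2Sum {Ω : Type*} [MeasurableSpace Ω] (f : ℕ → Ω → ℝ) (X : Ω → ℝ) (P : Measure Ω) : Prop :=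
  AEMeasurable X P ∧
    Tendsto (fun N : ℕ => eLpNorm (fun ω => X ω - ∑ ℓ ∈ Finset.range N, f ℓ ω) 2 P) atTop (𝓝 0)

/-- `X i j = ∑_{ℓ ≥ 0} a i ℓ * d i (j - ℓ)` for all `i, j ≥ 1`. -/
def IsLinearProcess {Ω : Type*} [MeasurableSpace Ω] (a : ℤ → ℤ → ℝ) (d : ℤ → ℤ → Ω → ℝ)
    (X : ℕ+ → ℕ+ → Ω → ℝ) (P : Measure Ω) : Prop :=
  ∀ i j : ℕ+, IsL2Sum (fun ℓ ω => a (i : ℕ) (ℓ : ℤ) * d (i : ℕ) (((j : ℕ) : ℤ) - (ℓ : ℤ)) ω) (X i j) P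

/-- The sums `∑_{ℓ = 0}^n a i ℓ ^ 2` converge as `n → ∞`, uniformly in `i ≥ 1`, to a limit that
is bounded in `i ≥ 1`. -/
def CondA1 (a : ℤ → ℤ → ℝ) : Prop :=
  ∃ A : ℤ → ℝ,
    TendstoUniformlyOn (fun (n : ℕ) (i : ℤ) => ∑ ℓ ∈ Finset.range (n + 1), a i (ℓ : ℤ) ^ 2) A
      atTop {i : ℤ | 1 ≤ i} ∧
    ∃ C : ℝ, ∀ i : ℤ, 1 ≤ i → A i ≤ C

/-- The innovations are bounded in `L²` and satisfy a Lindeberg condition. -/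
def CondA2 {Ω : Type*} [MeasurableSpace Ω] (d : ℤ → ℤ → Ω → ℝ) (P : Measure Ω) : Prop :=
  (∃ σ : ℝ, 0 < σ ∧ ⨆ (i : ℤ) (j : ℤ), eLpNorm (d i j) 2 P < ENNReal.ofReal σ) ∧
    ∀ ε : ℝ, 0 < ε →
      Tendsto (fun n : ℕ => (1 / (n : ℝ) ^ 2) *
          ∑ i ∈ Finset.Icc 1 n, ∑ j ∈ Finset.Icc 1 i,
            ∫ ω in {ω | ε * Real.sqrt n < |d (i : ℤ) (j : ℤ) ω|}, d (i : ℤ) (j : ℤ) ω ^ 2 ∂P)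
        atTop (𝓝 0)

/-- The σ-field generated by `d i k`, `k ≤ j`. -/
abbrev rowPast {Ω : Type*} (d : ℤ → ℤ → Ω → ℝ) (i j : ℤ) : MeasurableSpace Ω :=
  ⨆ (k : ℤ) (_ : k ≤ j), MeasurableSpace.comap (d i k) inferInstance

/-- Each row of `d` is a sequence of martingale differences, and the conditional variances
stabilize in `L¹`, uniformly, as one conditions on the more and more remote past. -/
def CondA3 {Ω : Type*} [MeasurableSpace Ω] (d : ℤ → ℤ → Ω → ℝ) (P : Measure Ω) : Prop :=
  (∀ i j : ℤ, P[d i j | rowPast d i (j - 1)] =ᵐ[P] 0) ∧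
    Tendsto (fun n : ℕ => ⨆ (i : ℤ) (_ : 1 ≤ i) (j : ℤ) (_ : (n : ℤ) ≤ j),
        eLpNorm (fun ω => (P[fun ω' => d i j ω' ^ 2 | rowPast d i (j - (n : ℤ))]) ω
          - ∫ ω', d i j ω' ^ 2 ∂P) 1 P)
      atTop (𝓝 0)

/-- `Y` is a centered Gaussian random field (on its own probability space) with the same
covariances as the field `X`. -/
def IsGaussianCounterpart {Ω Ω' : Type*} [MeasurableSpace Ω] [MeasurableSpace Ω']
    (X : ℕ+ → ℕ+ → Ω → ℝ) (P : Measure Ω) (Y : ℕ+ → ℕ+ → Ω' → ℝ) (P' : Measure Ω') : Prop :=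
  IsGaussianProcess (fun (u : ℕ+ × ℕ+) => Y u.1 u.2) P' ∧
    (∀ i j : ℕ+, ∫ ω, Y i j ω ∂P' = 0) ∧
    ∀ i j k l : ℕ+, covariance (Y i j) (Y k l) P' = covariance (X i j) (X k l) P

end LinearProcessESD

end

noncomputable section

namespace LinearProcessESD

open scoped Matrix Matrix.Norms.Frobenius

/-! ### Frobenius norm bounds for resolvents of Hermitian matrices. -/

section Frobenius

variable {m n p : Type*} [Fintype m] [Fintype n] [Fintype p]

/-! Two facts are combined: the Stieltjes transform concentrates around its mean because the rows
are independent, and its mean is insensitive to the law of the innovations by a Lindeberg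
replacement argument.

Concentration. Changing one row of the lower triangle perturbs the symmetric matrix by a matrix of
rank at most 2, hence moves the Stieltjes transform by at most `4 / (n |Im z|)`
(`stieltjesArray_sub_le_of_row`). The bounded differences inequality over the `n` independent rows
gives a subgaussian fluctuation with variance proxy of order `1 / n`, and Borel-Cantelli gives
almost sure convergence (`ae_tendsto_sub_integral`).

Replacement. The trace of the resolvent has a second order expansion whose remainder is controlled
by the Frobenius norm of the direction, without any power of the dimension
(`isSmoothFunctional_stieltjesArray`). Each innovation moves the matrix in a direction of squared
norm `O(1/n)`, and there is a further factor `1/n` from the normalized trace, so that the order of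
`n²` replacements add up to `O(1)` at second order and to a small quantity at third order, under the
Lindeberg condition. Within a row the innovations are replaced by Gaussian variables from the last
to the first; the martingale property kills the linear term. What survives is the expectation of
`(d² - E d²) Q(A)`, with `A` the past of the row. Deleting the `p - 1` most recent innovations from
`A` costs little, and A3 then makes the expectation small (`swap_step_fine`). Innovations with index
below `p` get only the second order bound (`swap_step_crude`): those with positive index are few,
and those with nonpositive index enter through tails of the coefficients, which are small on average
by the uniformity in A1.

Truncation. All this is done for the sum over the lags less than `M`, with bounds uniform in `M`.
Martingale differences are orthogonal and rows are independent, so the truncated process with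
Gaussian innovations of the same variances has the covariances of the truncated process; as `M`
grows these converge to those of `X`, which are those of `Y`, and Lévy's theorem identifies the
limiting expectation. Hence `M` can be chosen for each `n` so large that both truncation errors are
at most `2⁻ⁿ` (`ae_tendsto_stieltjesArray_sub`). -/

theorem frobenius_norm_sq (A : Matrix m n ℂ) : ‖A‖ ^ 2 = ∑ i, ∑ j, ‖A i j‖ ^ 2 := by
  rw [Matrix.frobenius_norm_def, ← Real.sqrt_eq_rpow, Real.sq_sqrt]
  · simp
  · positivity

theorem norm_trace_mul_le (A : Matrix m n ℂ) (B : Matrix n m ℂ) :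
    ‖(A * B).trace‖ ≤ ‖A‖ * ‖B‖ := by
  have h1 : ‖(A * B).trace‖ ≤ ∑ p : m × n, ‖A p.1 p.2‖ * ‖B p.2 p.1‖ := by
    rw [Fintype.sum_prod_type]
    simp only [Matrix.trace, Matrix.diag_apply, Matrix.mul_apply]
    refine (norm_sum_le _ _).trans (Finset.sum_le_sum fun i _ => ?_)
    refine (norm_sum_le _ _).trans (Finset.sum_le_sum fun j _ => ?_)
    rw [norm_mul]
  have hA : ∑ p : m × n, ‖A p.1 p.2‖ ^ 2 = ‖A‖ ^ 2 := by
    rw [frobenius_norm_sq, Fintype.sum_prod_type]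
  have hB : ∑ p : m × n, ‖B p.2 p.1‖ ^ 2 = ‖B‖ ^ 2 := by
    rw [frobenius_norm_sq, Fintype.sum_prod_type_right]
  refine h1.trans ((Real.sum_mul_le_sqrt_mul_sqrt _ _ _).trans (le_of_eq ?_))
  rw [hA, hB, Real.sqrt_sq (norm_nonneg _), Real.sqrt_sq (norm_nonneg _)]

theorem trace_conjTranspose_mul_self (M : Matrix n p ℂ) :
    (Mᴴ * M).trace = ((‖M‖ ^ 2 : ℝ) : ℂ) := by
  rw [frobenius_norm_sq, Finset.sum_comm]
  simp only [Matrix.trace, Matrix.diag_apply, Matrix.mul_apply, Matrix.conjTranspose_apply]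
  push_cast
  refine Finset.sum_congr rfl fun i _ => Finset.sum_congr rfl fun j _ => ?_
  rw [← Complex.conj_mul']
  rfl

variable [DecidableEq n]

/-- The trace of `Mᴴ * H * M` is real, so the imaginary part of the trace of `Mᴴ * (H - z) * M` is
`-(Im z) ‖M‖²`; Cauchy-Schwarz concludes. This replaces the spectral bound on the resolvent. The
matrix `M` is rectangular so that single columns are covered. -/
theorem abs_im_mul_norm_le {H : Matrix n n ℂ} (hH : H.IsHermitian) (z : ℂ) (M : Matrix n p ℂ) :
    |z.im| * ‖M‖ ≤ ‖(H - z • (1 : Matrix n n ℂ)) * M‖ := by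
  rcases (norm_nonneg M).eq_or_lt with h0 | h0
  · rw [← h0]; simp
  have hreal : ((Mᴴ * (H * M)).trace).im = 0 := by
    rw [← Complex.conj_eq_iff_im]
    change star _ = _
    rw [← Matrix.trace_conjTranspose]
    simp [Matrix.conjTranspose_mul, hH.eq, Matrix.mul_assoc]
  have h1 : ((Mᴴ * ((H - z • (1 : Matrix n n ℂ)) * M)).trace).im = - (z.im * ‖M‖ ^ 2) := by
    have : Mᴴ * ((H - z • (1 : Matrix n n ℂ)) * M) = Mᴴ * (H * M) - z • (Mᴴ * M) := by
      simp [Matrix.sub_mul, Matrix.mul_sub]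
    rw [this, Matrix.trace_sub, Matrix.trace_smul, trace_conjTranspose_mul_self, Complex.sub_im,
      hreal, smul_eq_mul, Complex.im_mul_ofReal]
    ring
  have h2 := (Complex.abs_im_le_norm _).trans
    (norm_trace_mul_le Mᴴ ((H - z • (1 : Matrix n n ℂ)) * M))
  rw [h1, abs_neg, abs_mul, abs_of_nonneg (sq_nonneg ‖M‖),
    Matrix.frobenius_norm_conjTranspose] at h2
  have h3 : ‖M‖ * (|z.im| * ‖M‖) ≤ ‖M‖ * ‖(H - z • (1 : Matrix n n ℂ)) * M‖ := by
    linarith [h2, sq (‖M‖)]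
  exact le_of_mul_le_mul_left h3 h0

/-- A kernel vector, read as a one-column matrix, has norm zero by the preceding lower bound. -/
theorem isUnit_det_sub {H : Matrix n n ℂ} (hH : H.IsHermitian) {z : ℂ} (hz : z.im ≠ 0) :
    IsUnit (H - z • (1 : Matrix n n ℂ)).det := by
  rw [isUnit_iff_ne_zero]
  intro h
  obtain ⟨v, hv, hv0⟩ := Matrix.exists_mulVec_eq_zero_iff.mpr h
  have h1 := abs_im_mul_norm_le hH z (Matrix.replicateCol Unit v)
  rw [← Matrix.replicateCol_mulVec, hv0] at h1
  have h2 : ‖Matrix.replicateCol Unit (0 : n → ℂ)‖ = 0 := by simp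
  rw [h2] at h1
  have h3 : ‖Matrix.replicateCol Unit v‖ = 0 := by
    have := abs_pos.mpr hz
    nlinarith [norm_nonneg (Matrix.replicateCol Unit v)]
  rw [norm_eq_zero, Matrix.replicateCol_eq_zero] at h3
  exact hv h3

/-- The resolvent of a square matrix. -/
def resolventAt (z : ℂ) (H : Matrix n n ℂ) : Matrix n n ℂ := (H - z • (1 : Matrix n n ℂ))⁻¹

variable {z : ℂ}

theorem norm_resolventAt_mul_le {H : Matrix n n ℂ} (hH : H.IsHermitian) (hz : z.im ≠ 0)
    (B : Matrix n p ℂ) : ‖resolventAt z H * B‖ ≤ |z.im|⁻¹ * ‖B‖ := by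
  have h := abs_im_mul_norm_le hH z (resolventAt z H * B)
  rw [resolventAt, ← Matrix.mul_assoc, Matrix.mul_nonsing_inv _ (isUnit_det_sub hH hz),
    Matrix.one_mul] at h
  rw [inv_mul_eq_div, le_div_iff₀ (abs_pos.mpr hz), mul_comm]
  exact h

theorem conjTranspose_resolventAt {H : Matrix n n ℂ} (hH : H.IsHermitian) :
    (resolventAt z H)ᴴ = resolventAt (star z) H := by
  rw [resolventAt, resolventAt, Matrix.conjTranspose_nonsing_inv, Matrix.conjTranspose_sub, hH.eq,
    Matrix.conjTranspose_smul, Matrix.conjTranspose_one]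

theorem norm_mul_resolventAt_le {H : Matrix n n ℂ} (hH : H.IsHermitian) (hz : z.im ≠ 0)
    (B : Matrix p n ℂ) : ‖B * resolventAt z H‖ ≤ |z.im|⁻¹ * ‖B‖ := by
  rw [← Matrix.frobenius_norm_conjTranspose, Matrix.conjTranspose_mul,
    conjTranspose_resolventAt hH]
  refine (norm_resolventAt_mul_le hH (by simpa using hz) _).trans (le_of_eq ?_)
  rw [Matrix.frobenius_norm_conjTranspose]
  simp

/-- The resolvent identity. -/
theorem resolventAt_sub {H K : Matrix n n ℂ} (hH : H.IsHermitian) (hK : K.IsHermitian)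
    (hz : z.im ≠ 0) :
    resolventAt z (H + K) - resolventAt z H
      = - (resolventAt z H * K * resolventAt z (H + K)) := by
  have h1 := Matrix.nonsing_inv_mul _ (isUnit_det_sub hH hz)
  have h2 := Matrix.mul_nonsing_inv _ (isUnit_det_sub (hH.add hK) hz)
  have h3 : K = (H + K - z • (1 : Matrix n n ℂ)) - (H - z • (1 : Matrix n n ℂ)) := by abel
  unfold resolventAt
  generalize hS : (H - z • (1 : Matrix n n ℂ)) = S at *
  generalize hT : (H + K - z • (1 : Matrix n n ℂ)) = T at *
  rw [h3, Matrix.mul_sub, Matrix.sub_mul, h1, Matrix.mul_assoc, h2, Matrix.mul_one, Matrix.one_mul]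
  abel

end Frobenius

/-! ### Second order expansion of the trace of the resolvent. -/

section Expansion

variable {n : Type*} [Fintype n] [DecidableEq n] {z : ℂ}

theorem trace_resolventAt_lipschitz {H K : Matrix n n ℂ} (hH : H.IsHermitian)
    (hK : K.IsHermitian) (hz : z.im ≠ 0) :
    ‖(resolventAt z (H + K)).trace - (resolventAt z H).trace‖
      ≤ (|z.im|⁻¹) ^ 2 * (√(Fintype.card n) * ‖K‖) := by
  rw [← Matrix.trace_sub, resolventAt_sub hH hK hz, Matrix.trace_neg, norm_neg, Matrix.mul_assoc]
  refine (norm_trace_mul_le _ _).trans ?_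
  have h1 := norm_resolventAt_mul_le hH hz (1 : Matrix n n ℂ)
  rw [Matrix.mul_one] at h1
  have h2 := norm_mul_resolventAt_le (hH.add hK) hz K
  have h3 : ‖(1 : Matrix n n ℂ)‖ = √(Fintype.card n) := by
    have := congrArg NNReal.toReal (Matrix.frobenius_nnnorm_one (n := n) (α := ℂ))
    simpa using this
  rw [h3] at h1
  refine (mul_le_mul h1 h2 (norm_nonneg _) (by positivity)).trans (le_of_eq ?_)
  ring

theorem norm_trace_resolventAt_le {H : Matrix n n ℂ} (hH : H.IsHermitian) (hz : z.im ≠ 0) :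
    ‖(resolventAt z H).trace‖ ≤ |z.im|⁻¹ * Fintype.card n := by
  have h1 := norm_resolventAt_mul_le hH hz (1 : Matrix n n ℂ)
  have h3 : ‖(1 : Matrix n n ℂ)‖ = √(Fintype.card n) := by
    have := congrArg NNReal.toReal (Matrix.frobenius_nnnorm_one (n := n) (α := ℂ))
    simpa using this
  have h2 := norm_trace_mul_le (resolventAt z H) (1 : Matrix n n ℂ)
  rw [Matrix.mul_one] at h1 h2
  refine h2.trans ((mul_le_mul_of_nonneg_right h1 (norm_nonneg _)).trans (le_of_eq ?_))
  rw [h3, mul_assoc, Real.mul_self_sqrt (by positivity)]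

/-- The first order coefficient in the expansion of the trace of the resolvent. -/
def resLin (z : ℂ) (H B : Matrix n n ℂ) : ℂ :=
  - (resolventAt z H * B * resolventAt z H).trace

/-- The second order coefficient in the expansion of the trace of the resolvent. -/
def resQuad (z : ℂ) (H B : Matrix n n ℂ) : ℂ :=
  (resolventAt z H * B * (resolventAt z H * B * resolventAt z H)).trace

/-- Cauchy-Schwarz for the trace gives one Frobenius norm to each perturbation, so no power of the
dimension appears. The resolvents may differ, since remainder terms mix them at different points. -/
theorem norm_three_le {H H' H'' : Matrix n n ℂ} (hH : H.IsHermitian) (hH' : H'.IsHermitian)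
    (hH'' : H''.IsHermitian) (hz : z.im ≠ 0) (B C : Matrix n n ℂ) :
    ‖(resolventAt z H * B * (resolventAt z H' * C * resolventAt z H'')).trace‖
      ≤ (|z.im|⁻¹) ^ 3 * (‖B‖ * ‖C‖) := by
  refine (norm_trace_mul_le _ _).trans ?_
  have h1 := norm_resolventAt_mul_le hH hz B
  have h2 := (norm_mul_resolventAt_le hH'' hz (resolventAt z H' * C)).trans
    (mul_le_mul_of_nonneg_left (norm_resolventAt_mul_le hH' hz C) (by positivity))
  refine (mul_le_mul h1 h2 (norm_nonneg _) (by positivity)).trans (le_of_eq ?_)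
  ring

theorem norm_four_le {H₁ H₂ H₃ H₄ : Matrix n n ℂ} (h₁ : H₁.IsHermitian) (h₂ : H₂.IsHermitian)
    (h₃ : H₃.IsHermitian) (h₄ : H₄.IsHermitian) (hz : z.im ≠ 0) (B C D : Matrix n n ℂ) :
    ‖(resolventAt z H₁ * B * (resolventAt z H₂ * C * (resolventAt z H₃ * D *
      resolventAt z H₄))).trace‖ ≤ (|z.im|⁻¹) ^ 4 * (‖B‖ * ‖C‖ * ‖D‖) := by
  refine (norm_trace_mul_le _ _).trans ?_
  have e1 := norm_resolventAt_mul_le h₁ hz B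
  have e2 := norm_resolventAt_mul_le h₂ hz C
  have e3 := (norm_mul_resolventAt_le h₄ hz (resolventAt z H₃ * D)).trans
    (mul_le_mul_of_nonneg_left (norm_resolventAt_mul_le h₃ hz D) (by positivity))
  have e4 := (norm_mul_le (resolventAt z H₂ * C) (resolventAt z H₃ * D * resolventAt z H₄)).trans
    (mul_le_mul e2 e3 (norm_nonneg _) (by positivity))
  refine (mul_le_mul e1 e4 (norm_nonneg _) (by positivity)).trans (le_of_eq ?_)
  ring

/-- Serves integrability only: the linear term has zero expectation, so the factor `√n` is harmless.
-/
theorem norm_resLin_le {H B : Matrix n n ℂ} (hH : H.IsHermitian) (hz : z.im ≠ 0) :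
    ‖resLin z H B‖ ≤ (|z.im|⁻¹) ^ 2 * (√(Fintype.card n) * ‖B‖) := by
  rw [resLin, norm_neg, Matrix.mul_assoc]
  refine (norm_trace_mul_le _ _).trans ?_
  have h1 := norm_resolventAt_mul_le hH hz (1 : Matrix n n ℂ)
  rw [Matrix.mul_one] at h1
  have h2 := norm_mul_resolventAt_le hH hz B
  have h3 : ‖(1 : Matrix n n ℂ)‖ = √(Fintype.card n) := by
    have := congrArg NNReal.toReal (Matrix.frobenius_nnnorm_one (n := n) (α := ℂ))
    simpa using this
  rw [h3] at h1
  refine (mul_le_mul h1 h2 (norm_nonneg _) (by positivity)).trans (le_of_eq ?_)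
  ring

theorem norm_resQuad_le {H B : Matrix n n ℂ} (hH : H.IsHermitian) (hz : z.im ≠ 0) :
    ‖resQuad z H B‖ ≤ (|z.im|⁻¹) ^ 3 * ‖B‖ ^ 2 := by
  rw [sq ‖B‖]
  exact norm_three_le hH hH hH hz B B

theorem isHermitian_real_smul {m : Type*} {B : Matrix m m ℂ} (hB : B.IsHermitian) (t : ℝ) :
    ((t : ℂ) • B).IsHermitian := by
  rw [Matrix.IsHermitian, Matrix.conjTranspose_smul, hB.eq]
  simp

/-- The resolvent identity is inserted into itself once, which yields an exact remainder without
differentiation. -/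
theorem trace_resolventAt_taylor_two {H B : Matrix n n ℂ} (hH : H.IsHermitian)
    (hB : B.IsHermitian) (hz : z.im ≠ 0) (t : ℝ) :
    (resolventAt z (H + (t : ℂ) • B)).trace - (resolventAt z H).trace - t * resLin z H B
      = t ^ 2 * (resolventAt z H * B * (resolventAt z H * B *
        resolventAt z (H + (t : ℂ) • B))).trace := by
  have hid := resolventAt_sub hH (isHermitian_real_smul hB t) hz
  generalize resolventAt z (H + (t : ℂ) • B) = G' at *
  rw [resLin]
  generalize resolventAt z H = G at *
  have e1 : G' = G - (t : ℂ) • (G * B * G') := by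
    have : G' - G = -((t : ℂ) • (G * B * G')) := by rw [hid]; simp
    rw [sub_eq_iff_eq_add] at this
    conv_lhs => rw [this]
    abel
  have e2 : G' = G - (t : ℂ) • (G * B * G) + ((t : ℂ) ^ 2) • (G * B * (G * B * G')) := by
    have e1' : G * B * G' = G * B * (G - (t : ℂ) • (G * B * G')) := congrArg _ e1
    conv_lhs => rw [e1, e1']
    rw [Matrix.mul_sub, smul_sub, Matrix.mul_smul, smul_smul, ← sq]
    abel
  have e3 := congrArg Matrix.trace e2
  rw [Matrix.trace_add, Matrix.trace_sub, Matrix.trace_smul, Matrix.trace_smul, smul_eq_mul,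
    smul_eq_mul] at e3
  rw [e3]; ring

theorem resolventAt_sub_smul {H B : Matrix n n ℂ} (hH : H.IsHermitian)
    (hB : B.IsHermitian) (hz : z.im ≠ 0) (t : ℝ) :
    resolventAt z (H + (t : ℂ) • B) - resolventAt z H
      = - ((t : ℂ) • (resolventAt z H * B * resolventAt z (H + (t : ℂ) • B))) := by
  rw [resolventAt_sub hH (isHermitian_real_smul hB t) hz]
  simp

/-- Subtracting the quadratic term gains nothing here, but gives this bound the same left side as
the cubic one, so that either can be used according to the size of `t`. -/
theorem trace_resolventAt_expansion_le_two {H B : Matrix n n ℂ} (hH : H.IsHermitian)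
    (hB : B.IsHermitian) (hz : z.im ≠ 0) (t : ℝ) :
    ‖(resolventAt z (H + (t : ℂ) • B)).trace - (resolventAt z H).trace - t * resLin z H B
      - t ^ 2 * resQuad z H B‖ ≤ 2 * (|z.im|⁻¹) ^ 3 * t ^ 2 * ‖B‖ ^ 2 := by
  rw [trace_resolventAt_taylor_two hH hB hz, ← mul_sub, norm_mul]
  have h1 := norm_three_le hH hH (hH.add (isHermitian_real_smul hB t)) hz B B
  have h2 := norm_resQuad_le (B := B) hH hz
  have h3 : ‖((t : ℂ)) ^ 2‖ = t ^ 2 := by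
    rw [norm_pow, Complex.norm_real, Real.norm_eq_abs, sq_abs]
  rw [h3]
  calc t ^ 2 * _ ≤ t ^ 2 * ((|z.im|⁻¹) ^ 3 * (‖B‖ * ‖B‖) + (|z.im|⁻¹) ^ 3 * ‖B‖ ^ 2) :=
        mul_le_mul_of_nonneg_left ((norm_sub_le _ _).trans (add_le_add h1 h2)) (sq_nonneg t)
    _ = _ := by ring

theorem trace_resolventAt_expansion_le_three {H B : Matrix n n ℂ} (hH : H.IsHermitian)
    (hB : B.IsHermitian) (hz : z.im ≠ 0) (t : ℝ) :
    ‖(resolventAt z (H + (t : ℂ) • B)).trace - (resolventAt z H).trace - t * resLin z H B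
      - t ^ 2 * resQuad z H B‖ ≤ (|z.im|⁻¹) ^ 4 * |t| ^ 3 * ‖B‖ ^ 3 := by
  rw [trace_resolventAt_taylor_two hH hB hz, ← mul_sub, norm_mul, resQuad, ← Matrix.trace_sub,
    ← Matrix.mul_sub, ← Matrix.mul_sub, resolventAt_sub_smul hH hB hz]
  have h1 := norm_four_le hH hH hH (hH.add (isHermitian_real_smul hB t)) hz B B B
  rw [Matrix.mul_neg, Matrix.mul_smul, Matrix.mul_neg, Matrix.mul_smul, Matrix.trace_neg, norm_neg,
    Matrix.trace_smul, norm_smul, Complex.norm_real, norm_pow, Complex.norm_real,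
    Real.norm_eq_abs]
  calc |t| ^ 2 * (|t| * _) ≤ |t| ^ 2 * (|t| * ((|z.im|⁻¹) ^ 4 * (‖B‖ * ‖B‖ * ‖B‖))) := by gcongr
    _ = _ := by ring

/-- The three resolvents are replaced one at a time; each replacement inserts one factor `C` through
the resolvent identity, whence the constant 3. -/
theorem resQuad_lipschitz {H B C : Matrix n n ℂ} (hH : H.IsHermitian)
    (hC : C.IsHermitian) (hz : z.im ≠ 0) (t : ℝ) :
    ‖resQuad z (H + (t : ℂ) • C) B - resQuad z H B‖
      ≤ 3 * (|z.im|⁻¹) ^ 4 * |t| * ‖C‖ * ‖B‖ ^ 2 := by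
  have hH' := hH.add (isHermitian_real_smul hC t)
  have hid := resolventAt_sub_smul hH hC hz t
  have h1 := norm_four_le hH hH' hH' hH' hz C B B
  have h2 := norm_four_le hH hH hH' hH' hz B C B
  have h3 := norm_four_le hH hH hH hH' hz B B C
  rw [resQuad, resQuad]
  generalize resolventAt z (H + (t : ℂ) • C) = G' at *
  generalize resolventAt z H = G at *
  have e : G' * B * (G' * B * G') - G * B * (G * B * G)
      = (G' - G) * B * (G' * B * G') + G * B * ((G' - G) * B * G')
        + G * B * (G * B * (G' - G)) := by
    noncomm_ring
  have e2 : G' * B * (G' * B * G') - G * B * (G * B * G)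
      = -((t : ℂ) • (G * C * (G' * B * (G' * B * G')) + G * B * (G * C * (G' * B * G'))
        + G * B * (G * B * (G * C * G')))) := by
    rw [e, hid]
    simp only [Matrix.neg_mul, Matrix.mul_neg, Matrix.smul_mul, Matrix.mul_smul, smul_add,
      Matrix.mul_assoc]
    abel
  rw [← Matrix.trace_sub, e2, Matrix.trace_neg, norm_neg, Matrix.trace_smul, norm_smul,
    Complex.norm_real, Real.norm_eq_abs, Matrix.trace_add, Matrix.trace_add]
  calc |t| * _ ≤ |t| * ((|z.im|⁻¹) ^ 4 * (‖C‖ * ‖B‖ * ‖B‖) + (|z.im|⁻¹) ^ 4 * (‖B‖ * ‖C‖ * ‖B‖)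
        + (|z.im|⁻¹) ^ 4 * (‖B‖ * ‖B‖ * ‖C‖)) :=
        mul_le_mul_of_nonneg_left (norm_add₃_le.trans (add_le_add (add_le_add h1 h2) h3))
          (abs_nonneg t)
    _ = _ := by ring

end Expansion

/-! ### The rank inequality for traces of resolvents. -/

section Rank

variable {n : Type*} [Fintype n] [DecidableEq n] {z : ℂ}

/-- By cyclicity the trace may be computed on the range of `T`; in an orthonormal basis of the range
each diagonal coefficient is at most `c`. -/
theorem norm_trace_le_finrank_range {E : Type*} [NormedAddCommGroup E] [InnerProductSpace ℂ E]
    [FiniteDimensional ℂ E] (T : E →ₗ[ℂ] E) {c : ℝ} (hT : ∀ v, ‖T v‖ ≤ c * ‖v‖) :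
    ‖LinearMap.trace ℂ E T‖ ≤ Module.finrank ℂ (LinearMap.range T) * c := by
  have h : LinearMap.trace ℂ E T
      = LinearMap.trace ℂ (LinearMap.range T) (T.rangeRestrict ∘ₗ (LinearMap.range T).subtype) := by
    rw [LinearMap.trace_comp_comm']
    rfl
  rw [h, LinearMap.trace_eq_sum_inner _ (stdOrthonormalBasis ℂ (LinearMap.range T))]
  refine (norm_sum_le _ _).trans ?_
  have : ∀ i ∈ (Finset.univ : Finset (Fin (Module.finrank ℂ (LinearMap.range T)))),
      ‖inner ℂ (stdOrthonormalBasis ℂ (LinearMap.range T) i)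
        ((T.rangeRestrict ∘ₗ (LinearMap.range T).subtype)
          (stdOrthonormalBasis ℂ (LinearMap.range T) i))‖ ≤ c := by
    intro i _
    refine (norm_inner_le_norm _ _).trans ?_
    have h1 := (stdOrthonormalBasis ℂ (LinearMap.range T)).orthonormal.1 i
    have h2 := hT (stdOrthonormalBasis ℂ (LinearMap.range T) i : E)
    rw [Submodule.norm_coe, h1] at h2
    rw [h1, one_mul, ← mul_one c]
    exact h2
  refine (Finset.sum_le_sum this).trans (le_of_eq ?_)
  simp

theorem norm_trace_le_rank (M : Matrix n n ℂ) {c : ℝ}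
    (hM : ∀ v : n → ℂ, ‖WithLp.toLp 2 (M *ᵥ v)‖ ≤ c * ‖WithLp.toLp 2 v‖) :
    ‖M.trace‖ ≤ M.rank * c := by
  have h := norm_trace_le_finrank_range (Matrix.toEuclideanLin M) (c := c) (fun v => hM v.ofLp)
  rwa [Matrix.rank_eq_finrank_range_toLin M (EuclideanSpace.basisFun n ℂ).toBasis
    (EuclideanSpace.basisFun n ℂ).toBasis, ← Matrix.toEuclideanLin_eq_toLin_orthonormal,
    ← show LinearMap.trace ℂ _ (Matrix.toEuclideanLin M) = M.trace from by
      rw [Matrix.toEuclideanLin_eq_toLin_orthonormal, Matrix.trace_toLin_eq]]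

/-- The difference of the resolvents contains `K` as a factor, hence has rank at most that of `K`,
while its operator norm is at most twice that of a resolvent. -/
theorem norm_trace_resolventAt_sub_le_rank {H K : Matrix n n ℂ} (hH : H.IsHermitian)
    (hK : K.IsHermitian) (hz : z.im ≠ 0) :
    ‖(resolventAt z (H + K)).trace - (resolventAt z H).trace‖
      ≤ K.rank * (2 * |z.im|⁻¹) := by
  have hv : ∀ {A : Matrix n n ℂ}, A.IsHermitian → ∀ v : n → ℂ,
      ‖WithLp.toLp 2 (resolventAt z A *ᵥ v)‖ ≤ |z.im|⁻¹ * ‖WithLp.toLp 2 v‖ := by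
    intro A hA v
    have := norm_resolventAt_mul_le hA hz (Matrix.replicateCol Unit v)
    rwa [← Matrix.replicateCol_mulVec, Matrix.frobenius_norm_replicateCol,
      Matrix.frobenius_norm_replicateCol] at this
  have hid := resolventAt_sub hH hK hz
  rw [← Matrix.trace_sub, hid, Matrix.trace_neg, norm_neg]
  have h1 : ‖(resolventAt z H * K * resolventAt z (H + K)).trace‖
      ≤ (resolventAt z H * K * resolventAt z (H + K)).rank * (2 * |z.im|⁻¹) := by
    refine norm_trace_le_rank _ fun v => ?_
    rw [← neg_neg (resolventAt z H * K * resolventAt z (H + K)), ← hid, neg_sub, Matrix.sub_mulVec,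
      WithLp.toLp_sub]
    refine (norm_sub_le _ _).trans ?_
    linarith [hv hH v, hv (hH.add hK) v]
  refine h1.trans (mul_le_mul_of_nonneg_right ?_ (by positivity))
  exact_mod_cast (Matrix.rank_mul_le_left _ _).trans (Matrix.rank_mul_le_right _ _)

end Rank

end LinearProcessESD

end

/-! ### The Stieltjes transform as a smooth function of the array of entries. -/

noncomputable section

namespace LinearProcessESD

open scoped Matrix Matrix.Norms.Frobenius

/-- A bounded measurable functional on a real vector space that has a second order expansion in
every direction, with a remainder controlled by a size function `ρ` of the direction. -/
structure IsSmoothFunctional {V : Type*} [AddCommGroup V] [Module ℝ V] [MeasurableSpace V]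
    (ρ : V → ℝ) (c₂ c₃ : ℝ) (u : V → ℂ) (L Q : V → V → ℂ) : Prop where
  measurable : Measurable u
  measurable_lin : ∀ v, Measurable fun x => L x v
  measurable_quad : ∀ v, Measurable fun x => Q x v
  bounded : ∃ C, ∀ x, ‖u x‖ ≤ C
  bounded_lin : ∀ v, ∃ C, ∀ x, ‖L x v‖ ≤ C
  norm_quad_le : ∀ x v, ‖Q x v‖ ≤ c₂ * ρ v ^ 2
  expansion_two : ∀ x v (t : ℝ),
    ‖u (x + t • v) - u x - t * L x v - t ^ 2 * Q x v‖ ≤ c₂ * t ^ 2 * ρ v ^ 2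
  expansion_three : ∀ x v (t : ℝ),
    ‖u (x + t • v) - u x - t * L x v - t ^ 2 * Q x v‖ ≤ c₃ * |t| ^ 3 * ρ v ^ 3
  quad_lipschitz : ∀ x v w (t : ℝ),
    ‖Q (x + t • w) v - Q x v‖ ≤ c₃ * |t| * ρ w * ρ v ^ 2

/-- The complexification of `wignerMatrix`. -/
def wignerC (n : ℕ) (x : ℕ+ → ℕ+ → ℝ) : Matrix (Fin n) (Fin n) ℂ :=
  (wignerMatrix x n).map (fun t : ℝ => (t : ℂ))

theorem wignerC_apply (n : ℕ) (x : ℕ+ → ℕ+ → ℝ) (k l : Fin n) :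
    wignerC n x k l = ((1 / Real.sqrt n) * (if l ≤ k then x (Nat.succPNat k) (Nat.succPNat l)
      else x (Nat.succPNat l) (Nat.succPNat k)) : ℝ) := rfl

theorem isHermitian_wignerC (n : ℕ) (x : ℕ+ → ℕ+ → ℝ) : (wignerC n x).IsHermitian := by
  ext k l
  rw [Matrix.conjTranspose_apply, wignerC_apply, wignerC_apply]
  simp only [RCLike.star_def, Complex.conj_ofReal]
  rcases lt_trichotomy k l with h | h | h
  · rw [if_pos h.le, if_neg (not_le.mpr h)]
  · rw [h]
  · rw [if_pos h.le, if_neg (not_le.mpr h)]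

theorem wignerC_add (n : ℕ) (x y : ℕ+ → ℕ+ → ℝ) :
    wignerC n (x + y) = wignerC n x + wignerC n y := by
  ext k l
  rw [Matrix.add_apply, wignerC_apply, wignerC_apply, wignerC_apply]
  split_ifs <;> simp [mul_add]

theorem wignerC_smul (n : ℕ) (t : ℝ) (x : ℕ+ → ℕ+ → ℝ) :
    wignerC n (t • x) = (t : ℂ) • wignerC n x := by
  ext k l
  rw [Matrix.smul_apply, wignerC_apply, wignerC_apply]
  split_ifs <;> simp [mul_left_comm]

theorem continuous_wignerC (n : ℕ) : Continuous (wignerC n) := by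
  refine continuous_matrix fun k l => ?_
  simp only [wignerC_apply]
  split_ifs <;> fun_prop

variable {z : ℂ}

theorem continuous_resolventAt_wignerC (hz : z.im ≠ 0) (n : ℕ) :
    Continuous fun x : ℕ+ → ℕ+ → ℝ => resolventAt z (wignerC n x) := by
  have hc : Continuous fun x : ℕ+ → ℕ+ → ℝ =>
      wignerC n x - z • (1 : Matrix (Fin n) (Fin n) ℂ) :=
    (continuous_wignerC n).sub continuous_const
  simp only [resolventAt, Matrix.inv_def, Ring.inverse_eq_inv']
  exact (hc.matrix_det.inv₀ fun x => (isUnit_det_sub (isHermitian_wignerC n x) hz).ne_zero).smul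
    hc.matrix_adjugate

/-- The Stieltjes transform as a function of the array of entries. -/
def stieltjesArray (n : ℕ) (z : ℂ) (x : ℕ+ → ℕ+ → ℝ) : ℂ := stieltjes (wignerMatrix x n) z

theorem stieltjesArray_eq (n : ℕ) (z : ℂ) (x : ℕ+ → ℕ+ → ℝ) :
    stieltjesArray n z x = (1 / (n : ℂ)) * (resolventAt z (wignerC n x)).trace := rfl

theorem continuous_stieltjesArray (hz : z.im ≠ 0) (n : ℕ) : Continuous (stieltjesArray n z) := by
  simp only [funext (stieltjesArray_eq n z)]
  exact continuous_const.mul (continuous_resolventAt_wignerC hz n).matrix_trace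

theorem norm_stieltjesArray_le (hz : z.im ≠ 0) (n : ℕ) (x : ℕ+ → ℕ+ → ℝ) :
    ‖stieltjesArray n z x‖ ≤ |z.im|⁻¹ := by
  rw [stieltjesArray_eq, norm_mul]
  have h := norm_trace_resolventAt_le (isHermitian_wignerC n x) hz
  rw [Fintype.card_fin] at h
  rcases Nat.eq_zero_or_pos n with rfl | hn
  · simp
  · have hn' : (0 : ℝ) < n := by exact_mod_cast hn
    calc ‖1 / (n : ℂ)‖ * _ ≤ ‖1 / (n : ℂ)‖ * (|z.im|⁻¹ * n) :=
          mul_le_mul_of_nonneg_left h (norm_nonneg _)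
      _ = |z.im|⁻¹ := by simp; field_simp

theorem isSmoothFunctional_stieltjesArray (hz : z.im ≠ 0) (n : ℕ) :
    IsSmoothFunctional (fun v => ‖wignerC n v‖) (2 * (|z.im|⁻¹) ^ 3 / n) (3 * (|z.im|⁻¹) ^ 4 / n)
      (stieltjesArray n z) (fun x v => (1 / (n : ℂ)) * resLin z (wignerC n x) (wignerC n v))
      (fun x v => (1 / (n : ℂ)) * resQuad z (wignerC n x) (wignerC n v)) := by
  have hn : ‖1 / (n : ℂ)‖ = 1 / n := by simp
  have hG := continuous_resolventAt_wignerC hz n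
  refine ⟨(continuous_stieltjesArray hz n).measurable, fun v => ?_, fun v => ?_,
    ⟨_, norm_stieltjesArray_le hz n⟩, fun v => ?_, fun x v => ?_, fun x v t => ?_, fun x v t => ?_,
    fun x v w t => ?_⟩
  · refine Continuous.measurable (continuous_const.mul ?_)
    exact ((hG.matrix_mul continuous_const).matrix_mul hG).matrix_trace.neg
  · refine Continuous.measurable (continuous_const.mul ?_)
    exact ((hG.matrix_mul continuous_const).matrix_mul
      ((hG.matrix_mul continuous_const).matrix_mul hG)).matrix_trace
  · refine ⟨1 / n * ((|z.im|⁻¹) ^ 2 * (√(Fintype.card (Fin n)) * ‖wignerC n v‖)), fun x => ?_⟩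
    rw [norm_mul, hn]
    exact mul_le_mul_of_nonneg_left (norm_resLin_le (isHermitian_wignerC n x) hz) (by positivity)
  · rw [norm_mul, hn]
    refine (mul_le_mul_of_nonneg_left (norm_resQuad_le (isHermitian_wignerC n x) hz)
      (by positivity)).trans ?_
    rw [← mul_assoc]
    refine mul_le_mul_of_nonneg_right ?_ (by positivity)
    rw [one_div_mul_eq_div]
    gcongr
    nlinarith [show 0 ≤ (|z.im|⁻¹) ^ 3 by positivity]
  · have h := trace_resolventAt_expansion_le_two (isHermitian_wignerC n x)
      (isHermitian_wignerC n v) hz t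
    rw [stieltjesArray_eq, stieltjesArray_eq, wignerC_add, wignerC_smul]
    rw [show ∀ a b c d e f : ℂ, a * b - a * c - d * (a * e) - d ^ 2 * (a * f)
      = a * (b - c - d * e - d ^ 2 * f) by intros; ring, norm_mul, hn]
    refine (mul_le_mul_of_nonneg_left h (by positivity)).trans (le_of_eq ?_)
    ring
  · have h := trace_resolventAt_expansion_le_three (isHermitian_wignerC n x)
      (isHermitian_wignerC n v) hz t
    rw [stieltjesArray_eq, stieltjesArray_eq, wignerC_add, wignerC_smul]
    rw [show ∀ a b c d e f : ℂ, a * b - a * c - d * (a * e) - d ^ 2 * (a * f)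
      = a * (b - c - d * e - d ^ 2 * f) by intros; ring, norm_mul, hn]
    refine (mul_le_mul_of_nonneg_left h (by positivity)).trans ?_
    rw [← mul_assoc, ← mul_assoc]
    refine mul_le_mul_of_nonneg_right (mul_le_mul_of_nonneg_right ?_ (by positivity))
      (by positivity)
    rw [one_div_mul_eq_div]
    gcongr
    nlinarith [show 0 ≤ (|z.im|⁻¹) ^ 4 by positivity]
  · have h := resQuad_lipschitz (B := wignerC n v) (isHermitian_wignerC n x)
      (isHermitian_wignerC n w) hz t
    rw [wignerC_add, wignerC_smul, ← mul_sub, norm_mul, hn]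
    refine (mul_le_mul_of_nonneg_left h (by positivity)).trans (le_of_eq ?_)
    ring

theorem stieltjesArray_lipschitz (hz : z.im ≠ 0) (n : ℕ) (x v : ℕ+ → ℕ+ → ℝ) :
    ‖stieltjesArray n z (x + v) - stieltjesArray n z x‖
      ≤ (|z.im|⁻¹) ^ 2 * (‖wignerC n v‖ / √n) := by
  have h := trace_resolventAt_lipschitz (isHermitian_wignerC n x) (isHermitian_wignerC n v) hz
  rw [stieltjesArray_eq, stieltjesArray_eq, wignerC_add, ← mul_sub, norm_mul,
    show ‖1 / (n : ℂ)‖ = 1 / n by simp]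
  refine (mul_le_mul_of_nonneg_left h (by positivity)).trans (le_of_eq ?_)
  rcases Nat.eq_zero_or_pos n with rfl | hn
  · simp
  · have hs : √(n : ℝ) ≠ 0 := by positivity
    have hn' : (n : ℝ) = √n * √n := (Real.mul_self_sqrt (by positivity)).symm
    rw [Fintype.card_fin, show (1 : ℝ) / n = 1 / (√n * √n) by rw [← hn']]
    field_simp

theorem norm_wignerC_sq_le (n : ℕ) (v : ℕ+ → ℕ+ → ℝ) :
    ‖wignerC n v‖ ^ 2 ≤ 2 / n *
      ∑ i ∈ Finset.range n, ∑ j ∈ Finset.range (i + 1),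
        v (Nat.succPNat i) (Nat.succPNat j) ^ 2 := by
  rw [frobenius_norm_sq]
  set f : ℕ → ℕ → ℝ := fun i j => v (Nat.succPNat i) (Nat.succPNat j) ^ 2 with hf
  -- Each entry off the diagonal occurs twice in the matrix; diagonal entries are also counted
  -- twice, which gives the uniform factor 2.
  have hentry : ∀ k l : Fin n, ‖wignerC n v k l‖ ^ 2
      ≤ 1 / n * ((if (l : ℕ) ≤ k then f k l else 0) + (if (k : ℕ) ≤ l then f l k else 0)) := by
    intro k l
    have hn : ((1 / √(n : ℝ)) ^ 2) = 1 / n := by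
      rw [div_pow, one_pow, Real.sq_sqrt (by positivity)]
    have hf0 : ∀ i j, 0 ≤ f i j := fun i j => sq_nonneg _
    rw [wignerC_apply, Complex.norm_real, Real.norm_eq_abs, sq_abs, mul_pow, hn]
    refine mul_le_mul_of_nonneg_left ?_ (by positivity)
    by_cases h : l ≤ k
    · rw [if_pos h, if_pos (show (l : ℕ) ≤ k by exact_mod_cast h)]
      have : 0 ≤ (if (k : ℕ) ≤ l then f l k else 0) := by split_ifs; exacts [hf0 _ _, le_rfl]
      simpa [hf] using this
    · rw [if_neg h, if_pos (show (k : ℕ) ≤ l by exact_mod_cast (not_le.mp h).le)]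
      have : 0 ≤ (if (l : ℕ) ≤ k then f k l else 0) := by split_ifs; exacts [hf0 _ _, le_rfl]
      simpa [hf] using this
  have hsum : ∑ k : Fin n, ∑ l : Fin n, (if (l : ℕ) ≤ k then f k l else 0)
      = ∑ i ∈ Finset.range n, ∑ j ∈ Finset.range (i + 1), f i j := by
    rw [Finset.sum_range]
    refine Finset.sum_congr rfl fun k _ => ?_
    rw [← Finset.sum_range (fun l => if l ≤ (k : ℕ) then f k l else 0), ← Finset.sum_filter]
    refine Finset.sum_congr ?_ fun _ _ => rfl
    ext j
    simp only [Finset.mem_filter, Finset.mem_range]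
    omega
  calc ∑ k : Fin n, ∑ l : Fin n, ‖wignerC n v k l‖ ^ 2
      ≤ ∑ k : Fin n, ∑ l : Fin n,
        1 / n * ((if (l : ℕ) ≤ k then f k l else 0) + (if (k : ℕ) ≤ l then f l k else 0)) :=
        Finset.sum_le_sum fun k _ => Finset.sum_le_sum fun l _ => hentry k l
    _ = 1 / n * (∑ k : Fin n, ∑ l : Fin n, (if (l : ℕ) ≤ k then f k l else 0)
        + ∑ k : Fin n, ∑ l : Fin n, (if (k : ℕ) ≤ l then f l k else 0)) := by
        simp only [← Finset.mul_sum, Finset.sum_add_distrib]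
    _ = _ := by
        rw [Finset.sum_comm (f := fun k l : Fin n => if (k : ℕ) ≤ l then f l k else 0), hsum]
        ring

theorem rank_add_le {m : Type*} [Fintype m] (A B : Matrix m m ℂ) :
    (A + B).rank ≤ A.rank + B.rank := by
  rw [Matrix.rank, Matrix.mulVecLin_add]
  exact (Submodule.finrank_mono (LinearMap.range_add_le _ _)).trans
    (Submodule.finrank_add_le_finrank_add_finrank _ _)

/-- A row of the lower triangle fills part of one row and of one column of the symmetric matrix,
hence a perturbation of rank at most 2. -/
theorem stieltjesArray_sub_le_of_row (hz : z.im ≠ 0) (n : ℕ) (i : ℕ) (x v : ℕ+ → ℕ+ → ℝ)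
    (hv : ∀ i' j, i' ≠ Nat.succPNat i → v i' j = 0) :
    ‖stieltjesArray n z (x + v) - stieltjesArray n z x‖ ≤ 4 * |z.im|⁻¹ / n := by
  have h := norm_trace_resolventAt_sub_le_rank (isHermitian_wignerC n x)
    (isHermitian_wignerC n v) hz
  have hr : (wignerC n v).rank ≤ 2 := by
    -- The diagonal entry is assigned to the first rank-one term: `≤ i` there, `< i` in the second.
    have hd : wignerC n v
        = Matrix.vecMulVec (fun k : Fin n => if (k : ℕ) = i then (1 : ℂ) else 0)
            (fun l : Fin n => if (l : ℕ) ≤ i then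
              (((1 / √n) * v (Nat.succPNat i) (Nat.succPNat l) : ℝ) : ℂ) else 0)
          + Matrix.vecMulVec (fun k : Fin n => if (k : ℕ) < i then
              (((1 / √n) * v (Nat.succPNat i) (Nat.succPNat k) : ℝ) : ℂ) else 0)
            (fun l : Fin n => if (l : ℕ) = i then (1 : ℂ) else 0) := by
      ext k l
      rw [wignerC_apply, Matrix.add_apply, Matrix.vecMulVec_apply, Matrix.vecMulVec_apply]
      have hv' : ∀ (a : ℕ) (b : ℕ+), a ≠ i → v (Nat.succPNat a) b = 0 := fun a b hab =>
        hv _ _ fun h => hab (Nat.succPNat_injective h)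
      by_cases h : l ≤ k
      · rw [if_pos h]
        have h' : (l : ℕ) ≤ k := by exact_mod_cast h
        by_cases hk : (k : ℕ) = i
        · rw [if_pos hk, if_pos (show (l : ℕ) ≤ i by omega),
            if_neg (show ¬ (k : ℕ) < i by omega), hk]
          simp
        · have h2 : (if (k : ℕ) < i then
              (((1 / √n) * v (Nat.succPNat i) (Nat.succPNat k) : ℝ) : ℂ) else 0)
              * (if (l : ℕ) = i then (1 : ℂ) else 0) = 0 := by
            by_cases hki : (k : ℕ) < i
            · rw [if_neg (show ¬ (l : ℕ) = i by omega), mul_zero]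
            · rw [if_neg hki, zero_mul]
          rw [hv' _ _ hk, if_neg hk, h2]
          simp
      · rw [if_neg h]
        have h' : (k : ℕ) < l := by exact_mod_cast not_le.mp h
        by_cases hl : (l : ℕ) = i
        · have : (k : ℕ) ≠ i := by omega
          rw [if_neg this, if_pos (show (k : ℕ) < i by omega), if_pos hl, hl]
          simp
        · have h2 : (if (k : ℕ) = i then (1 : ℂ) else 0) * (if (l : ℕ) ≤ i then
              (((1 / √n) * v (Nat.succPNat i) (Nat.succPNat l) : ℝ) : ℂ) else 0) = 0 := by
            by_cases hki : (k : ℕ) = i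
            · rw [if_neg (show ¬ (l : ℕ) ≤ i by omega), mul_zero]
            · rw [if_neg hki, zero_mul]
          rw [hv' _ _ hl, if_neg hl, h2]
          simp
    rw [hd]
    exact (rank_add_le _ _).trans
      (add_le_add (Matrix.rank_vecMulVec_le _ _) (Matrix.rank_vecMulVec_le _ _))
  have hr' : ((wignerC n v).rank : ℝ) ≤ 2 := by exact_mod_cast hr
  rw [stieltjesArray_eq, stieltjesArray_eq, wignerC_add, ← mul_sub, norm_mul,
    show ‖1 / (n : ℂ)‖ = 1 / n by simp]
  calc 1 / (n : ℝ) * _ ≤ 1 / (n : ℝ) * (2 * (2 * |z.im|⁻¹)) :=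
        mul_le_mul_of_nonneg_left (h.trans (mul_le_mul_of_nonneg_right hr' (by positivity)))
          (by positivity)
    _ = _ := by ring

end LinearProcessESD

end

/-! ### Lindeberg replacement: one variable, one row, a sum of independent rows. -/

noncomputable section

namespace LinearProcessESD

/-- The increments are added one at a time. A small coefficient is handled by the Lipschitz bound on
`Q`, a large one by twice its uniform bound: a factor `|t j|` multiplied later by the square of
another innovation need not be integrable. -/
theorem IsSmoothFunctional.quad_sub_le {V : Type*} [AddCommGroup V] [Module ℝ V]
    [MeasurableSpace V] {ρ : V → ℝ} {c₂ c₃ : ℝ} {u : V → ℂ} {L Q : V → V → ℂ}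
    (h : IsSmoothFunctional ρ c₂ c₃ u L Q) (hρ : ∀ v, 0 ≤ ρ v)
    (hc₃ : 0 ≤ c₃) {ι : Type*} (S : Finset ι) (x v : V) (t : ι → ℝ) (w : ι → V) {τ : ℝ}
    (hτ : 0 ≤ τ) :
    ‖Q (x + ∑ j ∈ S, t j • w j) v - Q x v‖
      ≤ ∑ j ∈ S, ρ v ^ 2 * (c₃ * τ * ρ (w j) + 2 * c₂ * (if τ < |t j| then 1 else 0)) := by
  classical
  induction S using Finset.induction_on generalizing x with
  | empty => simp
  | insert i S hi ih =>
    rw [Finset.sum_insert hi, Finset.sum_insert hi, ← add_assoc]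
    have h1 := ih (x + t i • w i)
    have h2 : ‖Q (x + t i • w i) v - Q x v‖
        ≤ ρ v ^ 2 * (c₃ * τ * ρ (w i) + 2 * c₂ * (if τ < |t i| then 1 else 0)) := by
      split_ifs with hti
      · have h3 := (norm_sub_le _ _).trans
          (add_le_add (h.norm_quad_le (x + t i • w i) v) (h.norm_quad_le x v))
        have h4 : 0 ≤ ρ v ^ 2 * (c₃ * τ * ρ (w i)) := by have := hρ (w i); positivity
        linarith
      · refine (h.quad_lipschitz x v (w i) (t i)).trans ?_
        have h4 : |t i| ≤ τ := not_lt.mp hti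
        calc c₃ * |t i| * ρ (w i) * ρ v ^ 2 ≤ c₃ * τ * ρ (w i) * ρ v ^ 2 := by
              have := hρ (w i); gcongr
          _ = _ := by ring
    calc _ = ‖(Q (x + t i • w i + ∑ j ∈ S, t j • w j) v - Q (x + t i • w i) v)
          + (Q (x + t i • w i) v - Q x v)‖ := by congr 1; ring
      _ ≤ _ := (norm_add_le _ _).trans (by linarith)

section Average

theorem integral_sub_sub {α : Type*} [MeasurableSpace α] {μ : Measure α} {f g h : α → ℂ}
    (hf : Integrable f μ) (hg : Integrable g μ) (hh : Integrable h μ) :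
    ∫ a, (f a - g a - h a) ∂μ = ∫ a, f a ∂μ - ∫ a, g a ∂μ - ∫ a, h a ∂μ := by
  rw [integral_sub (f := fun a => f a - g a) (hf.sub hg) hh, integral_sub hf hg]

theorem integral_sub_sub_sub {α : Type*} [MeasurableSpace α] {μ : Measure α} {f g h k : α → ℂ}
    (hf : Integrable f μ) (hg : Integrable g μ) (hh : Integrable h μ) (hk : Integrable k μ) :
    ∫ a, (f a - g a - h a - k a) ∂μ
      = ∫ a, f a ∂μ - ∫ a, g a ∂μ - ∫ a, h a ∂μ - ∫ a, k a ∂μ := by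
  rw [integral_sub (f := fun a => f a - g a - h a) ((hf.sub hg).sub hh) hk,
    integral_sub_sub hf hg hh]

theorem integrable_comp_of_norm_le {α : Type*} [MeasurableSpace α]
    {V : Type*} [MeasurableSpace V] {f : V → ℂ} (hf : Measurable f)
    {C : ℝ} (hC : ∀ x, ‖f x‖ ≤ C) {μ : Measure α} [IsFiniteMeasure μ] {A : α → V}
    (hA : Measurable A) : Integrable (fun a => f (A a)) μ :=
  Integrable.of_bound (hf.comp hA).aestronglyMeasurable C (ae_of_all _ fun _ => hC _)

theorem norm_integral_le_of_forall_norm_le {α : Type*} [MeasurableSpace α] {f : α → ℂ} {C : ℝ}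
    (hC : ∀ x, ‖f x‖ ≤ C) (μ : Measure α) [IsProbabilityMeasure μ] : ‖∫ x, f x ∂μ‖ ≤ C := by
  simpa using norm_integral_le_of_norm_le_const (μ := μ) (ae_of_all _ hC)

variable {V : Type*} [AddCommGroup V] [Module ℝ V] [MeasurableSpace V] [MeasurableAdd₂ V]
  [MeasurableSMul₂ ℝ V]

theorem measurable_add_smul (v : V) : Measurable fun p : V × ℝ => p.1 + p.2 • v := by fun_prop

theorem measurable_integral_add_smul {f : V → ℂ} (hf : Measurable f) (v : V) (ν : Measure ℝ)
    [SFinite ν] : Measurable fun x => ∫ g, f (x + g • v) ∂ν :=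
  ((hf.comp (measurable_add_smul v)).stronglyMeasurable.integral_prod_right').measurable

/-- All bounds are uniform in the base point, so they survive averaging with the same constants.
This stability is why `L` and `Q` are carried as data, and it lets a Gaussian variable already
substituted be absorbed into the functional. -/
theorem IsSmoothFunctional.average {ρ : V → ℝ} {c₂ c₃ : ℝ} {u : V → ℂ} {L Q : V → V → ℂ}
    (h : IsSmoothFunctional ρ c₂ c₃ u L Q) (w : V) (ν : Measure ℝ) [IsProbabilityMeasure ν] :
    IsSmoothFunctional ρ c₂ c₃ (fun x => ∫ g, u (x + g • w) ∂ν)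
      (fun x v => ∫ g, L (x + g • w) v ∂ν) (fun x v => ∫ g, Q (x + g • w) v ∂ν) := by
  obtain ⟨C, hC⟩ := h.bounded
  have hm : ∀ x : V, Measurable fun g : ℝ => x + g • w := fun x => by fun_prop
  have iu : ∀ x : V, Integrable (fun g : ℝ => u (x + g • w)) ν := fun x =>
    integrable_comp_of_norm_le h.measurable hC (hm x)
  have iL : ∀ x v : V, Integrable (fun g : ℝ => L (x + g • w) v) ν := fun x v =>
    let ⟨_, hD⟩ := h.bounded_lin v
    integrable_comp_of_norm_le (f := fun x => L x v) (h.measurable_lin v) hD (hm x)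
  have iQ : ∀ x v : V, Integrable (fun g : ℝ => Q (x + g • w) v) ν := fun x v =>
    integrable_comp_of_norm_le (f := fun x => Q x v) (h.measurable_quad v)
      (fun x => h.norm_quad_le x v) (hm x)
  have hexp : ∀ (x v : V) (t : ℝ), (∫ g, u (x + t • v + g • w) ∂ν) - (∫ g, u (x + g • w) ∂ν)
      - t * (∫ g, L (x + g • w) v ∂ν) - t ^ 2 * (∫ g, Q (x + g • w) v ∂ν)
      = ∫ g, (u (x + g • w + t • v) - u (x + g • w) - t * L (x + g • w) v
        - t ^ 2 * Q (x + g • w) v) ∂ν := by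
    intro x v t
    have i1 : Integrable (fun g : ℝ => u (x + g • w + t • v)) ν := by
      simpa only [add_right_comm] using iu (x + t • v)
    rw [integral_sub_sub_sub i1 (iu x) ((iL x v).const_mul _) ((iQ x v).const_mul _),
      integral_const_mul, integral_const_mul]
    simp only [add_right_comm]
  refine ⟨measurable_integral_add_smul h.measurable w ν,
    fun v => measurable_integral_add_smul (h.measurable_lin v) w ν,
    fun v => measurable_integral_add_smul (h.measurable_quad v) w ν,
    ⟨C, fun x => norm_integral_le_of_forall_norm_le (fun _ => hC _) ν⟩, fun v => ?_,
    fun x v => norm_integral_le_of_forall_norm_le (fun _ => h.norm_quad_le _ v) ν,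
    fun x v t => ?_, fun x v t => ?_, fun x v w' t => ?_⟩
  · obtain ⟨D, hD⟩ := h.bounded_lin v
    exact ⟨D, fun x => norm_integral_le_of_forall_norm_le (fun _ => hD _) ν⟩
  · rw [hexp]
    exact norm_integral_le_of_forall_norm_le (fun _ => h.expansion_two _ v t) ν
  · rw [hexp]
    exact norm_integral_le_of_forall_norm_le (fun _ => h.expansion_three _ v t) ν
  · rw [← integral_sub (iQ _ v) (iQ _ v)]
    simp only [add_right_comm x (t • w')]
    exact norm_integral_le_of_forall_norm_le (fun _ => h.quad_lipschitz _ v w' t) ν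

end Average

section Step

variable {Ω : Type*} {m mΩ : MeasurableSpace Ω} {P : Measure Ω} [IsProbabilityMeasure P]

theorem integral_ofReal_mul_eq_condExp (hm : m ≤ mΩ) {f : Ω → ℝ}
    (hf : Integrable f P) {W : Ω → ℂ} (hW : Measurable[m] W) {C : ℝ} (hC : ∀ ω, ‖W ω‖ ≤ C) :
    ∫ ω, (f ω : ℂ) * W ω ∂P = ∫ ω, ((P[f | m]) ω : ℂ) * W ω ∂P := by
  have hWs : StronglyMeasurable[m] W := hW.stronglyMeasurable
  have hi : Integrable (f • W) P :=
    hf.smul_bdd C (hWs.mono hm).aestronglyMeasurable (ae_of_all _ hC)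
  have h := condExp_smul_of_aestronglyMeasurable_right hf hi hWs.aestronglyMeasurable
  have h2 := integral_condExp (μ := P) (f := f • W) hm
  rw [integral_congr_ae h] at h2
  simpa using h2.symm

variable {V : Type*} [AddCommGroup V] [Module ℝ V] [MeasurableSpace V] [MeasurableAdd₂ V]
  [MeasurableSMul₂ ℝ V] {ρ : V → ℝ} {c₂ c₃ : ℝ} {u : V → ℂ} {L Q : V → V → ℂ}

/-- Both sides are expanded at `A`. The linear terms vanish, by the martingale property on one side
and centering on the other; the quadratic terms differ only by the fluctuation of `d²` around its
mean. Separate majorants `φ` and `ψ` are allowed because `d` has only two moments while the Gaussian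
law has three. -/
theorem IsSmoothFunctional.swap_step (h : IsSmoothFunctional ρ c₂ c₃ u L Q)
    (hm : m ≤ mΩ) {A : Ω → V} (hA : Measurable[m] A) {d : Ω → ℝ}
    (hd : Measurable d) (hd2 : MemLp d 2 P) (hmart : P[d | m] =ᵐ[P] 0) (v : V)
    (ν : Measure ℝ) [IsProbabilityMeasure ν] (hν2 : MemLp id 2 ν) (hν0 : ∫ g, g ∂ν = 0)
    (hν : ∫ g, g ^ 2 ∂ν = ∫ ω, d ω ^ 2 ∂P) {φ ψ : ℝ → ℝ}
    (hφ : ∀ x (t : ℝ), ‖u (x + t • v) - u x - t * L x v - t ^ 2 * Q x v‖ ≤ φ t)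
    (hψ : ∀ x (t : ℝ), ‖u (x + t • v) - u x - t * L x v - t ^ 2 * Q x v‖ ≤ ψ t)
    (hφi : Integrable (fun ω => φ (d ω)) P) (hψi : Integrable ψ ν) :
    ‖∫ ω, u (A ω + d ω • v) ∂P - ∫ ω, ∫ g, u (A ω + g • v) ∂ν ∂P‖
      ≤ ‖∫ ω, ((d ω ^ 2 - ∫ ω', d ω' ^ 2 ∂P : ℝ) : ℂ) * Q (A ω) v ∂P‖
        + ∫ ω, φ (d ω) ∂P + ∫ g, ψ g ∂ν := by
  obtain ⟨C, hC⟩ := h.bounded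
  obtain ⟨D, hD⟩ := h.bounded_lin v
  set s := ∫ ω, d ω ^ 2 ∂P with hs
  have hA' : Measurable A := hA.mono hm le_rfl
  have hd1 : Integrable d P := hd2.integrable (by norm_num)
  have hdsq : Integrable (fun ω => d ω ^ 2) P := hd2.integrable_sq
  have hg1 : Integrable (fun g : ℝ => g) ν := hν2.integrable (by norm_num)
  have hgsq : Integrable (fun g : ℝ => g ^ 2) ν := hν2.integrable_sq
  -- the Gaussian side
  have hG : ∀ x, ‖(∫ g, u (x + g • v) ∂ν) - u x - s * Q x v‖ ≤ ∫ g, ψ g ∂ν := by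
    intro x
    have i1 : Integrable (fun g : ℝ => u (x + g • v)) ν :=
      integrable_comp_of_norm_le h.measurable hC (by fun_prop)
    have i2 : Integrable (fun g : ℝ => (g : ℂ) * L x v) ν := hg1.ofReal.mul_const _
    have i3 : Integrable (fun g : ℝ => (g : ℂ) ^ 2 * Q x v) ν := by
      simpa using (hgsq.ofReal (𝕜 := ℂ)).mul_const (Q x v)
    have e : (∫ g, u (x + g • v) ∂ν) - u x - s * Q x v
        = ∫ g : ℝ, (u (x + g • v) - u x - g * L x v - g ^ 2 * Q x v) ∂ν := by
      rw [integral_sub_sub_sub i1 (integrable_const _) i2 i3, integral_mul_const,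
        integral_mul_const, integral_complex_ofReal, hν0]
      simp only [← Complex.ofReal_pow]
      rw [integral_complex_ofReal, hν]
      simp
    rw [e]
    exact norm_integral_le_of_norm_le hψi (ae_of_all _ fun g => hψ x g)
  have iu0 : Integrable (fun ω => u (A ω)) P := integrable_comp_of_norm_le h.measurable hC hA'
  have iu1 : Integrable (fun ω => u (A ω + d ω • v)) P :=
    integrable_comp_of_norm_le h.measurable hC (by fun_prop)
  have iu2 : Integrable (fun ω => ∫ g, u (A ω + g • v) ∂ν) P :=
    integrable_comp_of_norm_le (measurable_integral_add_smul h.measurable v ν)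
      (fun x => norm_integral_le_of_forall_norm_le (fun _ => hC _) ν) hA'
  have mL : Measurable[m] fun ω => L (A ω) v := (h.measurable_lin v).comp hA
  have mQ : Measurable[m] fun ω => Q (A ω) v := (h.measurable_quad v).comp hA
  have iL : Integrable (fun ω => (d ω : ℂ) * L (A ω) v) P :=
    (hd1.ofReal).mul_bdd (c := D) (mL.mono hm le_rfl).aestronglyMeasurable
      (ae_of_all _ fun ω => hD _)
  have iQ0 : Integrable (fun ω => Q (A ω) v) P :=
    integrable_comp_of_norm_le (f := fun x => Q x v) (h.measurable_quad v)
      (fun x => h.norm_quad_le x v) hA'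
  have iQ : Integrable (fun ω => ((d ω ^ 2 : ℝ) : ℂ) * Q (A ω) v) P :=
    (hdsq.ofReal).mul_bdd (c := c₂ * ρ v ^ 2) (mQ.mono hm le_rfl).aestronglyMeasurable
      (ae_of_all _ fun ω => h.norm_quad_le _ v)
  have hL0 : ∫ ω, (d ω : ℂ) * L (A ω) v ∂P = 0 := by
    rw [integral_ofReal_mul_eq_condExp hm hd1 mL (fun ω => hD _)]
    rw [integral_congr_ae (g := fun _ => 0) (by
      filter_upwards [hmart] with ω hω
      rw [hω]; simp)]
    simp
  set r : Ω → ℂ := fun ω => u (A ω + d ω • v) - u (A ω) - d ω * L (A ω) v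
    - ((d ω ^ 2 : ℝ) : ℂ) * Q (A ω) v with hr
  set r' : Ω → ℂ := fun ω => (∫ g, u (A ω + g • v) ∂ν) - u (A ω) - s * Q (A ω) v with hr'
  have ir : Integrable r P := ((iu1.sub iu0).sub iL).sub iQ
  have ir' : Integrable r' P := (iu2.sub iu0).sub (iQ0.const_mul _)
  have e1 : ∫ ω, u (A ω + d ω • v) ∂P - ∫ ω, ∫ g, u (A ω + g • v) ∂ν ∂P
      = ∫ ω, ((d ω ^ 2 - s : ℝ) : ℂ) * Q (A ω) v ∂P + ∫ ω, r ω ∂P - ∫ ω, r' ω ∂P := by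
    have e2 : ∫ ω, ((d ω ^ 2 - s : ℝ) : ℂ) * Q (A ω) v ∂P
        = ∫ ω, ((d ω ^ 2 : ℝ) : ℂ) * Q (A ω) v ∂P - ∫ ω, (s : ℂ) * Q (A ω) v ∂P := by
      rw [← integral_sub iQ (iQ0.const_mul _)]
      refine integral_congr_ae (ae_of_all _ fun ω => ?_)
      simp only [Complex.ofReal_sub]
      ring
    rw [e2, hr, hr', integral_sub_sub_sub iu1 iu0 iL iQ,
      integral_sub_sub iu2 iu0 (iQ0.const_mul _), hL0]
    ring
  have e3 : ‖∫ ω, r ω ∂P‖ ≤ ∫ ω, φ (d ω) ∂P :=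
    norm_integral_le_of_norm_le hφi (ae_of_all _ fun ω => by
      simpa [hr] using hφ (A ω) (d ω))
  have e4 : ‖∫ ω, r' ω ∂P‖ ≤ ∫ g, ψ g ∂ν := norm_integral_le_of_forall_norm_le (fun ω => hG _) P
  rw [e1]
  refine (norm_sub_le _ _).trans (add_le_add ((norm_add_le _ _).trans ?_) e4)
  gcongr

/-- Only second moments enter, so this applies to innovations for which neither the Lindeberg
condition nor A3 is at hand. The constant 4 is 2 from the quadratic term, through `|d² - E d²| ≤ d²
+ E d²`, and 1 from each remainder. -/
theorem IsSmoothFunctional.swap_step_crude (h : IsSmoothFunctional ρ c₂ c₃ u L Q)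
    (hm : m ≤ mΩ) {A : Ω → V} (hA : Measurable[m] A) {d : Ω → ℝ}
    (hd : Measurable d) (hd2 : MemLp d 2 P) (hmart : P[d | m] =ᵐ[P] 0) (v : V)
    (ν : Measure ℝ) [IsProbabilityMeasure ν] (hν2 : MemLp id 2 ν) (hν0 : ∫ g, g ∂ν = 0)
    (hν : ∫ g, g ^ 2 ∂ν = ∫ ω, d ω ^ 2 ∂P) :
    ‖∫ ω, u (A ω + d ω • v) ∂P - ∫ ω, ∫ g, u (A ω + g • v) ∂ν ∂P‖
      ≤ 4 * c₂ * ρ v ^ 2 * ∫ ω, d ω ^ 2 ∂P := by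
  have hdsq : Integrable (fun ω => d ω ^ 2) P := hd2.integrable_sq
  have hgsq : Integrable (fun g : ℝ => g ^ 2) ν := hν2.integrable_sq
  have hφ : ∀ x (t : ℝ), ‖u (x + t • v) - u x - t * L x v - t ^ 2 * Q x v‖
      ≤ c₂ * ρ v ^ 2 * t ^ 2 := fun x t => (h.expansion_two x v t).trans (le_of_eq (by ring))
  refine (h.swap_step hm hA hd hd2 hmart v ν hν2 hν0 hν hφ hφ (hdsq.const_mul _)
    (hgsq.const_mul _)).trans ?_
  rw [integral_const_mul, integral_const_mul, hν]
  have h1 : ‖∫ ω, ((d ω ^ 2 - ∫ ω', d ω' ^ 2 ∂P : ℝ) : ℂ) * Q (A ω) v ∂P‖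
      ≤ ∫ ω, (d ω ^ 2 + ∫ ω', d ω' ^ 2 ∂P) * (c₂ * ρ v ^ 2) ∂P := by
    refine norm_integral_le_of_norm_le ((hdsq.add (integrable_const _)).mul_const _)
      (ae_of_all _ fun ω => ?_)
    rw [norm_mul, Complex.norm_real, Real.norm_eq_abs]
    have hs : 0 ≤ ∫ ω', d ω' ^ 2 ∂P := integral_nonneg fun _ => sq_nonneg _
    refine mul_le_mul ?_ (h.norm_quad_le _ _) (norm_nonneg _) (by positivity)
    rw [abs_le]
    constructor <;> nlinarith [sq_nonneg (d ω)]
  rw [integral_mul_const, integral_add hdsq (integrable_const _)] at h1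
  simp only [integral_const, probReal_univ, one_smul] at h1
  linarith

end Step

section Sums

variable {V : Type*} [AddCommGroup V] [MeasurableSpace V] [MeasurableAdd₂ V]
variable {Ω Γ : Type*} {mΩ : MeasurableSpace Ω} {mΓ : MeasurableSpace Γ} {P : Measure Ω}
  [IsProbabilityMeasure P] {κ : Measure Γ} [IsProbabilityMeasure κ]

theorem integral_add_of_indepFun {E : Type*} [NormedAddCommGroup E] [NormedSpace ℝ E]
    [MeasurableSpace E] [BorelSpace E] [SecondCountableTopology E] {u : V → E}
    (hu : Measurable u) {C : ℝ}
    (hC : ∀ x, ‖u x‖ ≤ C) {U W : Ω → V} (hU : Measurable U) (hW : Measurable W)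
    (hUW : IndepFun U W P) :
    ∫ ω, u (U ω + W ω) ∂P = ∫ ω, ∫ ω', u (U ω + W ω') ∂P ∂P := by
  have h := (indepFun_iff_map_prod_eq_prod_map_map hU.aemeasurable hW.aemeasurable).mp hUW
  have : IsProbabilityMeasure (P.map U) := Measure.isProbabilityMeasure_map hU.aemeasurable
  have : IsProbabilityMeasure (P.map W) := Measure.isProbabilityMeasure_map hW.aemeasurable
  have hm : Measurable fun p : V × V => u (p.1 + p.2) := by fun_prop
  calc ∫ ω, u (U ω + W ω) ∂P = ∫ p, u (p.1 + p.2) ∂(P.map fun ω => (U ω, W ω)) := by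
        rw [integral_map (hU.prodMk hW).aemeasurable hm.aestronglyMeasurable]
    _ = ∫ a, ∫ b, u (a + b) ∂(P.map W) ∂(P.map U) := by
        rw [h, integral_prod _ (Integrable.of_bound hm.aestronglyMeasurable C
          (ae_of_all _ fun _ => hC _))]
    _ = ∫ ω, ∫ b, u (U ω + b) ∂(P.map W) ∂P := by
        rw [integral_map hU.aemeasurable]
        exact hm.stronglyMeasurable.integral_prod_right.aestronglyMeasurable
    _ = _ := by
        refine integral_congr_ae (ae_of_all _ fun ω => ?_)
        simp only
        rw [integral_map hW.aemeasurable]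
        exact (hu.comp (measurable_const.add measurable_id)).aestronglyMeasurable

/-- Comparison of sums of independent random elements, one summand at a time. -/
theorem norm_integral_sum_sub_le {ι : Type*} {u : V → ℂ} (hu : Measurable u) {C : ℝ}
    (hC : ∀ x, ‖u x‖ ≤ C) {U : ι → Ω → V} {W : ι → Γ → V} (hU : ∀ i, Measurable (U i))
    (hW : ∀ i, Measurable (W i)) (hUi : iIndepFun U P) (hWi : iIndepFun W κ) (S : Finset ι)
    {δ : ι → ℝ} (hδ : ∀ i ∈ S, ∀ x, ‖∫ ω, u (x + U i ω) ∂P - ∫ γ, u (x + W i γ) ∂κ‖ ≤ δ i)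
    (x : V) :
    ‖∫ ω, u (x + ∑ i ∈ S, U i ω) ∂P - ∫ γ, u (x + ∑ i ∈ S, W i γ) ∂κ‖ ≤ ∑ i ∈ S, δ i := by
  classical
  induction S using Finset.induction_on generalizing x with
  | empty => simp
  | insert i S hi ih =>
    have ih' := ih fun j hj => hδ j (Finset.mem_insert_of_mem hj)
    have hδi := hδ i (Finset.mem_insert_self i S)
    have hUS : Measurable fun ω => ∑ j ∈ S, U j ω := Finset.measurable_fun_sum _ fun j _ => hU j
    have hWS : Measurable fun γ => ∑ j ∈ S, W j γ := Finset.measurable_fun_sum _ fun j _ => hW j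
    have hux : Measurable fun y => u (x + y) := by fun_prop
    have hindU : IndepFun (fun ω => ∑ j ∈ S, U j ω) (U i) P := by
      have := hUi.indepFun_finsetSum_of_notMem hU hi
      convert! this using 1
      ext ω; simp
    have hindW : IndepFun (W i) (fun γ => ∑ j ∈ S, W j γ) κ := by
      have := (hWi.indepFun_finsetSum_of_notMem hW hi).symm
      convert! this using 1
      ext ω; simp
    have e1 : ∫ ω, u (x + ∑ j ∈ insert i S, U j ω) ∂P
        = ∫ ω, ∫ ω', u (x + ∑ j ∈ S, U j ω + U i ω') ∂P ∂P := by
      have := integral_add_of_indepFun hux (fun y => hC _) hUS (hU i) hindU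
      simp only [← add_assoc] at this
      rw [← this]
      refine integral_congr_ae (ae_of_all _ fun ω => ?_)
      simp only [Finset.sum_insert hi]
      rw [add_assoc, add_comm (∑ j ∈ S, U j ω)]
    have e2 : ∫ γ, u (x + ∑ j ∈ insert i S, W j γ) ∂κ
        = ∫ γ, ∫ γ', u (x + W i γ + ∑ j ∈ S, W j γ') ∂κ ∂κ := by
      have := integral_add_of_indepFun hux (fun y => hC _) (hW i) hWS hindW
      simp only [← add_assoc] at this
      rw [← this]
      refine integral_congr_ae (ae_of_all _ fun ω => ?_)
      simp only [Finset.sum_insert hi, add_assoc]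
    have m3 : Measurable fun p : Ω × Γ => u (x + ∑ j ∈ S, U j p.1 + W i p.2) :=
      hu.comp (((measurable_const.add (hUS.comp measurable_fst))).add ((hW i).comp measurable_snd))
    have m4 : Measurable fun p : Ω × Ω => u (x + ∑ j ∈ S, U j p.1 + U i p.2) :=
      hu.comp (((measurable_const.add (hUS.comp measurable_fst))).add ((hU i).comp measurable_snd))
    have m5 : Measurable fun p : Γ × Γ => u (x + W i p.1 + ∑ j ∈ S, W j p.2) :=
      hu.comp (((measurable_const.add ((hW i).comp measurable_fst))).add
        (hWS.comp measurable_snd))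
    have m6 : Measurable fun p : Γ × Ω => u (x + W i p.1 + ∑ j ∈ S, U j p.2) :=
      hu.comp (((measurable_const.add ((hW i).comp measurable_fst))).add
        (hUS.comp measurable_snd))
    -- Fubini identifies the two forms of the hybrid integral: one is reached from the left by
    -- changing the summand `i` with the others as shift, the other from the right by the induction
    -- hypothesis with `W i` as shift.
    have e3 : ∫ ω, ∫ γ, u (x + ∑ j ∈ S, U j ω + W i γ) ∂κ ∂P
        = ∫ γ, ∫ ω, u (x + W i γ + ∑ j ∈ S, U j ω) ∂P ∂κ := by
      rw [integral_integral_swap (f := fun ω γ => u (x + ∑ j ∈ S, U j ω + W i γ))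
        (Integrable.of_bound m3.aestronglyMeasurable C (ae_of_all _ fun _ => hC _))]
      simp only [add_right_comm]
    have n1 : ‖∫ ω, ∫ ω', u (x + ∑ j ∈ S, U j ω + U i ω') ∂P ∂P
        - ∫ ω, ∫ γ, u (x + ∑ j ∈ S, U j ω + W i γ) ∂κ ∂P‖ ≤ δ i := by
      have i1 : Integrable (fun ω => ∫ ω', u (x + ∑ j ∈ S, U j ω + U i ω') ∂P) P :=
        Integrable.of_bound m4.stronglyMeasurable.integral_prod_right'.aestronglyMeasurable C
          (ae_of_all _ fun a => norm_integral_le_of_forall_norm_le (fun b => hC _) P)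
      have i2 : Integrable (fun ω => ∫ γ, u (x + ∑ j ∈ S, U j ω + W i γ) ∂κ) P :=
        Integrable.of_bound m3.stronglyMeasurable.integral_prod_right'.aestronglyMeasurable C
          (ae_of_all _ fun a => norm_integral_le_of_forall_norm_le (fun b => hC _) κ)
      rw [← integral_sub i1 i2]
      exact norm_integral_le_of_forall_norm_le (fun ω => hδi _) P
    have n2 : ‖∫ γ, ∫ ω, u (x + W i γ + ∑ j ∈ S, U j ω) ∂P ∂κ
        - ∫ γ, ∫ γ', u (x + W i γ + ∑ j ∈ S, W j γ') ∂κ ∂κ‖ ≤ ∑ j ∈ S, δ j := by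
      have i1 : Integrable (fun γ => ∫ ω, u (x + W i γ + ∑ j ∈ S, U j ω) ∂P) κ :=
        Integrable.of_bound m6.stronglyMeasurable.integral_prod_right'.aestronglyMeasurable C
          (ae_of_all _ fun a => norm_integral_le_of_forall_norm_le (fun b => hC _) P)
      have i2 : Integrable (fun γ => ∫ γ', u (x + W i γ + ∑ j ∈ S, W j γ') ∂κ) κ :=
        Integrable.of_bound m5.stronglyMeasurable.integral_prod_right'.aestronglyMeasurable C
          (ae_of_all _ fun a => norm_integral_le_of_forall_norm_le (fun b => hC _) κ)
      rw [← integral_sub i1 i2]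
      exact norm_integral_le_of_forall_norm_le (fun γ => ih' _) κ
    rw [Finset.sum_insert hi, e1, e2]
    rw [e3] at n1
    exact (norm_sub_le_norm_sub_add_norm_sub _ _ _).trans (add_le_add n1 n2)

end Sums

section Row

variable {V : Type*} [AddCommGroup V] [Module ℝ V] [MeasurableSpace V] [MeasurableAdd₂ V]
  [MeasurableSMul₂ ℝ V] {ρ : V → ℝ} {c₂ c₃ : ℝ}
variable {Ω Γ : Type*} {mΩ : MeasurableSpace Ω} {mΓ : MeasurableSpace Γ} {P : Measure Ω}
  [IsProbabilityMeasure P] {κ : Measure Γ} [IsProbabilityMeasure κ]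

/-- Replacement of the variables of a row by independent ones, one at a time. -/
theorem IsSmoothFunctional.swap_row {d : ℕ → Ω → ℝ} {ξ : ℕ → Γ → ℝ}
    (hξ : ∀ t, Measurable (ξ t)) (hξi : iIndepFun ξ κ) (v : ℕ → V) {e : ℕ → ℝ} (N : ℕ)
    (hstep : ∀ t < N, ∀ (u : V → ℂ) (L Q : V → V → ℂ), IsSmoothFunctional ρ c₂ c₃ u L Q → ∀ x,
      ‖∫ ω, u (x + ∑ j ∈ Finset.range t, d j ω • v j + d t ω • v t) ∂P
        - ∫ ω, ∫ g, u (x + ∑ j ∈ Finset.range t, d j ω • v j + g • v t) ∂(κ.map (ξ t)) ∂P‖ ≤ e t)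
    {u : V → ℂ} {L Q : V → V → ℂ} (h : IsSmoothFunctional ρ c₂ c₃ u L Q) (x : V) :
    ‖∫ ω, u (x + ∑ j ∈ Finset.range N, d j ω • v j) ∂P
      - ∫ γ, u (x + ∑ j ∈ Finset.range N, ξ j γ • v j) ∂κ‖ ≤ ∑ t ∈ Finset.range N, e t := by
  induction N generalizing u L Q with
  | zero => simp
  | succ N ih =>
    have : IsProbabilityMeasure (κ.map (ξ N)) :=
      Measure.isProbabilityMeasure_map (hξ N).aemeasurable
    obtain ⟨C, hC⟩ := h.bounded
    have hS : Measurable fun γ => ∑ j ∈ Finset.range N, ξ j γ • v j :=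
      Finset.measurable_fun_sum _ fun j _ => (hξ j).smul_const _
    -- The last variable is replaced first and then integrated into the functional. Thus at every
    -- step the base point contains only original variables of smaller index, as the martingale
    -- property requires.
    have h1 := hstep N (Nat.lt_succ_self N) u L Q h x
    have h2 := ih (fun t ht => hstep t (ht.trans (Nat.lt_succ_self N))) (h.average (v N)
      (κ.map (ξ N)))
    have hind : IndepFun (fun γ => ∑ j ∈ Finset.range N, ξ j γ • v j) (fun γ => ξ N γ • v N) κ := by
      have h3 : iIndepFun (fun t γ => ξ t γ • v t) κ :=
        hξi.comp (fun t (g : ℝ) => g • v t) fun t => by fun_prop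
      have := h3.indepFun_finsetSum_of_notMem (fun t => (hξ t).smul_const _)
        (Finset.notMem_range_self (n := N))
      convert! this using 1
      ext γ; simp
    have h4 : ∫ γ, u (x + ∑ j ∈ Finset.range (N + 1), ξ j γ • v j) ∂κ
        = ∫ γ, ∫ g, u (x + ∑ j ∈ Finset.range N, ξ j γ • v j + g • v N) ∂(κ.map (ξ N)) ∂κ := by
      have := integral_add_of_indepFun (u := fun y => u (x + y)) (by have := h.measurable; fun_prop)
        (fun y => hC _) hS ((hξ N).smul_const (v N)) hind
      simp only [Finset.sum_range_succ]
      rw [this]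
      refine integral_congr_ae (ae_of_all _ fun γ => ?_)
      simp only
      rw [integral_map (hξ N).aemeasurable]
      · simp only [add_assoc]
      · exact (h.measurable.comp (by fun_prop)).aestronglyMeasurable
    rw [h4, Finset.sum_range_succ]
    simp only [Finset.sum_range_succ, ← add_assoc] at h1 ⊢
    calc _ ≤ _ := norm_sub_le_norm_sub_add_norm_sub _ _ _
      _ ≤ _ := add_le_add h1 h2
      _ = _ := add_comm _ _

end Row

end LinearProcessESD

end

/-! ### The replacement step under the Lindeberg condition and stabilizing conditional variances. -/

noncomputable section

namespace LinearProcessESD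

section SqTail

variable {Ω : Type*} {mΩ : MeasurableSpace Ω} {P : Measure Ω}

/-- When `|y| > τ`, either `|x| > τ` and `x²` is its own tail, or `x² ≤ τ² ≤ y²`; the constant `s`
is treated as in Chebyshev's inequality. No independence of `x` and `y` is needed to bound the
expectation of the left side by tails. -/
theorem sq_add_mul_ite_le {x y s τ : ℝ} (hs : 0 ≤ s) (hτ : 0 < τ) :
    (x ^ 2 + s) * (if τ < |y| then 1 else 0)
      ≤ (if τ < |x| then x ^ 2 else 0) + (if τ < |y| then y ^ 2 else 0) + s * (y ^ 2 / τ ^ 2) := by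
  by_cases hy : τ < |y|
  · have h2 : τ ^ 2 ≤ y ^ 2 := by rw [← sq_abs y]; gcongr
    have h1 : 1 ≤ y ^ 2 / τ ^ 2 := by rw [le_div_iff₀ (by positivity)]; linarith
    have h3 : s ≤ s * (y ^ 2 / τ ^ 2) := le_mul_of_one_le_right hs h1
    rw [if_pos hy, if_pos hy]
    split_ifs with hx
    · nlinarith [sq_nonneg y]
    · have : x ^ 2 ≤ τ ^ 2 := by rw [← sq_abs x]; gcongr; exact not_lt.mp hx
      nlinarith
  · rw [if_neg hy, if_neg hy]
    have : 0 ≤ (if τ < |x| then x ^ 2 else 0) := by split_ifs <;> positivity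
    have : 0 ≤ s * (y ^ 2 / τ ^ 2) := by positivity
    nlinarith

/-- The part of the second moment of `d` carried by the values of modulus larger than `τ`. -/
def sqTail (P : Measure Ω) (d : Ω → ℝ) (τ : ℝ) : ℝ := ∫ ω in {ω | τ < |d ω|}, d ω ^ 2 ∂P

theorem integrable_ite_sq {d : Ω → ℝ} (hd : Measurable d) (hd2 : MemLp d 2 P) (τ : ℝ) :
    Integrable (fun ω => if τ < |d ω| then d ω ^ 2 else 0) P := by
  have hs : MeasurableSet {ω | τ < |d ω|} := measurableSet_lt measurable_const (by fun_prop)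
  exact hd2.integrable_sq.indicator hs

theorem integral_ite_sq {d : Ω → ℝ} (hd : Measurable d) (τ : ℝ) :
    ∫ ω, (if τ < |d ω| then d ω ^ 2 else 0) ∂P = sqTail P d τ := by
  have hs : MeasurableSet {ω | τ < |d ω|} := measurableSet_lt measurable_const (by fun_prop)
  rw [sqTail, ← integral_indicator hs]
  rfl

theorem sqTail_nonneg (d : Ω → ℝ) (τ : ℝ) : 0 ≤ sqTail P d τ :=
  integral_nonneg fun _ => sq_nonneg _

end SqTail

section GoodStep

variable {V : Type*} [AddCommGroup V] [Module ℝ V] [MeasurableSpace V] {ρ : V → ℝ} {c₂ c₃ : ℝ}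
  {u : V → ℂ} {L Q : V → V → ℂ}
variable {Ω : Type*} {m mΩ : MeasurableSpace Ω} {P : Measure Ω} [IsProbabilityMeasure P]

/-- Since `Q (A ω) v` is bounded and measurable with respect to `m`, the factor `d²` may be replaced
by its conditional expectation. Here `m` will be a remote past, so that A3 applies. -/
theorem IsSmoothFunctional.norm_integral_quad_le (h : IsSmoothFunctional ρ c₂ c₃ u L Q)
    (hm : m ≤ mΩ) {A : Ω → V} (hA : Measurable[m] A) {d : Ω → ℝ} (hd2 : MemLp d 2 P) (v : V) :
    ‖∫ ω, ((d ω ^ 2 - ∫ ω', d ω' ^ 2 ∂P : ℝ) : ℂ) * Q (A ω) v ∂P‖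
      ≤ c₂ * ρ v ^ 2 * ∫ ω, |(P[fun ω' => d ω' ^ 2 | m]) ω - ∫ ω', d ω' ^ 2 ∂P| ∂P := by
  have hdsq : Integrable (fun ω => d ω ^ 2) P := hd2.integrable_sq
  have h1 := integral_ofReal_mul_eq_condExp hm (hdsq.sub (integrable_const (∫ ω', d ω' ^ 2 ∂P)))
    ((h.measurable_quad v).comp hA) (fun ω => h.norm_quad_le _ v)
  simp only [Pi.sub_apply, Function.comp_apply] at h1
  rw [h1, ← integral_const_mul]
  refine norm_integral_le_of_norm_le ((integrable_condExp.sub (integrable_const _)).abs.const_mul _)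
    ?_
  have h2 := condExp_sub hdsq (integrable_const (∫ ω', d ω' ^ 2 ∂P)) m
  rw [condExp_const hm] at h2
  filter_upwards [h2] with ω hω
  rw [norm_mul, Complex.norm_real, Real.norm_eq_abs, mul_comm]
  refine mul_le_mul (h.norm_quad_le _ v) (le_of_eq ?_) (abs_nonneg _)
    ((norm_nonneg _).trans (h.norm_quad_le 0 v))
  exact congrArg _ hω

variable [MeasurableAdd₂ V] [MeasurableSMul₂ ℝ V]

/-- The cost of deleting a block of recent innovations from the base point: the pointwise bound
`quad_sub_le` is multiplied by `d² + E d²` and integrated by means of `sq_add_mul_ite_le`. -/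
theorem IsSmoothFunctional.norm_integral_quad_sub_le (h : IsSmoothFunctional ρ c₂ c₃ u L Q)
    (hρ : ∀ v, 0 ≤ ρ v) (hc₂ : 0 ≤ c₂) (hc₃ : 0 ≤ c₃) {A : Ω → V} (hA : Measurable A) {d : Ω → ℝ}
    (hd : Measurable d) (hd2 : MemLp d 2 P) (v : V) {ι : Type*} (S : Finset ι) {D : ι → Ω → ℝ}
    (hD : ∀ j ∈ S, Measurable (D j)) (hD2 : ∀ j ∈ S, MemLp (D j) 2 P) (w : ι → V) {τ : ℝ}
    (hτ : 0 < τ) :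
    ‖∫ ω, ((d ω ^ 2 - ∫ ω', d ω' ^ 2 ∂P : ℝ) : ℂ) * Q (A ω + ∑ j ∈ S, D j ω • w j) v ∂P
        - ∫ ω, ((d ω ^ 2 - ∫ ω', d ω' ^ 2 ∂P : ℝ) : ℂ) * Q (A ω) v ∂P‖
      ≤ ∑ j ∈ S, ρ v ^ 2 * (c₃ * τ * ρ (w j) * (2 * ∫ ω', d ω' ^ 2 ∂P)
        + 2 * c₂ * (sqTail P d τ + sqTail P (D j) τ
          + (∫ ω', d ω' ^ 2 ∂P) * ((∫ ω', D j ω' ^ 2 ∂P) / τ ^ 2))) := by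
  have hdsq : Integrable (fun ω => d ω ^ 2) P := hd2.integrable_sq
  set s := ∫ ω', d ω' ^ 2 ∂P with hs
  have hs0 : 0 ≤ s := integral_nonneg fun _ => sq_nonneg _
  have iS : ∀ {B : Ω → V}, Measurable B → Integrable
      (fun ω => ((d ω ^ 2 - s : ℝ) : ℂ) * Q (B ω) v) P := fun {B} hB =>
    ((hdsq.sub (integrable_const s)).ofReal).mul_bdd (c := c₂ * ρ v ^ 2)
      ((h.measurable_quad v).comp hB).aestronglyMeasurable
      (ae_of_all _ fun ω => h.norm_quad_le _ v)
  have hSm : Measurable fun ω => ∑ j ∈ S, D j ω • w j :=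
    Finset.measurable_fun_sum _ fun j hj => (hD j hj).smul_const _
  have iS1 : Integrable (fun ω => ((d ω ^ 2 - s : ℝ) : ℂ) * Q (A ω + ∑ j ∈ S, D j ω • w j) v) P :=
    iS (hA.add hSm)
  rw [← integral_sub iS1 (iS hA)]
  have hint : ∀ j ∈ S, Integrable (fun ω => ρ v ^ 2 * (c₃ * τ * ρ (w j) * (d ω ^ 2 + s)
      + 2 * c₂ * ((if τ < |d ω| then d ω ^ 2 else 0) + (if τ < |D j ω| then D j ω ^ 2 else 0)
        + s * (D j ω ^ 2 / τ ^ 2)))) P := fun j hj =>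
    (((hdsq.add (integrable_const _)).const_mul _).add
      ((((integrable_ite_sq hd hd2 τ).add (integrable_ite_sq (hD j hj) (hD2 j hj) τ)).add
        (((hD2 j hj).integrable_sq.div_const _).const_mul _)).const_mul _)).const_mul _
  have hval : ∫ ω, ∑ j ∈ S, ρ v ^ 2 * (c₃ * τ * ρ (w j) * (d ω ^ 2 + s)
      + 2 * c₂ * ((if τ < |d ω| then d ω ^ 2 else 0) + (if τ < |D j ω| then D j ω ^ 2 else 0)
        + s * (D j ω ^ 2 / τ ^ 2))) ∂P = ∑ j ∈ S, ρ v ^ 2 * (c₃ * τ * ρ (w j) * (2 * s)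
        + 2 * c₂ * (sqTail P d τ + sqTail P (D j) τ + s * ((∫ ω', D j ω' ^ 2 ∂P) / τ ^ 2))) := by
    rw [integral_finsetSum _ hint]
    refine Finset.sum_congr rfl fun j hj => ?_
    have i1 := integrable_ite_sq hd hd2 τ
    have i2 := integrable_ite_sq (hD j hj) (hD2 j hj) τ
    have i3 : Integrable (fun ω => s * (D j ω ^ 2 / τ ^ 2)) P :=
      ((hD2 j hj).integrable_sq.div_const _).const_mul _
    have i4 : Integrable (fun ω => (if τ < |d ω| then d ω ^ 2 else 0)
        + (if τ < |D j ω| then D j ω ^ 2 else 0)) P := i1.add i2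
    have i5 : Integrable (fun ω => (if τ < |d ω| then d ω ^ 2 else 0)
        + (if τ < |D j ω| then D j ω ^ 2 else 0) + s * (D j ω ^ 2 / τ ^ 2)) P := i4.add i3
    have i6 : Integrable (fun ω => d ω ^ 2 + s) P := hdsq.add (integrable_const _)
    rw [integral_const_mul, integral_add (i6.const_mul _) (i5.const_mul _), integral_const_mul,
      integral_const_mul, integral_add hdsq (integrable_const _), integral_add i4 i3, integral_add i1 i2,
      integral_ite_sq hd, integral_ite_sq (hD j hj),
      integral_const_mul, integral_div]
    simp only [integral_const, probReal_univ, one_smul]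
    rw [← hs]
    ring
  rw [← hval]
  refine norm_integral_le_of_norm_le (integrable_finsetSum _ hint) (ae_of_all _ fun ω => ?_)
  rw [← mul_sub, norm_mul, Complex.norm_real, Real.norm_eq_abs]
  have h1 : |d ω ^ 2 - s| ≤ d ω ^ 2 + s := by
    rw [abs_le]; constructor <;> nlinarith [sq_nonneg (d ω)]
  refine (mul_le_mul h1 (h.quad_sub_le hρ hc₃ S (A ω) v (fun j => D j ω) w hτ.le) (norm_nonneg _)
    (by positivity)).trans ?_
  rw [Finset.mul_sum]
  refine Finset.sum_le_sum fun j _ => ?_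
  have h2 := sq_add_mul_ite_le (x := d ω) (y := D j ω) hs0 hτ
  calc (d ω ^ 2 + s) * (ρ v ^ 2 * (c₃ * τ * ρ (w j) + 2 * c₂ * (if τ < |D j ω| then 1 else 0)))
      = ρ v ^ 2 * (c₃ * τ * ρ (w j) * (d ω ^ 2 + s)
        + 2 * c₂ * ((d ω ^ 2 + s) * (if τ < |D j ω| then 1 else 0))) := by ring
    _ ≤ _ := by gcongr

/-- The past is cut at `t'`: the innovations in `Ico t' t` are removed from the argument of `Q`,
after which conditioning on `F t'` leaves only the error `η`. The remainder is cut at level `τ`. -/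
theorem IsSmoothFunctional.swap_step_fine (h : IsSmoothFunctional ρ c₂ c₃ u L Q)
    (hρ : ∀ v, 0 ≤ ρ v) (hc₂ : 0 ≤ c₂) (hc₃ : 0 ≤ c₃) {F : ℕ → MeasurableSpace Ω}
    (hF : ∀ t, F t ≤ mΩ) {d : ℕ → Ω → ℝ} (hd : ∀ t, Measurable (d t))
    (hdF : ∀ j t, j < t → Measurable[F t] (d j)) (hd2 : ∀ t, MemLp (d t) 2 P)
    (hmart : ∀ t, P[d t | F t] =ᵐ[P] 0) {σ : ℝ} (hσ : ∀ t, ∫ ω, d t ω ^ 2 ∂P ≤ σ ^ 2) (v : ℕ → V)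
    {r : ℝ} (hr : ∀ t, ρ (v t) ≤ r) {t' t : ℕ} (htt : t' ≤ t)
    {η : ℝ} (hη : ∫ ω, |(P[fun ω' => d t ω' ^ 2 | F t']) ω - ∫ ω', d t ω' ^ 2 ∂P| ∂P ≤ η)
    (ν : Measure ℝ) [IsProbabilityMeasure ν] (hν2 : MemLp id 2 ν) (hν0 : ∫ g, g ∂ν = 0)
    (hν : ∫ g, g ^ 2 ∂ν = ∫ ω, d t ω ^ 2 ∂P) (hν3 : Integrable (fun g => |g| ^ 3) ν) {κ₃ : ℝ}
    (hκ₃ : ∫ g, |g| ^ 3 ∂ν ≤ κ₃) {τ : ℝ} (hτ : 0 < τ) (x : V) :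
    ‖∫ ω, u (x + ∑ j ∈ Finset.range t, d j ω • v j + d t ω • v t) ∂P
        - ∫ ω, ∫ g, u (x + ∑ j ∈ Finset.range t, d j ω • v j + g • v t) ∂ν ∂P‖
      ≤ c₂ * r ^ 2 * (η + sqTail P (d t) τ) + c₃ * r ^ 3 * (τ * σ ^ 2 + κ₃)
        + ∑ j ∈ Finset.Ico t' t, r ^ 2 * (2 * c₃ * τ * r * σ ^ 2
          + 2 * c₂ * (sqTail P (d t) τ + sqTail P (d j) τ + σ ^ 4 / τ ^ 2)) := by
  have hdsq : Integrable (fun ω => d t ω ^ 2) P := (hd2 t).integrable_sq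
  have hrv := hr t
  have hρv := hρ (v t)
  have hr0 : 0 ≤ r := hρv.trans hrv
  have hA : ∀ q, Measurable[F q] fun ω => x + ∑ j ∈ Finset.range q, d j ω • v j := fun q =>
    Measurable.const_add (Finset.measurable_fun_sum _ fun j hj =>
      (hdF j q (Finset.mem_range.mp hj)).smul_const _) _
  have hs0 : ∀ j, 0 ≤ ∫ ω, d j ω ^ 2 ∂P := fun j => integral_nonneg fun _ => sq_nonneg _
  -- Below the level `τ` the cubic bound is used with `|g|³ ≤ τ g²`, above it the quadratic bound;
  -- only two moments of `d t` are then required.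
  have hφ : ∀ x (g : ℝ), ‖u (x + g • v t) - u x - g * L x (v t) - g ^ 2 * Q x (v t)‖
      ≤ c₃ * ρ (v t) ^ 3 * τ * g ^ 2 + c₂ * ρ (v t) ^ 2 * (if τ < |g| then g ^ 2 else 0) := by
    intro x g
    split_ifs with hg
    · have := h.expansion_two x (v t) g
      have h1 : 0 ≤ c₃ * ρ (v t) ^ 3 * τ * g ^ 2 := by positivity
      linarith
    · refine (h.expansion_three x (v t) g).trans ?_
      have h1 : |g| ^ 3 ≤ τ * g ^ 2 := by
        rw [← sq_abs g, pow_succ, mul_comm]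
        gcongr
        exact not_lt.mp hg
      calc c₃ * |g| ^ 3 * ρ (v t) ^ 3 ≤ c₃ * (τ * g ^ 2) * ρ (v t) ^ 3 := by gcongr
        _ = _ := by ring
  have hψ : ∀ x (g : ℝ), ‖u (x + g • v t) - u x - g * L x (v t) - g ^ 2 * Q x (v t)‖
      ≤ c₃ * ρ (v t) ^ 3 * |g| ^ 3 := fun x g =>
    (h.expansion_three x (v t) g).trans (le_of_eq (by ring))
  have i1 := integrable_ite_sq (hd t) (hd2 t) τ
  have h1 := h.swap_step (hF t) (hA t) (hd t) (hd2 t) (hmart t) (v t) ν hν2 hν0 hν hφ hψ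
    ((hdsq.const_mul _).add (i1.const_mul _)) (hν3.const_mul _)
  rw [integral_add (hdsq.const_mul _) (i1.const_mul _), integral_const_mul, integral_const_mul,
    integral_const_mul, integral_ite_sq (hd t)] at h1
  have h2 := h.norm_integral_quad_le (hF t') (hA t') (hd2 t) (v t)
  have h3 := h.norm_integral_quad_sub_le hρ hc₂ hc₃ ((hA t').mono (hF t') le_rfl) (hd t) (hd2 t)
    (v t) (Finset.Ico t' t) (fun j _ => hd j) (fun j _ => hd2 j) v hτ
  have e : ∀ ω, x + ∑ j ∈ Finset.range t', d j ω • v j + ∑ j ∈ Finset.Ico t' t, d j ω • v j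
      = x + ∑ j ∈ Finset.range t, d j ω • v j := fun ω => by
    rw [add_assoc, Finset.sum_range_add_sum_Ico _ htt]
  simp only [e] at h3
  have h4 := norm_le_norm_add_norm_sub'
    (∫ ω, ((d t ω ^ 2 - ∫ ω', d t ω' ^ 2 ∂P : ℝ) : ℂ)
      * Q (x + ∑ j ∈ Finset.range t, d j ω • v j) (v t) ∂P)
    (∫ ω, ((d t ω ^ 2 - ∫ ω', d t ω' ^ 2 ∂P : ℝ) : ℂ)
      * Q (x + ∑ j ∈ Finset.range t', d j ω • v j) (v t) ∂P)
  have hlt := sqTail_nonneg (P := P) (d t) τ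
  have hη0 : 0 ≤ η := (integral_nonneg fun _ => abs_nonneg _).trans hη
  have hκ0 : 0 ≤ κ₃ := (integral_nonneg fun _ => by positivity).trans hκ₃
  have hσt := hσ t
  have b2 : c₂ * ρ (v t) ^ 2 * ∫ ω, |(P[fun ω' => d t ω' ^ 2 | F t']) ω - ∫ ω', d t ω' ^ 2 ∂P| ∂P
      ≤ c₂ * r ^ 2 * η := by gcongr
  have b3 : ∑ j ∈ Finset.Ico t' t, ρ (v t) ^ 2 * (c₃ * τ * ρ (v j) * (2 * ∫ ω', d t ω' ^ 2 ∂P)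
        + 2 * c₂ * (sqTail P (d t) τ + sqTail P (d j) τ
          + (∫ ω', d t ω' ^ 2 ∂P) * ((∫ ω', d j ω' ^ 2 ∂P) / τ ^ 2)))
      ≤ ∑ j ∈ Finset.Ico t' t, r ^ 2 * (2 * c₃ * τ * r * σ ^ 2
          + 2 * c₂ * (sqTail P (d t) τ + sqTail P (d j) τ + σ ^ 4 / τ ^ 2)) := by
    refine Finset.sum_le_sum fun j _ => ?_
    have hlj := sqTail_nonneg (P := P) (d j) τ
    have hσj := hσ j
    have hrj := hr j
    have hρj := hρ (v j)
    have hst := hs0 t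
    have hsj := hs0 j
    have q1 : c₃ * τ * ρ (v j) * (2 * ∫ ω', d t ω' ^ 2 ∂P) ≤ 2 * c₃ * τ * r * σ ^ 2 := by
      calc _ ≤ c₃ * τ * r * (2 * σ ^ 2) := by gcongr
        _ = _ := by ring
    have q2 : (∫ ω', d t ω' ^ 2 ∂P) * ((∫ ω', d j ω' ^ 2 ∂P) / τ ^ 2) ≤ σ ^ 4 / τ ^ 2 := by
      calc _ ≤ σ ^ 2 * (σ ^ 2 / τ ^ 2) := by gcongr
        _ = _ := by ring
    gcongr
  have b4 : c₃ * ρ (v t) ^ 3 * τ * ∫ ω, d t ω ^ 2 ∂P ≤ c₃ * r ^ 3 * (τ * σ ^ 2) := by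
    calc _ ≤ c₃ * r ^ 3 * τ * σ ^ 2 := by gcongr
      _ = _ := by ring
  have b5 : c₂ * ρ (v t) ^ 2 * sqTail P (d t) τ ≤ c₂ * r ^ 2 * sqTail P (d t) τ := by gcongr
  have b6 : c₃ * ρ (v t) ^ 3 * ∫ g, |g| ^ 3 ∂ν ≤ c₃ * r ^ 3 * κ₃ := by
    have : 0 ≤ ∫ g, |g| ^ 3 ∂ν := integral_nonneg fun _ => by positivity
    gcongr
  linarith

end GoodStep

end LinearProcessESD

end

/-! ### Bounded differences and almost sure convergence. -/

noncomputable section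

namespace LinearProcessESD

section Concentration

variable {V : Type*} [AddCommGroup V] [MeasurableSpace V] [MeasurableAdd₂ V]
variable {Ω : Type*} {mΩ : MeasurableSpace Ω} {P : Measure Ω} [IsProbabilityMeasure P]

/-- The bounded differences inequality for functions of a sum of independent random elements. -/
theorem mgf_sum_sub_integral_le {ι : Type*} {u : V → ℝ} (hu : Measurable u) {C : ℝ}
    (hC : ∀ x, |u x| ≤ C) {U : ι → Ω → V} (hU : ∀ i, Measurable (U i)) (hUi : iIndepFun U P)
    (S : Finset ι) {c : ℝ} (hc : 0 ≤ c)
    (hdiff : ∀ i ∈ S, ∀ x ω ω', |u (x + U i ω) - u (x + U i ω')| ≤ c) (x : V) (l : ℝ) :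
    ∫ ω, Real.exp (l * (u (x + ∑ i ∈ S, U i ω) - ∫ ω', u (x + ∑ i ∈ S, U i ω') ∂P)) ∂P
      ≤ Real.exp (S.card * c ^ 2 * l ^ 2 / 2) := by
  classical
  induction S using Finset.induction_on generalizing x with
  | empty => simp
  | insert i S hi ih =>
    have ih' := ih fun j hj => hdiff j (Finset.mem_insert_of_mem hj)
    have hdi := hdiff i (Finset.mem_insert_self i S)
    have hUS : Measurable fun ω => ∑ j ∈ S, U j ω := Finset.measurable_fun_sum _ fun j _ => hU j
    have hux : Measurable fun y => u (x + y) := by fun_prop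
    have hind : IndepFun (U i) (fun ω => ∑ j ∈ S, U j ω) P := by
      have := (hUi.indepFun_finsetSum_of_notMem hU hi).symm
      convert! this using 1
      ext ω; simp
    -- `b` is the conditional mean given the summand `i`, the martingale increment of the bounded
    -- differences method.
    set b : Ω → ℝ := fun ω => ∫ ω', u (x + (U i ω + ∑ j ∈ S, U j ω')) ∂P with hb
    have hbm : Measurable b := by
      have : Measurable fun p : Ω × Ω => u (x + (U i p.1 + ∑ j ∈ S, U j p.2)) :=
        hux.comp (((hU i).comp measurable_fst).add (hUS.comp measurable_snd))
      exact this.stronglyMeasurable.integral_prod_right'.measurable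
    have iu : ∀ y : V, Integrable (fun ω' => u (x + (y + ∑ j ∈ S, U j ω'))) P := fun y =>
      Integrable.of_bound (hux.comp (hUS.const_add y)).aestronglyMeasurable C
        (ae_of_all _ fun _ => hC _)
    have hbdiff : ∀ ω ω', |b ω - b ω'| ≤ c := by
      intro ω ω'
      rw [hb, ← integral_sub (iu _) (iu _), ← Real.norm_eq_abs]
      have h1 : ∀ ω'', ‖u (x + (U i ω + ∑ j ∈ S, U j ω''))
          - u (x + (U i ω' + ∑ j ∈ S, U j ω''))‖ ≤ c := fun ω'' => by
        rw [Real.norm_eq_abs, add_comm (U i ω), add_comm (U i ω'), ← add_assoc, ← add_assoc]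
        exact hdi _ _ _
      simpa using norm_integral_le_of_norm_le_const (μ := P) (ae_of_all _ h1)
    obtain ⟨ω₀⟩ : Nonempty Ω := nonempty_of_isProbabilityMeasure P
    -- Hoeffding's lemma on the interval of length `2c` centred at an arbitrary value of `b`; this
    -- gives the variance proxy `c²`, which is not optimal but suffices.
    have hsub := hasSubgaussianMGF_of_mem_Icc (μ := P) (X := b) (a := b ω₀ - c) (b := b ω₀ + c)
      hbm.aemeasurable (ae_of_all _ fun ω => by
        have := abs_le.mp (hbdiff ω ω₀)
        constructor <;> linarith)
    have hE : ∫ ω, u (x + ∑ j ∈ insert i S, U j ω) ∂P = ∫ ω, b ω ∂P := by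
      simp only [Finset.sum_insert hi]
      exact integral_add_of_indepFun (u := fun y => u (x + y)) hux (fun y => hC _) (hU i) hUS hind
    set E := ∫ ω, b ω ∂P with hEdef
    have hexpb : ∀ y, ‖Real.exp (l * (u (x + y) - E))‖ ≤ Real.exp (|l| * (C + |E|)) := by
      intro y
      rw [Real.norm_eq_abs, Real.abs_exp, Real.exp_le_exp]
      refine (le_abs_self _).trans ?_
      rw [abs_mul]
      refine mul_le_mul_of_nonneg_left ?_ (abs_nonneg l)
      exact (abs_sub _ _).trans (add_le_add (hC _) le_rfl)
    have hmain : ∫ ω, Real.exp (l * (u (x + ∑ j ∈ insert i S, U j ω) - E)) ∂P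
        = ∫ ω, ∫ ω', Real.exp (l * (u (x + (U i ω + ∑ j ∈ S, U j ω')) - E)) ∂P ∂P := by
      simp only [Finset.sum_insert hi]
      exact integral_add_of_indepFun (u := fun y => Real.exp (l * (u (x + y) - E))) (by fun_prop)
        hexpb (hU i) hUS hind
    -- With the summand `i` frozen, the induction hypothesis at the shifted point `x + U i ω`
    -- controls the fluctuation around `b ω`.
    have hinner : ∀ ω, ∫ ω', Real.exp (l * (u (x + (U i ω + ∑ j ∈ S, U j ω')) - E)) ∂P
        ≤ Real.exp (l * (b ω - E)) * Real.exp (S.card * c ^ 2 * l ^ 2 / 2) := by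
      intro ω
      have h1 := ih' (x + U i ω)
      simp only [add_assoc x] at h1
      calc _ = ∫ ω', Real.exp (l * (b ω - E))
            * Real.exp (l * (u (x + (U i ω + ∑ j ∈ S, U j ω')) - b ω)) ∂P := by
            refine integral_congr_ae (ae_of_all _ fun ω' => ?_)
            simp only [← Real.exp_add]
            congr 1; ring
        _ ≤ _ := by
            rw [integral_const_mul]
            exact mul_le_mul_of_nonneg_left h1 (Real.exp_nonneg _)
    have hcoe : (((‖b ω₀ + c - (b ω₀ - c)‖₊ / 2) ^ 2 : NNReal) : ℝ) = c ^ 2 := by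
      have : b ω₀ + c - (b ω₀ - c) = 2 * c := by ring
      rw [this]
      simp [abs_of_nonneg hc]
    have hm := hsub.mgf_le l
    rw [hcoe] at hm
    rw [hE, hmain, Finset.card_insert_of_notMem hi]
    calc _ ≤ ∫ ω, Real.exp (l * (b ω - E)) * Real.exp (S.card * c ^ 2 * l ^ 2 / 2) ∂P := by
          refine integral_mono_of_nonneg
            (ae_of_all _ fun ω => integral_nonneg fun _ => Real.exp_nonneg _)
            ((hsub.integrable_exp_mul l).mul_const _) (ae_of_all _ hinner)
      _ ≤ Real.exp (c ^ 2 * l ^ 2 / 2) * Real.exp (S.card * c ^ 2 * l ^ 2 / 2) := by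
          rw [integral_mul_const]
          exact mul_le_mul_of_nonneg_right hm (Real.exp_nonneg _)
      _ = _ := by
          rw [← Real.exp_add]
          congr 1
          push_cast
          ring

theorem hasSubgaussianMGF_sum_sub_integral {ι : Type*} {u : V → ℝ} (hu : Measurable u) {C : ℝ}
    (hC : ∀ x, |u x| ≤ C) {U : ι → Ω → V} (hU : ∀ i, Measurable (U i)) (hUi : iIndepFun U P)
    (S : Finset ι) {c : ℝ} (hc : 0 ≤ c)
    (hdiff : ∀ i ∈ S, ∀ x ω ω', |u (x + U i ω) - u (x + U i ω')| ≤ c) {K : NNReal}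
    (hK : S.card * c ^ 2 ≤ K) :
    HasSubgaussianMGF (fun ω => u (∑ i ∈ S, U i ω) - ∫ ω', u (∑ i ∈ S, U i ω') ∂P) K P where
  integrable_exp_mul l := by
    have hUS : Measurable fun ω => ∑ j ∈ S, U j ω := Finset.measurable_fun_sum _ fun j _ => hU j
    refine integrable_exp_mul_of_mem_Icc (a := -C - ∫ ω', u (∑ i ∈ S, U i ω') ∂P)
      (b := C - ∫ ω', u (∑ i ∈ S, U i ω') ∂P)
      ((hu.comp hUS).sub_const _).aemeasurable (ae_of_all _ fun ω => ?_)
    have := abs_le.mp (hC (∑ i ∈ S, U i ω))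
    constructor <;> linarith
  mgf_le l := by
    have h := mgf_sum_sub_integral_le hu hC hU hUi S hc hdiff 0 l
    simp only [zero_add] at h
    refine h.trans (Real.exp_le_exp.mpr ?_)
    gcongr

/-- With variance proxy `K / n` the probability of a deviation `ε` is at most `2 exp(-ε² / 2K)ⁿ`, a
geometric series, so Borel-Cantelli applies for each `ε = 1 / (k + 1)`. -/
theorem ae_tendsto_zero_of_hasSubgaussianMGF {g : ℕ → Ω → ℝ} {K : NNReal} (hK : 0 < K)
    (hg : ∀ n : ℕ, 1 ≤ n → HasSubgaussianMGF (g n) (K / n) P) :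
    ∀ᵐ ω ∂P, Tendsto (fun n => g n ω) atTop (𝓝 0) := by
  have hsum : ∀ ε : ℝ, 0 < ε → Summable fun n : ℕ => Real.exp (-ε ^ 2 / (2 * K)) ^ n := fun ε hε =>
    summable_geometric_of_lt_one (Real.exp_nonneg _) (by
      rw [Real.exp_lt_one_iff]
      have : (0 : ℝ) < K := by exact_mod_cast hK
      rw [neg_div]
      exact neg_neg_of_pos (by positivity))
  have hbound : ∀ ε : ℝ, 0 < ε → ∀ n : ℕ, 1 ≤ n →
      P {ω | ε ≤ |g n ω|} ≤ ENNReal.ofReal (2 * Real.exp (-ε ^ 2 / (2 * K)) ^ n) := by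
    intro ε hε n hn
    have e1 : Real.exp (-ε ^ 2 / (2 * ((K / n : NNReal) : ℝ)))
        = Real.exp (-ε ^ 2 / (2 * K)) ^ n := by
      rw [← Real.exp_nat_mul]
      congr 1
      have : (K : ℝ) ≠ 0 := by exact_mod_cast hK.ne'
      have : (n : ℝ) ≠ 0 := by positivity
      push_cast
      field_simp
    have h1 := (hg n hn).measure_ge_le hε.le
    have h2 := (hg n hn).neg.measure_ge_le hε.le
    rw [e1] at h1 h2
    rw [← ofReal_measureReal]
    refine ENNReal.ofReal_le_ofReal ?_
    have h3 : {ω | ε ≤ |g n ω|} ⊆ {ω | ε ≤ g n ω} ∪ {ω | ε ≤ (-g n) ω} := by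
      intro ω hω
      exact le_abs.mp (show ε ≤ |g n ω| from hω)
    calc P.real {ω | ε ≤ |g n ω|} ≤ _ := measureReal_mono h3
      _ ≤ _ := measureReal_union_le _ _
      _ ≤ _ := by linarith
  have hBC : ∀ k : ℕ, ∀ᵐ ω ∂P, ∀ᶠ n in atTop, |g n ω| < 1 / ((k : ℝ) + 1) := by
    intro k
    have hε : (0 : ℝ) < 1 / ((k : ℝ) + 1) := by positivity
    have hfin : ∑' n : ℕ, P {ω | 1 / ((k : ℝ) + 1) ≤ |g (n + 1) ω|} ≠ ⊤ := by
      refine ne_top_of_le_ne_top ?_ (ENNReal.tsum_le_tsum fun n => hbound _ hε (n + 1) (by omega))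
      have := ((summable_nat_add_iff 1).mpr (hsum _ hε)).mul_left 2
      exact this.tsum_ofReal_ne_top
    filter_upwards [ae_eventually_notMem hfin] with ω hω
    obtain ⟨N, hN⟩ := eventually_atTop.mp hω
    filter_upwards [eventually_ge_atTop (N + 1)] with n hn
    obtain ⟨k', rfl⟩ : ∃ k', n = k' + 1 := ⟨n - 1, by omega⟩
    simpa using hN k' (by omega)
  filter_upwards [ae_all_iff.mpr hBC] with ω hω
  rw [Metric.tendsto_atTop']
  intro ε hε
  obtain ⟨k, hk⟩ := exists_nat_one_div_lt hε
  obtain ⟨N, hN⟩ := eventually_atTop.mp (hω k)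
  exact ⟨N, fun n hn => by
    rw [Real.dist_eq, sub_zero]
    exact (hN n hn.le).trans hk⟩

end Concentration

/-- The series of the norms has finite expectation, hence converges almost surely. -/
theorem ae_tendsto_zero_of_integral_le {Ω : Type*} {mΩ : MeasurableSpace Ω}
    {P : Measure Ω} {g : ℕ → Ω → ℂ} (hgm : ∀ n, Integrable (g n) P)
    (hg : ∀ n : ℕ, ∫ ω, ‖g n ω‖ ∂P ≤ (1 / 2) ^ n) :
    ∀ᵐ ω ∂P, Tendsto (fun n => g n ω) atTop (𝓝 0) := by
  have h1 : ∑' n : ℕ, ∫⁻ ω, ‖g n ω‖ₑ ∂P ≠ ⊤ := by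
    have : ∀ n, ∫⁻ ω, ‖g n ω‖ₑ ∂P ≤ ENNReal.ofReal ((1 / 2) ^ n) := fun n => by
      rw [← ofReal_integral_norm_eq_lintegral_enorm (hgm n)]
      exact ENNReal.ofReal_le_ofReal (hg n)
    refine ne_top_of_le_ne_top ?_ (ENNReal.tsum_le_tsum this)
    exact summable_geometric_two.tsum_ofReal_ne_top
  rw [← lintegral_tsum fun n => (hgm n).aestronglyMeasurable.enorm] at h1
  have h2 : AEMeasurable (fun ω => ∑' n, ‖g n ω‖ₑ) P :=
    AEMeasurable.tsum fun n => (hgm n).aestronglyMeasurable.enorm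
  filter_upwards [ae_lt_top' h2 h1] with ω hω
  have h3 := ENNReal.tendsto_atTop_zero_of_tsum_ne_top hω.ne
  rw [tendsto_zero_iff_enorm_tendsto_zero]
  exact h3

end LinearProcessESD

end

/-! ### Gaussian noise and convergence of centered Gaussian arrays. -/

noncomputable section

namespace LinearProcessESD

section GaussianSums

variable {Ω : Type*} {mΩ : MeasurableSpace Ω} {P : Measure Ω} [IsProbabilityMeasure P]

theorem map_sum_eq_gaussianReal {ι : Type*} {X : ι → Ω → ℝ} (hX : ∀ i, Measurable (X i))
    (hXi : iIndepFun X P) {v : ι → NNReal} (hv : ∀ i, P.map (X i) = gaussianReal 0 (v i))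
    (S : Finset ι) : P.map (fun ω => ∑ i ∈ S, X i ω) = gaussianReal 0 (∑ i ∈ S, v i) := by
  classical
  induction S using Finset.induction_on with
  | empty => simp [gaussianReal_zero_var]
  | insert i S hi ih =>
    have hind : IndepFun (X i) (fun ω => ∑ j ∈ S, X j ω) P := by
      have := (hXi.indepFun_finsetSum_of_notMem hX hi).symm
      convert! this using 1
      ext ω; simp
    have h := gaussianReal_add_gaussianReal_of_indepFun hind (hv i) ih
    simp only [Finset.sum_insert hi]
    rw [add_zero] at h
    exact h

theorem integral_cexp_of_map_eq_gaussianReal {Ω : Type*} {mΩ : MeasurableSpace Ω}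
    {P : Measure Ω} {Z : Ω → ℝ} (hZ : AEMeasurable Z P) {v : NNReal}
    (h : P.map Z = gaussianReal 0 v) :
    ∫ ω, Complex.exp (Z ω * Complex.I) ∂P = Complex.exp (-(v : ℂ) / 2) := by
  have h1 := charFun_gaussianReal (μ := 0) (v := v) 1
  rw [← h, charFun_apply_real, integral_map hZ (by fun_prop)] at h1
  simpa [neg_div] using h1

end GaussianSums

section Noise

/-- The law of a two-parameter family of independent standard Gaussian random variables. -/
def noiseMeasure : Measure (ℤ → ℤ → ℝ) :=
  Measure.infinitePi fun _ : ℤ => Measure.infinitePi fun _ : ℤ => gaussianReal 0 1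

instance : IsProbabilityMeasure noiseMeasure := by
  unfold noiseMeasure; infer_instance

theorem iIndepFun_noise_rows :
    iIndepFun (fun (i : ℤ) (ω : ℤ → ℤ → ℝ) => ω i) noiseMeasure :=
  iIndepFun_infinitePi (X := fun (_ : ℤ) (x : ℤ → ℝ) => x) fun _ => measurable_id

theorem iIndepFun_noise_row (i : ℤ) :
    iIndepFun (fun (k : ℤ) (ω : ℤ → ℤ → ℝ) => ω i k) noiseMeasure := by
  have h := iIndepFun_uncurry_infinitePi' (X := fun (_ _ : ℤ) (x : ℝ) => x)
    (fun _ _ => gaussianReal 0 1) fun _ _ => measurable_id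
  exact h.precomp (g := fun k : ℤ => (i, k)) fun _ _ h => (Prod.mk.inj h).2

theorem map_noise (i k : ℤ) :
    noiseMeasure.map (fun ω : ℤ → ℤ → ℝ => ω i k) = gaussianReal 0 1 := by
  have h1 := (measurePreserving_eval_infinitePi
    (fun _ : ℤ => Measure.infinitePi fun _ : ℤ => gaussianReal 0 1) i)
  have h2 := (measurePreserving_eval_infinitePi (fun _ : ℤ => gaussianReal 0 1) k)
  exact (h2.comp h1).map_eq

theorem map_sum_noise {ι κ : Type*} (S : Finset ι) (T : ι → Finset κ) {r : ι → ℤ}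
    (hr : Function.Injective r) {k : κ → ℤ} (hk : Function.Injective k) (c : ι → κ → ℝ) :
    noiseMeasure.map (fun ω : ℤ → ℤ → ℝ => ∑ i ∈ S, ∑ t ∈ T i, c i t * ω (r i) (k t))
      = gaussianReal 0 (∑ i ∈ S, ∑ t ∈ T i, (NNReal.mk (c i t ^ 2) (sq_nonneg _))) := by
  have hm : ∀ i t, Measurable fun ω : ℤ → ℤ → ℝ => c i t * ω (r i) (k t) := by fun_prop
  refine map_sum_eq_gaussianReal (X := fun i (ω : ℤ → ℤ → ℝ) => ∑ t ∈ T i, c i t * ω (r i) (k t))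
    (fun i => Finset.measurable_fun_sum _ fun t _ => hm i t) ?_ (fun i => ?_) S
  · exact (iIndepFun_noise_rows.precomp hr).comp
      (fun i (x : ℤ → ℝ) => ∑ t ∈ T i, c i t * x (k t)) fun i => by fun_prop
  · refine map_sum_eq_gaussianReal (hm i) ?_ (fun t => ?_) (T i)
    · exact ((iIndepFun_noise_row (r i)).precomp hk).comp (fun t (x : ℝ) => c i t * x)
        fun t => by fun_prop
    · have h := gaussianReal_map_const_mul (μ := 0) (v := 1) (c i t)
      rw [← map_noise (r i) (k t), Measure.map_map (by fun_prop) (by fun_prop)] at h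
      rw [mul_zero, mul_one] at h
      exact h

end Noise

section Limit

variable {z : ℂ}

/-- The array which has the entries `e` on a finite set of indices and vanishes elsewhere. -/
def extendArray (I : Finset (ℕ+ × ℕ+)) (e : EuclideanSpace ℝ I) : ℕ+ → ℕ+ → ℝ := fun i j =>
  if h : (i, j) ∈ I then e ⟨(i, j), h⟩ else 0

/-- The entries of an array at a finite set of indices. -/
def restrictArray (I : Finset (ℕ+ × ℕ+)) (x : ℕ+ → ℕ+ → ℝ) : EuclideanSpace ℝ I :=
  WithLp.toLp 2 fun p : I => x p.1.1 p.1.2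

theorem continuous_extendArray (I : Finset (ℕ+ × ℕ+)) : Continuous (extendArray I) := by
  refine continuous_pi fun i => continuous_pi fun j => ?_
  unfold extendArray
  by_cases h : (i, j) ∈ I
  · simp only [h, dif_pos]
    fun_prop
  · simp only [h, dif_neg, not_false_eq_true]
    exact continuous_const

theorem stieltjesArray_extend_restrict {n : ℕ} {I : Finset (ℕ+ × ℕ+)}
    (hI : ∀ k l : ℕ, k < n → l ≤ k → (Nat.succPNat k, Nat.succPNat l) ∈ I) (x : ℕ+ → ℕ+ → ℝ) :
    stieltjesArray n z (extendArray I (restrictArray I x)) = stieltjesArray n z x := by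
  have : wignerMatrix (extendArray I (restrictArray I x)) n = wignerMatrix x n := by
    ext k l
    simp only [wignerMatrix, Matrix.of_apply, extendArray, restrictArray]
    split_ifs with h1 h2 h2
    · rfl
    · exact absurd (hI k l k.2 (by exact_mod_cast h1)) h2
    · rfl
    · exact absurd (hI l k l.2 (by exact_mod_cast (not_le.mp h1).le)) h2
  rw [stieltjesArray, stieltjesArray, this]

variable {Ω Γ : Type*} {mΩ : MeasurableSpace Ω} {mΓ : MeasurableSpace Γ} {P : Measure Ω}
  [IsProbabilityMeasure P] {κ : Measure Γ} [IsProbabilityMeasure κ]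

theorem charFun_map_restrictArray {Ω : Type*} {mΩ : MeasurableSpace Ω} {P : Measure Ω}
    (I : Finset (ℕ+ × ℕ+)) {W : Ω → ℕ+ → ℕ+ → ℝ}
    (hW : ∀ i j, AEMeasurable (fun ω => W ω i j) P) (t : EuclideanSpace ℝ I) :
    charFun (P.map fun ω => restrictArray I (W ω)) t
      = ∫ ω, Complex.exp ((∑ p ∈ I, extendArray I t p.1 p.2 * W ω p.1 p.2 : ℝ) * Complex.I) ∂P := by
  have hm : AEMeasurable (fun ω => restrictArray I (W ω)) P :=
    (WithLp.measurable_toLp 2 _).comp_aemeasurable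
      (aemeasurable_pi_lambda _ fun p => hW p.1.1 p.1.2)
  rw [charFun_apply, integral_map hm (by fun_prop)]
  refine integral_congr_ae (ae_of_all _ fun ω => ?_)
  simp only
  congr 3
  rw [← Finset.sum_coe_sort I, PiLp.inner_apply]
  refine Finset.sum_congr rfl fun p _ => ?_
  simp [extendArray, restrictArray]

/-- Convergence of the covariances of centered Gaussian arrays implies convergence of the
expected Stieltjes transform. -/
theorem tendsto_integral_stieltjesArray (hz : z.im ≠ 0) {n : ℕ} {I : Finset (ℕ+ × ℕ+)}
    (hI : ∀ k l : ℕ, k < n → l ≤ k → (Nat.succPNat k, Nat.succPNat l) ∈ I)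
    {W : ℕ → Γ → ℕ+ → ℕ+ → ℝ} (hW : ∀ M, Measurable (W M)) {Y : ℕ+ → ℕ+ → Ω → ℝ}
    (hY : IsGaussianProcess (fun (u : ℕ+ × ℕ+) => Y u.1 u.2) P)
    (hY0 : ∀ i j, ∫ ω, Y i j ω ∂P = 0) {v : (ℕ+ → ℕ+ → ℝ) → ℕ → NNReal}
    (hv : ∀ t M, κ.map (fun γ => ∑ p ∈ I, t p.1 p.2 * W M γ p.1 p.2) = gaussianReal 0 (v t M))
    (hlim : ∀ t : ℕ+ → ℕ+ → ℝ, Tendsto (fun M => (v t M : ℝ)) atTop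
      (𝓝 (∑ p ∈ I, ∑ q ∈ I, t p.1 p.2 * t q.1 q.2 * cov[Y p.1 p.2, Y q.1 q.2; P]))) :
    Tendsto (fun M => ∫ γ, stieltjesArray n z (W M γ) ∂κ) atTop
      (𝓝 (∫ ω, stieltjesArray n z (fun i j => Y i j ω) ∂P)) := by
  have hYm : ∀ i j, AEMeasurable (Y i j) P := fun i j => hY.aemeasurable (i, j)
  have hY2 : ∀ i j, MemLp (Y i j) 2 P := fun i j => (hY.hasGaussianLaw_eval (i, j)).memLp_two
  have hWm : ∀ M i j, AEMeasurable (fun γ => W M γ i j) κ := fun M i j => by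
    have := hW M
    fun_prop
  have hrW : ∀ M, AEMeasurable (fun γ => restrictArray I (W M γ)) κ := fun M =>
    (WithLp.measurable_toLp 2 _).comp_aemeasurable
      (aemeasurable_pi_lambda _ fun p => hWm M p.1.1 p.1.2)
  have hrY : AEMeasurable (fun ω => restrictArray I (fun i j => Y i j ω)) P :=
    (WithLp.measurable_toLp 2 _).comp_aemeasurable
      (aemeasurable_pi_lambda _ fun p => hYm p.1.1 p.1.2)
  let μ : ℕ → ProbabilityMeasure (EuclideanSpace ℝ I) := fun M =>
    ⟨κ.map fun γ => restrictArray I (W M γ), Measure.isProbabilityMeasure_map (hrW M)⟩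
  let μ₀ : ProbabilityMeasure (EuclideanSpace ℝ I) :=
    ⟨P.map fun ω => restrictArray I (fun i j => Y i j ω), Measure.isProbabilityMeasure_map hrY⟩
  -- Lévy's continuity theorem: every linear combination of the entries is centered Gaussian on both
  -- sides, so the characteristic functions are `exp(-variance / 2)` and converge with the
  -- variances.
  have hconv : Tendsto μ atTop (𝓝 μ₀) := by
    refine ProbabilityMeasure.tendsto_of_tendsto_charFun fun t => ?_
    set t' := extendArray I t with ht'
    have e0 : charFun (μ₀ : Measure (EuclideanSpace ℝ I)) t = Complex.exp
        (-((∑ p ∈ I, ∑ q ∈ I, t' p.1 p.2 * t' q.1 q.2 * cov[Y p.1 p.2, Y q.1 q.2; P] : ℝ) : ℂ)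
          / 2) := by
      refine (charFun_map_restrictArray I hYm t).trans ?_
      have hg : HasGaussianLaw (fun ω => ∑ p ∈ I, t' p.1 p.2 * Y p.1 p.2 ω) P := by
        have : IsGaussianProcess (fun (u : ℕ+ × ℕ+) ω => t' u.1 u.2 * Y u.1 u.2 ω) P :=
          hY.of_isGaussianProcess fun u => ⟨{u},
            t' u.1 u.2 • ContinuousLinearMap.proj ⟨u, by simp⟩, fun ω => by simp⟩
        exact this.hasGaussianLaw_fun_sum
      have hmean : ∫ ω, ∑ p ∈ I, t' p.1 p.2 * Y p.1 p.2 ω ∂P = 0 := by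
        rw [integral_finsetSum _ fun p _ =>
          ((hY2 p.1 p.2).integrable (by norm_num)).const_mul _]
        refine Finset.sum_eq_zero fun p _ => ?_
        rw [integral_const_mul, hY0, mul_zero]
      have hvar : Var[fun ω => ∑ p ∈ I, t' p.1 p.2 * Y p.1 p.2 ω; P]
          = ∑ p ∈ I, ∑ q ∈ I, t' p.1 p.2 * t' q.1 q.2 * cov[Y p.1 p.2, Y q.1 q.2; P] := by
        have hL : ∀ p ∈ I, MemLp (fun ω => t' p.1 p.2 * Y p.1 p.2 ω) 2 P := fun p _ =>
          (hY2 p.1 p.2).const_mul _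
        rw [← covariance_self (by fun_prop), covariance_fun_sum_fun_sum' hL hL]
        refine Finset.sum_congr rfl fun p _ => Finset.sum_congr rfl fun q _ => ?_
        rw [covariance_const_mul_left, covariance_const_mul_right, mul_assoc]
      have h1 := hg.map_eq_gaussianReal
      rw [hmean, hvar] at h1
      rw [integral_cexp_of_map_eq_gaussianReal hg.aemeasurable h1, ← hvar]
      congr 3
      exact congrArg Complex.ofReal (Real.coe_toNNReal _ (variance_nonneg _ _))
    have e1 : ∀ M, charFun (μ M : Measure (EuclideanSpace ℝ I)) t
        = Complex.exp (-((v t' M : ℝ) : ℂ) / 2) := fun M => by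
      refine (charFun_map_restrictArray I (hWm M) t).trans ?_
      exact integral_cexp_of_map_eq_gaussianReal
        (Finset.aemeasurable_fun_sum _ fun p _ => (hWm M p.1 p.2).const_mul _) (hv t' M)
    rw [e0]
    simp only [e1]
    refine (Complex.continuous_exp.tendsto _).comp (Tendsto.div_const (Tendsto.neg ?_) _)
    exact (Complex.continuous_ofReal.tendsto _).comp (hlim t')
  rw [ProbabilityMeasure.tendsto_iff_forall_integral_rclike_tendsto ℂ] at hconv
  -- The Stieltjes transform depends on the entries in `I` only, so it is a bounded continuous test
  -- function on a finite-dimensional space.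
  have hcont : Continuous fun e : EuclideanSpace ℝ I => stieltjesArray n z (extendArray I e) :=
    (continuous_stieltjesArray hz n).comp (continuous_extendArray I)
  have h := hconv (BoundedContinuousFunction.ofNormedAddCommGroup _ hcont (|z.im|⁻¹)
    fun e => norm_stieltjesArray_le hz n _)
  have e2 : ∀ M, ∫ e, stieltjesArray n z (extendArray I e) ∂(μ M : Measure (EuclideanSpace ℝ I))
      = ∫ γ, stieltjesArray n z (W M γ) ∂κ := fun M => by
    refine (integral_map (hrW M) hcont.aestronglyMeasurable).trans ?_
    simp only [stieltjesArray_extend_restrict hI]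
  have e3 : ∫ e, stieltjesArray n z (extendArray I e) ∂(μ₀ : Measure (EuclideanSpace ℝ I))
      = ∫ ω, stieltjesArray n z (fun i j => Y i j ω) ∂P := by
    refine (integral_map hrY hcont.aestronglyMeasurable).trans ?_
    simp only [stieltjesArray_extend_restrict hI]
  simp only [BoundedContinuousFunction.coe_ofNormedAddCommGroup] at h
  rw [← e3]
  simpa only [e2] using h

end Limit

end LinearProcessESD

end

/-! ### The truncated linear process: coefficient directions and summation of the errors of a row.
-/

noncomputable section

namespace LinearProcessESD

open scoped Matrix.Norms.Frobenius

/-- The index `t` stands for the column `t - M + 1`, so `t < M` are the nonpositive columns and `t <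
M + p - 1` those below `p`, where only the crude bound is available. The sum of `ρ` over `t < M` is
kept, since bounding each term by `r` would cost a factor `M`; the remaining crude terms are fewer
than `p`. -/
theorem sum_row_error_le {M p N : ℕ} (hp : 1 ≤ p) {ρ lam : ℕ → ℝ} {r α β b g h : ℝ}
    (hρr : ∀ t, ρ t ≤ r) (hr : 0 ≤ r) (hlam : ∀ t, 0 ≤ lam t) (hα : 0 ≤ α) (hβ : 0 ≤ β)
    (hb : 0 ≤ b) (hg : 0 ≤ g) (hh : 0 ≤ h) :
    ∑ t ∈ Finset.range (N + M), (if t < M + p - 1 then α * ρ t else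
        β + b * lam t + ∑ j ∈ Finset.Ico (t + 1 - p) t, (g + h * (lam t + lam j)))
      ≤ α * ∑ t ∈ Finset.range M, ρ t + α * p * r + N * (β + p * g)
        + (b + 2 * p * h) * ∑ t ∈ Finset.Ico M (N + M), lam t := by
  set S := Finset.Ico M (N + M) with hS
  have hcardS : (S.card : ℝ) = N := by simp [hS]
  have h0 : ∑ t ∈ Finset.range M, (if t < M + p - 1 then α * ρ t else
        β + b * lam t + ∑ j ∈ Finset.Ico (t + 1 - p) t, (g + h * (lam t + lam j)))
      = α * ∑ t ∈ Finset.range M, ρ t := by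
    rw [Finset.mul_sum]
    refine Finset.sum_congr rfl fun t ht => if_pos ?_
    have := Finset.mem_range.mp ht
    omega
  have h1 : ∀ t ∈ S, (if t < M + p - 1 then α * ρ t else
        β + b * lam t + ∑ j ∈ Finset.Ico (t + 1 - p) t, (g + h * (lam t + lam j)))
      ≤ (if t < M + p then α * r else 0) + (β + p * g + (b + p * h) * lam t)
        + h * (if M + p - 1 ≤ t then ∑ j ∈ Finset.Ico (t + 1 - p) t, lam j else 0) := by
    intro t _
    have hl := hlam t
    by_cases hlt : t < M + p - 1
    · rw [if_pos hlt, if_pos (by omega), if_neg (by omega)]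
      have : α * ρ t ≤ α * r := mul_le_mul_of_nonneg_left (hρr t) hα
      have : 0 ≤ β + p * g + (b + p * h) * lam t := by positivity
      linarith
    · rw [if_neg hlt, if_pos (show M + p - 1 ≤ t by omega)]
      have e : ∑ j ∈ Finset.Ico (t + 1 - p) t, (g + h * (lam t + lam j))
          = ((Finset.Ico (t + 1 - p) t).card : ℝ) * (g + h * lam t)
            + h * ∑ j ∈ Finset.Ico (t + 1 - p) t, lam j := by
        rw [Finset.mul_sum, ← nsmul_eq_mul, ← Finset.sum_const, ← Finset.sum_add_distrib]
        exact Finset.sum_congr rfl fun j _ => by ring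
      have hc : ((Finset.Ico (t + 1 - p) t).card : ℝ) ≤ p := by
        rw [Nat.card_Ico]
        exact_mod_cast (by omega : t - (t + 1 - p) ≤ p)
      have h2 : ((Finset.Ico (t + 1 - p) t).card : ℝ) * (g + h * lam t) ≤ p * (g + h * lam t) :=
        mul_le_mul_of_nonneg_right hc (by positivity)
      have h3 : 0 ≤ (if t < M + p then α * r else 0) := by split_ifs <;> positivity
      rw [e]
      linarith
  have h2 : ∑ t ∈ S, (if t < M + p then α * r else 0) ≤ α * p * r := by
    rw [← Finset.sum_filter, Finset.sum_const, nsmul_eq_mul]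
    have hc : (({t ∈ S | t < M + p} : Finset ℕ).card : ℝ) ≤ p := by
      have : ({t ∈ S | t < M + p} : Finset ℕ) ⊆ Finset.Ico M (M + p) := by
        intro t ht
        simp only [hS, Finset.mem_filter, Finset.mem_Ico] at ht ⊢
        omega
      have := Finset.card_le_card this
      rw [Nat.card_Ico] at this
      exact_mod_cast (by omega)
    calc _ ≤ (p : ℝ) * (α * r) := mul_le_mul_of_nonneg_right hc (by positivity)
      _ = _ := by ring
  -- Exchanging the sums, each `lam j` is met for at most `p` values of `t`. The restriction `M + p
  -- - 1 ≤ t` forces `j ≥ M`, so only tails of positive columns occur, the ones that the Lindeberg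
  -- condition controls.
  have h3 : ∑ t ∈ S, (if M + p - 1 ≤ t then ∑ j ∈ Finset.Ico (t + 1 - p) t, lam j else 0)
      ≤ p * ∑ t ∈ S, lam t := by
    rw [← Finset.sum_filter, Finset.sum_comm' (t' := S)
      (s' := fun j => {t ∈ S | M + p - 1 ≤ t ∧ j < t ∧ t < j + p}) (by
        intro t j
        simp only [hS, Finset.mem_filter, Finset.mem_Ico]
        omega), Finset.mul_sum]
    refine Finset.sum_le_sum fun j _ => ?_
    rw [Finset.sum_const, nsmul_eq_mul]
    refine mul_le_mul_of_nonneg_right ?_ (hlam j)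
    have : ({t ∈ S | M + p - 1 ≤ t ∧ j < t ∧ t < j + p} : Finset ℕ) ⊆ Finset.Ico j (j + p) := by
      intro t ht
      simp only [Finset.mem_filter, Finset.mem_Ico] at ht ⊢
      omega
    have := Finset.card_le_card this
    rw [Nat.card_Ico] at this
    exact_mod_cast (by omega)
  rw [← Finset.sum_range_add_sum_Ico _ (show M ≤ N + M by omega), h0]
  have h4 := Finset.sum_le_sum h1
  rw [Finset.sum_add_distrib, Finset.sum_add_distrib, ← Finset.mul_sum, Finset.sum_add_distrib,
    ← Finset.mul_sum, Finset.sum_const, nsmul_eq_mul, hcardS] at h4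
  have h5 := mul_le_mul_of_nonneg_left h3 hh
  linarith

/-- The array which collects the coefficients of the innovation number `t` in the row `i` of the
truncated linear process with coefficients `b`. -/
def coeffArray (b : ℕ → ℝ) (M i t : ℕ) : ℕ+ → ℕ+ → ℝ := fun i' j =>
  if i' = Nat.succPNat i ∧ j.natPred < t ∧ t ≤ j.natPred + M then b (j.natPred + M - t) else 0

theorem coeffArray_of_ne (b : ℕ → ℝ) (M i t : ℕ) {i' : ℕ+} (h : i' ≠ Nat.succPNat i) (j : ℕ+) :
    coeffArray b M i t i' j = 0 :=
  if_neg fun h' => h h'.1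

theorem coeffArray_succPNat (b : ℕ → ℝ) (M i t j : ℕ) :
    coeffArray b M i t (Nat.succPNat i) (Nat.succPNat j)
      = if j < t ∧ t ≤ j + M then b (j + M - t) else 0 := by
  simp [coeffArray]

theorem norm_wignerC_coeffArray_sq_le (b : ℕ → ℝ) (M t : ℕ) {i n : ℕ} (hi : i < n) :
    ‖wignerC n (coeffArray b M i t)‖ ^ 2
      ≤ 2 / n * ∑ j ∈ Finset.range (i + 1), if j < t ∧ t ≤ j + M then b (j + M - t) ^ 2 else 0 := by
  refine (norm_wignerC_sq_le n _).trans (le_of_eq ?_)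
  rw [Finset.sum_eq_single_of_mem i (Finset.mem_range.mpr hi)]
  · congr 1
    refine Finset.sum_congr rfl fun j _ => ?_
    rw [coeffArray_succPNat]
    split_ifs <;> simp
  · intro i' _ hne
    refine Finset.sum_eq_zero fun j _ => ?_
    rw [coeffArray_of_ne _ _ _ _ fun h => hne (Nat.succPNat_injective h)]
    simp

/-- An innovation enters different columns with different lags, so the squared coefficients in its
direction are distinct terms of the sum of `b l ^ 2`. -/
theorem norm_wignerC_coeffArray_sq_le_of_bound {b : ℕ → ℝ} {M : ℕ} {K : ℝ}
    (hb : ∑ l ∈ Finset.range M, b l ^ 2 ≤ K) (t : ℕ) {i n : ℕ} (hi : i < n) :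
    ‖wignerC n (coeffArray b M i t)‖ ^ 2 ≤ 2 / n * K := by
  refine (norm_wignerC_coeffArray_sq_le b M t hi).trans
    (mul_le_mul_of_nonneg_left ?_ (by positivity))
  refine le_trans ?_ hb
  rw [← Finset.sum_filter]
  have hinj : Set.InjOn (fun j => j + M - t)
      (({j ∈ Finset.range (i + 1) | j < t ∧ t ≤ j + M} : Finset ℕ) : Set ℕ) := by
    intro j hj j' hj' h
    simp only [Finset.coe_filter, Finset.mem_range, Set.mem_ofPred_eq] at hj hj' h
    omega
  rw [← Finset.sum_image (f := fun l => b l ^ 2) hinj]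
  refine Finset.sum_le_sum_of_subset_of_nonneg ?_ fun _ _ _ => sq_nonneg _
  intro l hl
  simp only [Finset.mem_image, Finset.mem_filter, Finset.mem_range] at hl ⊢
  omega

/-- An innovation with nonpositive index reaches the column of zero-based index `j` with a lag
larger than `j`. Summing over these innovations first leaves a tail of the coefficients for each
`j`, and a bound free of `M`. -/
theorem sum_norm_wignerC_coeffArray_sq_le {b : ℕ → ℝ} {M : ℕ} {θ : ℕ → ℝ}
    (hb : ∀ j, ∑ l ∈ Finset.Ico (j + 1) M, b l ^ 2 ≤ θ j) {i n : ℕ} (hi : i < n) :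
    ∑ t ∈ Finset.range M, ‖wignerC n (coeffArray b M i t)‖ ^ 2
      ≤ 2 / n * ∑ j ∈ Finset.range (i + 1), θ j := by
  refine (Finset.sum_le_sum fun t _ => norm_wignerC_coeffArray_sq_le b M t hi).trans ?_
  rw [← Finset.mul_sum, Finset.sum_comm]
  refine mul_le_mul_of_nonneg_left (Finset.sum_le_sum fun j _ => ?_) (by positivity)
  refine le_trans ?_ (hb j)
  rw [← Finset.sum_filter]
  have hinj : Set.InjOn (fun t => j + M - t)
      (({t ∈ Finset.range M | j < t ∧ t ≤ j + M} : Finset ℕ) : Set ℕ) := by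
    intro t ht t' ht' h
    simp only [Finset.coe_filter, Finset.mem_range, Set.mem_ofPred_eq] at ht ht' h
    omega
  rw [← Finset.sum_image (f := fun l => b l ^ 2) hinj]
  refine Finset.sum_le_sum_of_subset_of_nonneg ?_ fun _ _ _ => sq_nonneg _
  intro l hl
  simp only [Finset.mem_image, Finset.mem_filter, Finset.mem_range, Finset.mem_Ico] at hl ⊢
  omega

/-- The sum over a row of the truncated linear process, with innovations `y`. -/
def rowArray (b : ℕ → ℝ) (M i : ℕ) (y : ℤ → ℝ) : ℕ+ → ℕ+ → ℝ :=
  ∑ t ∈ Finset.range (i + 1 + M), y ((t : ℤ) - M + 1) • coeffArray b M i t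

theorem rowArray_of_ne (b : ℕ → ℝ) (M i : ℕ) (y : ℤ → ℝ) {i' : ℕ+} (h : i' ≠ Nat.succPNat i)
    (j : ℕ+) : rowArray b M i y i' j = 0 := by
  simp [rowArray, Finset.sum_apply, coeffArray_of_ne _ _ _ _ h]

theorem rowArray_succPNat (b : ℕ → ℝ) (M i : ℕ) (y : ℤ → ℝ) {j : ℕ} (hj : j ≤ i) :
    rowArray b M i y (Nat.succPNat i) (Nat.succPNat j)
      = ∑ l ∈ Finset.range M, b l * y ((j : ℤ) + 1 - l) := by
  simp only [rowArray, Finset.sum_apply, Pi.smul_apply, coeffArray_succPNat, smul_eq_mul, mul_ite,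
    mul_zero]
  rw [← Finset.sum_filter]
  -- The column of zero-based index `j` is `j + 1` and `t` stands for `t - M + 1`, so the lag is `j
  -- + M - t`.
  refine Finset.sum_bij' (fun t _ => j + M - t) (fun l _ => j + M - l) ?_ ?_ ?_ ?_ ?_
  · intro t ht
    simp only [Finset.mem_filter, Finset.mem_range] at ht ⊢
    omega
  · intro l hl
    simp only [Finset.mem_filter, Finset.mem_range] at hl ⊢
    omega
  · intro t ht
    simp only [Finset.mem_filter, Finset.mem_range] at ht ⊢
    omega
  · intro l hl
    simp only [Finset.mem_range] at hl ⊢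
    omega
  · intro t ht
    simp only [Finset.mem_filter, Finset.mem_range] at ht
    rw [mul_comm]
    congr 2
    push_cast [Nat.cast_sub ht.2.2]
    ring

theorem measurable_rowArray (b : ℕ → ℝ) (M i : ℕ) : Measurable (rowArray b M i) :=
  Finset.measurable_fun_sum _ fun _ _ => (measurable_pi_apply _).smul_const _

/-- The truncated linear process. -/
def truncatedArray (a : ℤ → ℤ → ℝ) (M n : ℕ) (y : ℤ → ℤ → ℝ) : ℕ+ → ℕ+ → ℝ :=
  ∑ i ∈ Finset.range n, rowArray (fun l => a ((i : ℤ) + 1) l) M i (y ((i : ℤ) + 1))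

theorem truncatedArray_succPNat (a : ℤ → ℤ → ℝ) (M : ℕ) (y : ℤ → ℤ → ℝ) {n i j : ℕ} (hi : i < n)
    (hj : j ≤ i) : truncatedArray a M n y (Nat.succPNat i) (Nat.succPNat j)
      = ∑ l ∈ Finset.range M, a ((i : ℤ) + 1) l * y ((i : ℤ) + 1) ((j : ℤ) + 1 - l) := by
  rw [truncatedArray, Finset.sum_apply, Finset.sum_apply,
    Finset.sum_eq_single_of_mem i (Finset.mem_range.mpr hi)]
  · exact rowArray_succPNat _ _ _ _ hj
  · intro i' _ hne
    exact rowArray_of_ne _ _ _ _ (fun h => hne (Nat.succPNat_injective h).symm) _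

end LinearProcessESD

end

/-! ### Comparison of the truncated process with its Gaussian counterpart, for fixed parameters. -/

noncomputable section

namespace LinearProcessESD

open scoped Matrix.Norms.Frobenius

section GaussianMoments

/-- The third absolute moment of the standard Gaussian law. -/
def gaussianThirdMoment : ℝ := ∫ g, |g| ^ 3 ∂(gaussianReal 0 1)

theorem gaussianThirdMoment_nonneg : 0 ≤ gaussianThirdMoment :=
  integral_nonneg fun _ => by positivity

theorem measurable_noise (i k : ℤ) : Measurable fun γ : ℤ → ℤ → ℝ => γ i k := by fun_prop

theorem map_const_mul_noise (s : ℝ) (i k : ℤ) :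
    noiseMeasure.map (fun γ => s * γ i k) = gaussianReal 0 (.mk (s ^ 2) (sq_nonneg _)) := by
  have h := gaussianReal_map_const_mul (μ := 0) (v := 1) s
  rw [← map_noise i k, Measure.map_map (by fun_prop) (by fun_prop)] at h
  rw [mul_zero, mul_one] at h
  exact h

theorem integrable_abs_cube_gaussianReal (v : NNReal) :
    Integrable (fun g => |g| ^ 3) (gaussianReal 0 v) := by
  have h := (memLp_id_gaussianReal (μ := 0) (v := v) 3).integrable_norm_pow (by norm_num)
  simpa using h

theorem integral_abs_cube_map_noise (s : ℝ) (i k : ℤ) :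
    ∫ g, |g| ^ 3 ∂(noiseMeasure.map fun γ => s * γ i k) = |s| ^ 3 * gaussianThirdMoment := by
  rw [gaussianThirdMoment, ← map_noise i k,
    integral_map ((measurable_noise i k).const_mul s).aemeasurable (by fun_prop),
    integral_map (measurable_noise i k).aemeasurable (by fun_prop), ← integral_const_mul]
  simp only [abs_mul, mul_pow]

theorem integral_sq_map_noise (s : ℝ) (i k : ℤ) :
    ∫ g, g ^ 2 ∂(noiseMeasure.map fun γ => s * γ i k) = s ^ 2 := by
  rw [map_const_mul_noise]
  have h := variance_id_gaussianReal (μ := 0) (v := .mk (s ^ 2) (sq_nonneg _))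
  rw [variance_eq_integral (by fun_prop)] at h
  simpa using h

end GaussianMoments

variable {Ω : Type*} {mΩ : MeasurableSpace Ω} {P : Measure Ω} [IsProbabilityMeasure P]
  {d : ℤ → ℤ → Ω → ℝ} {z : ℂ}

theorem rowPast_le (hd : ∀ i j, Measurable (d i j)) (i j : ℤ) : rowPast d i j ≤ mΩ :=
  iSup₂_le fun k _ => (hd i k).comap_le

theorem measurable_rowPast {i j k : ℤ} (h : k ≤ j) : Measurable[rowPast d i j] (d i k) :=
  (comap_measurable (d i k)).mono (le_iSup₂ (f := fun (k : ℤ) (_ : k ≤ j) =>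
    MeasurableSpace.comap (d i k) inferInstance) k h) le_rfl

/-- The Gaussian innovations which have the same variances as `d`. -/
def gaussianInnovations (P : Measure Ω) (d : ℤ → ℤ → Ω → ℝ) (γ : ℤ → ℤ → ℝ) (i k : ℤ) : ℝ :=
  √(∫ ω, d i k ω ^ 2 ∂P) * γ i k

/-- `swap_row` with the crude step for columns below `p` and the fine step for the others. The fine
errors are grouped into a constant part and multiples of tails, the shape expected by
`sum_row_error_le`. -/
theorem norm_integral_row_sub_le (hz : z.im ≠ 0) (hd : ∀ i j, Measurable (d i j))
    (hd2 : ∀ i j, MemLp (d i j) 2 P) {σ : ℝ} (hσ0 : 0 ≤ σ) (hσ : ∀ i j, ∫ ω, d i j ω ^ 2 ∂P ≤ σ ^ 2)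
    (hmart : ∀ i j, P[d i j | rowPast d i (j - 1)] =ᵐ[P] 0) (b : ℕ → ℝ) (M p n i : ℕ)
    (hp : 1 ≤ p) {τ : ℝ} (hτ : 0 < τ) {r : ℝ}
    (hr : ∀ t, ‖wignerC n (coeffArray b M i t)‖ ≤ r) {η : ℝ}
    (hη : ∀ k : ℤ, (p : ℤ) ≤ k →
      ∫ ω, |(P[fun ω' => d ((i : ℤ) + 1) k ω' ^ 2 | rowPast d ((i : ℤ) + 1) (k - p)]) ω
        - ∫ ω', d ((i : ℤ) + 1) k ω' ^ 2 ∂P| ∂P ≤ η) (x : ℕ+ → ℕ+ → ℝ) {c₂ c₃ : ℝ}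
    (hc₂ : c₂ = 2 * (|z.im|⁻¹) ^ 3 / n) (hc₃ : c₃ = 3 * (|z.im|⁻¹) ^ 4 / n) :
    ‖∫ ω, stieltjesArray n z (x + rowArray b M i (fun k => d ((i : ℤ) + 1) k ω)) ∂P
      - ∫ γ, stieltjesArray n z (x + rowArray b M i (gaussianInnovations P d γ ((i : ℤ) + 1)))
        ∂noiseMeasure‖
    ≤ ∑ t ∈ Finset.range (i + 1 + M), (if t < M + p - 1 then
        4 * c₂ * σ ^ 2 * ‖wignerC n (coeffArray b M i t)‖ ^ 2 else
        (c₂ * r ^ 2 * η + c₃ * r ^ 3 * (τ * σ ^ 2 + σ ^ 3 * gaussianThirdMoment))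
        + c₂ * r ^ 2 * sqTail P (d ((i : ℤ) + 1) ((t : ℤ) - M + 1)) τ
        + ∑ j ∈ Finset.Ico (t + 1 - p) t, (r ^ 2 * (2 * c₃ * τ * r * σ ^ 2
            + 2 * c₂ * (σ ^ 4 / τ ^ 2)) + 2 * c₂ * r ^ 2 *
            (sqTail P (d ((i : ℤ) + 1) ((t : ℤ) - M + 1)) τ
              + sqTail P (d ((i : ℤ) + 1) ((j : ℤ) - M + 1)) τ))) := by
  set s : ℤ → ℝ := fun k => √(∫ ω, d ((i : ℤ) + 1) k ω ^ 2 ∂P) with hs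
  have hs2 : ∀ k, s k ^ 2 = ∫ ω, d ((i : ℤ) + 1) k ω ^ 2 ∂P := fun k =>
    Real.sq_sqrt (integral_nonneg fun _ => sq_nonneg _)
  have hsσ : ∀ k, |s k| ≤ σ := fun k => by
    refine abs_le_of_sq_le_sq ?_ hσ0
    rw [hs2]
    exact hσ _ _
  have hc₂0 : 0 ≤ c₂ := by rw [hc₂]; positivity
  have hc₃0 : 0 ≤ c₃ := by rw [hc₃]; positivity
  have hF := isSmoothFunctional_stieltjesArray (z := z) hz n
  rw [← hc₂, ← hc₃] at hF
  have hξi : iIndepFun (fun (t : ℕ) (γ : ℤ → ℤ → ℝ) =>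
      s ((t : ℤ) - M + 1) * γ ((i : ℤ) + 1) ((t : ℤ) - M + 1)) noiseMeasure := by
    have hinj : Function.Injective fun t : ℕ => (t : ℤ) - M + 1 := fun t t' h => by
      simp only at h; omega
    exact ((iIndepFun_noise_row ((i : ℤ) + 1)).precomp hinj).comp
      (fun (t : ℕ) (y : ℝ) => s ((t : ℤ) - M + 1) * y) fun t => by fun_prop
  refine le_trans (le_of_eq ?_) (IsSmoothFunctional.swap_row (P := P) (κ := noiseMeasure)
    (d := fun (t : ℕ) ω => d ((i : ℤ) + 1) ((t : ℤ) - M + 1) ω)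
    (fun t => by fun_prop) hξi (coeffArray b M i) (i + 1 + M) ?_ hF x)
  · simp only [rowArray, gaussianInnovations, hs]
  intro t _ u L Q hu x
  have hprob : IsProbabilityMeasure (noiseMeasure.map fun γ : ℤ → ℤ → ℝ =>
      s ((t : ℤ) - M + 1) * γ ((i : ℤ) + 1) ((t : ℤ) - M + 1)) :=
    Measure.isProbabilityMeasure_map ((measurable_noise _ _).const_mul _).aemeasurable
  have hν2 : MemLp id 2 (noiseMeasure.map fun γ : ℤ → ℤ → ℝ =>
      s ((t : ℤ) - M + 1) * γ ((i : ℤ) + 1) ((t : ℤ) - M + 1)) := by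
    rw [map_const_mul_noise]; exact memLp_id_gaussianReal 2
  have hν0 : ∫ g, g ∂(noiseMeasure.map fun γ : ℤ → ℤ → ℝ =>
      s ((t : ℤ) - M + 1) * γ ((i : ℤ) + 1) ((t : ℤ) - M + 1)) = 0 := by
    rw [map_const_mul_noise, integral_id_gaussianReal]
  have hν : ∫ g, g ^ 2 ∂(noiseMeasure.map fun γ : ℤ → ℤ → ℝ =>
      s ((t : ℤ) - M + 1) * γ ((i : ℤ) + 1) ((t : ℤ) - M + 1))
      = ∫ ω, d ((i : ℤ) + 1) ((t : ℤ) - M + 1) ω ^ 2 ∂P := by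
    rw [integral_sq_map_noise, hs2]
  have hFle : ∀ t : ℕ, rowPast d ((i : ℤ) + 1) ((t : ℤ) - M) ≤ mΩ := fun t => rowPast_le hd _ _
  have hdF : ∀ j t : ℕ, j < t → Measurable[rowPast d ((i : ℤ) + 1) ((t : ℤ) - M)]
      (d ((i : ℤ) + 1) ((j : ℤ) - M + 1)) := fun j t hjt => measurable_rowPast (by omega)
  have hmart' : ∀ t : ℕ, P[d ((i : ℤ) + 1) ((t : ℤ) - M + 1) |
      rowPast d ((i : ℤ) + 1) ((t : ℤ) - M)] =ᵐ[P] 0 := fun t => by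
    have := hmart ((i : ℤ) + 1) ((t : ℤ) - M + 1)
    rwa [add_sub_cancel_right] at this
  split_ifs with ht
  · have hA : Measurable[rowPast d ((i : ℤ) + 1) ((t : ℤ) - M)] fun ω =>
        x + ∑ j ∈ Finset.range t, d ((i : ℤ) + 1) ((j : ℤ) - M + 1) ω • coeffArray b M i j :=
      Measurable.const_add (Finset.measurable_fun_sum _ fun j hj =>
        (hdF j t (Finset.mem_range.mp hj)).smul_const _) _
    refine (hu.swap_step_crude (hFle t) hA (hd _ _) (hd2 _ _) (hmart' t) _ _ hν2 hν0 hν).trans ?_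
    calc _ ≤ 4 * c₂ * ‖wignerC n (coeffArray b M i t)‖ ^ 2 * σ ^ 2 :=
          mul_le_mul_of_nonneg_left (hσ _ _) (by positivity)
      _ = _ := by ring
  -- The cut `t' = t + 1 - p` corresponds to the σ-field of the column `t - M + 1` shifted back by
  -- `p`, which is the one in A3; it removes `p - 1` innovations.
  · have h := hu.swap_step_fine (P := P) (fun v => norm_nonneg _) hc₂0 hc₃0
      (F := fun t : ℕ => rowPast d ((i : ℤ) + 1) ((t : ℤ) - M)) hFle
      (d := fun (t : ℕ) ω => d ((i : ℤ) + 1) ((t : ℤ) - M + 1) ω) (fun t => hd _ _) hdF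
      (fun t => hd2 _ _) hmart' (fun t => hσ _ _) (coeffArray b M i) hr (t' := t + 1 - p) (t := t)
      (by omega) (η := η) (by
        have h1 := hη ((t : ℤ) - M + 1) (by omega)
        have h2 : (((t + 1 - p : ℕ) : ℤ) - M) = (t : ℤ) - M + 1 - p := by omega
        rw [h2]
        exact h1) _ hν2 hν0 hν (by
        rw [map_const_mul_noise]; exact integrable_abs_cube_gaussianReal _)
      (κ₃ := σ ^ 3 * gaussianThirdMoment) (by
        rw [integral_abs_cube_map_noise]
        exact mul_le_mul_of_nonneg_right (pow_le_pow_left₀ (abs_nonneg _) (hsσ _) 3)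
          gaussianThirdMoment_nonneg) hτ x
    refine h.trans (le_of_eq ?_)
    have e : ∀ j : ℕ, r ^ 2 * (2 * c₃ * τ * r * σ ^ 2
          + 2 * c₂ * (sqTail P (d ((i : ℤ) + 1) ((t : ℤ) - M + 1)) τ
            + sqTail P (d ((i : ℤ) + 1) ((j : ℤ) - M + 1)) τ + σ ^ 4 / τ ^ 2))
        = r ^ 2 * (2 * c₃ * τ * r * σ ^ 2 + 2 * c₂ * (σ ^ 4 / τ ^ 2)) + 2 * c₂ * r ^ 2 *
            (sqTail P (d ((i : ℤ) + 1) ((t : ℤ) - M + 1)) τ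
              + sqTail P (d ((i : ℤ) + 1) ((j : ℤ) - M + 1)) τ) := fun j => by ring
    simp only [e]
    ring

theorem sum_sqTail_shift {Ω : Type*} {mΩ : MeasurableSpace Ω} {P : Measure Ω}
    {d : ℤ → ℤ → Ω → ℝ} (i M : ℕ) (τ : ℝ) :
    ∑ t ∈ Finset.Ico M (i + 1 + M), sqTail P (d ((i : ℤ) + 1) ((t : ℤ) - M + 1)) τ
      = ∑ j ∈ Finset.range (i + 1), sqTail P (d ((i : ℤ) + 1) ((j : ℤ) + 1)) τ := by
  rw [Finset.sum_Ico_eq_sum_range, Nat.add_sub_cancel]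
  refine Finset.sum_congr rfl fun j _ => ?_
  congr 2
  push_cast
  ring

/-- The comparison of the expected Stieltjes transforms of the truncated process and its Gaussian
counterpart. -/
theorem norm_integral_truncatedArray_sub_le (hz : z.im ≠ 0) (hd : ∀ i j, Measurable (d i j))
    (hd2 : ∀ i j, MemLp (d i j) 2 P) {σ : ℝ} (hσ0 : 0 ≤ σ) (hσ : ∀ i j, ∫ ω, d i j ω ^ 2 ∂P ≤ σ ^ 2)
    (hmart : ∀ i j, P[d i j | rowPast d i (j - 1)] =ᵐ[P] 0)
    (hindep : iIndepFun (fun (i : {i : ℤ // 1 ≤ i}) (ω : Ω) (j : ℤ) => d i j ω) P)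
    {a : ℤ → ℤ → ℝ} {K : ℝ} (hK : ∀ i M : ℕ, ∑ l ∈ Finset.range M, a ((i : ℤ) + 1) l ^ 2 ≤ K)
    {N : ℕ} {δ : ℝ} (hδ : 0 ≤ δ)
    (hN : ∀ i M j : ℕ, N ≤ j → ∑ l ∈ Finset.Ico (j + 1) M, a ((i : ℤ) + 1) l ^ 2 ≤ δ) {p : ℕ}
    (hp : 1 ≤ p) {η : ℝ} (hη0 : 0 ≤ η)
    (hη : ∀ (i : ℕ) (k : ℤ), (p : ℤ) ≤ k →
      ∫ ω, |(P[fun ω' => d ((i : ℤ) + 1) k ω' ^ 2 | rowPast d ((i : ℤ) + 1) (k - p)]) ω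
        - ∫ ω', d ((i : ℤ) + 1) k ω' ^ 2 ∂P| ∂P ≤ η) {ε : ℝ} (hε : 0 < ε) (M : ℕ) {n : ℕ}
    (hn : 1 ≤ n) {C₂ C₃ : ℝ} (hC₂ : C₂ = 2 * (|z.im|⁻¹) ^ 3) (hC₃ : C₃ = 3 * (|z.im|⁻¹) ^ 4) :
    ‖∫ ω, stieltjesArray n z (truncatedArray a M n (fun i k => d i k ω)) ∂P
      - ∫ γ, stieltjesArray n z (truncatedArray a M n (gaussianInnovations P d γ)) ∂noiseMeasure‖
    ≤ 8 * C₂ * σ ^ 2 * (N * K / n + δ) + 4 * C₂ * σ ^ 2 * p * √(2 * K) ^ 2 / n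
      + C₂ * √(2 * K) ^ 2 * η
      + C₃ * √(2 * K) ^ 3 * (ε * σ ^ 2 + σ ^ 3 * gaussianThirdMoment / √n)
      + p * √(2 * K) ^ 2 * (2 * C₃ * ε * √(2 * K) * σ ^ 2 + 2 * C₂ * σ ^ 4 / (ε ^ 2 * n))
      + C₂ * √(2 * K) ^ 2 * (1 + 4 * p) * (1 / (n : ℝ) ^ 2 * ∑ i ∈ Finset.range n,
        ∑ j ∈ Finset.range (i + 1), sqTail P (d ((i : ℤ) + 1) ((j : ℤ) + 1)) (ε * √n)) := by
  have hK0 : 0 ≤ K := (Finset.sum_nonneg fun _ _ => sq_nonneg _).trans (hK 0 0)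
  have hw : 0 < √(n : ℝ) := Real.sqrt_pos.mpr (by exact_mod_cast hn)
  have hnw : (n : ℝ) = √(n : ℝ) ^ 2 := (Real.sq_sqrt (by positivity)).symm
  have hn0 : (0 : ℝ) < n := by exact_mod_cast hn
  have hC₂0 : 0 ≤ C₂ := by rw [hC₂]; positivity
  have hC₃0 : 0 ≤ C₃ := by rw [hC₃]; positivity
  have hG3 := gaussianThirdMoment_nonneg
  -- `r` bounds the Frobenius norm of the direction of any single innovation.
  set r := √(2 * K) / √n with hr
  have hr0 : 0 ≤ r := by positivity
  have hr2 : r ^ 2 = 2 / n * K := by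
    rw [hr, div_pow, Real.sq_sqrt (by positivity), ← hnw]; ring
  set c₂ := C₂ / n with hc₂
  set c₃ := C₃ / n with hc₃
  have hc₂0 : 0 ≤ c₂ := by positivity
  have hc₃0 : 0 ≤ c₃ := by positivity
  -- The truncation level is that of the Lindeberg condition.
  have hτ : 0 < ε * √(n : ℝ) := by positivity
  set lam : ℕ → ℕ → ℝ := fun i t => sqTail P (d ((i : ℤ) + 1) ((t : ℤ) - M + 1)) (ε * √n) with hlam
  set bm : ℕ → ℕ → ℝ := fun i l => a ((i : ℤ) + 1) l with hbm
  have hUm : ∀ i, Measurable fun ω => rowArray (bm i) M i (fun k => d ((i : ℤ) + 1) k ω) := fun i =>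
    (measurable_rowArray _ M i).comp (measurable_pi_lambda _ fun k => hd _ k)
  have hWm : ∀ i, Measurable fun γ : ℤ → ℤ → ℝ =>
      rowArray (bm i) M i (gaussianInnovations P d γ ((i : ℤ) + 1)) := fun i =>
    (measurable_rowArray _ M i).comp (measurable_pi_lambda _ fun k => by
      unfold gaussianInnovations; fun_prop)
  have hUi : iIndepFun (fun i ω => rowArray (bm i) M i (fun k => d ((i : ℤ) + 1) k ω)) P := by
    have hinj : Function.Injective fun i : ℕ => (⟨(i : ℤ) + 1, by omega⟩ : {i : ℤ // 1 ≤ i}) :=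
      fun i i' h => by
        have := congrArg Subtype.val h
        simp only at this
        omega
    exact (hindep.precomp hinj).comp (fun i y => rowArray (bm i) M i y)
      fun i => measurable_rowArray _ _ _
  have hWi : iIndepFun (fun i (γ : ℤ → ℤ → ℝ) =>
      rowArray (bm i) M i (gaussianInnovations P d γ ((i : ℤ) + 1))) noiseMeasure := by
    have hinj : Function.Injective fun i : ℕ => (i : ℤ) + 1 := fun i i' h => by
      simp only at h; omega
    exact (iIndepFun_noise_rows.precomp hinj).comp
      (fun i (y : ℤ → ℝ) => rowArray (bm i) M i
        (fun k => √(∫ ω, d ((i : ℤ) + 1) k ω ^ 2 ∂P) * y k))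
      fun i => (measurable_rowArray _ _ _).comp (by fun_prop)
  have hrow : ∀ i ∈ Finset.range n, ∀ x : ℕ+ → ℕ+ → ℝ,
      ‖∫ ω, stieltjesArray n z (x + rowArray (bm i) M i (fun k => d ((i : ℤ) + 1) k ω)) ∂P
      - ∫ γ, stieltjesArray n z (x + rowArray (bm i) M i (gaussianInnovations P d γ ((i : ℤ) + 1)))
        ∂noiseMeasure‖ ≤ 4 * c₂ * σ ^ 2 * (2 / n * (N * K + n * δ))
          + 4 * c₂ * σ ^ 2 * p * r ^ 2
          + n * ((c₂ * r ^ 2 * η + c₃ * r ^ 3 * (ε * √n * σ ^ 2 + σ ^ 3 * gaussianThirdMoment))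
            + p * (r ^ 2 * (2 * c₃ * (ε * √n) * r * σ ^ 2 + 2 * c₂ * (σ ^ 4 / (ε * √n) ^ 2))))
          + (c₂ * r ^ 2 + 2 * p * (2 * c₂ * r ^ 2)) *
            ∑ j ∈ Finset.range (i + 1), sqTail P (d ((i : ℤ) + 1) ((j : ℤ) + 1)) (ε * √n) := by
    intro i hi x
    have hin := Finset.mem_range.mp hi
    have hρ : ∀ t, ‖wignerC n (coeffArray (bm i) M i t)‖ ^ 2 ≤ r ^ 2 := fun t => by
      rw [hr2]
      exact norm_wignerC_coeffArray_sq_le_of_bound (hK i M) t hin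
    have h1 := norm_integral_row_sub_le hz hd hd2 hσ0 hσ hmart (bm i) M p n i hp hτ
      (fun t => abs_le_of_sq_le_sq' (hρ t) hr0 |>.2) (hη i) x
      (c₂ := c₂) (c₃ := c₃) (by rw [hc₂, hC₂]) (by rw [hc₃, hC₃])
    have h2 := sum_row_error_le (M := M) (p := p) (N := i + 1) hp
      (ρ := fun t => ‖wignerC n (coeffArray (bm i) M i t)‖ ^ 2) (lam := lam i) (r := r ^ 2)
      (α := 4 * c₂ * σ ^ 2)
      (β := c₂ * r ^ 2 * η + c₃ * r ^ 3 * (ε * √n * σ ^ 2 + σ ^ 3 * gaussianThirdMoment))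
      (b := c₂ * r ^ 2)
      (g := r ^ 2 * (2 * c₃ * (ε * √n) * r * σ ^ 2 + 2 * c₂ * (σ ^ 4 / (ε * √n) ^ 2)))
      (h := 2 * c₂ * r ^ 2) hρ (by positivity) (fun t => sqTail_nonneg _ _) (by positivity)
      (by positivity) (by positivity) (by positivity) (by positivity)
    refine (h1.trans h2).trans ?_
    have h3 : ∑ t ∈ Finset.range M, ‖wignerC n (coeffArray (bm i) M i t)‖ ^ 2
        ≤ 2 / n * (N * K + n * δ) := by
      -- The coefficient tail beyond `j` is at most `K` for the first `N` columns and at most `δ`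
      -- afterwards; averaged over the row, this leaves `N K / n + δ` up to a factor.
      refine (sum_norm_wignerC_coeffArray_sq_le (θ := fun j => (if j < N then K else 0) + δ)
        (fun j => ?_) hin).trans (mul_le_mul_of_nonneg_left ?_ (by positivity))
      · split_ifs with hj
        · have : ∑ l ∈ Finset.Ico (j + 1) M, bm i l ^ 2 ≤ ∑ l ∈ Finset.range M, bm i l ^ 2 := by
            refine Finset.sum_le_sum_of_subset_of_nonneg (fun l hl => ?_) fun _ _ _ => sq_nonneg _
            simp only [Finset.mem_Ico, Finset.mem_range] at hl ⊢
            omega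
          linarith [hK i M]
        · linarith [hN i M j (not_lt.mp hj)]
      · rw [Finset.sum_add_distrib, Finset.sum_const, nsmul_eq_mul, Finset.card_range]
        refine add_le_add ?_ (mul_le_mul_of_nonneg_right (by exact_mod_cast hin) hδ)
        rw [← Finset.sum_filter, Finset.sum_const, nsmul_eq_mul]
        refine mul_le_mul_of_nonneg_right ?_ hK0
        have : ({j ∈ Finset.range (i + 1) | j < N} : Finset ℕ) ⊆ Finset.range N := by
          intro j hj
          simp only [Finset.mem_filter, Finset.mem_range] at hj ⊢
          exact hj.2
        have := Finset.card_le_card this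
        rw [Finset.card_range] at this
        exact_mod_cast this
    have h4 : ((i + 1 : ℕ) : ℝ) ≤ n := by exact_mod_cast hin
    rw [← sum_sqTail_shift i M]
    refine add_le_add (add_le_add (add_le_add ?_ le_rfl) ?_) le_rfl
    · exact mul_le_mul_of_nonneg_left h3 (by positivity)
    · exact mul_le_mul_of_nonneg_right h4 (by positivity)
  have hmain := norm_integral_sum_sub_le (continuous_stieltjesArray hz n).measurable
    (norm_stieltjesArray_le hz n) hUm hWm hUi hWi (Finset.range n) hrow 0
  simp only [zero_add] at hmain
  unfold truncatedArray
  refine hmain.trans (le_of_eq ?_)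
  rw [Finset.sum_add_distrib, Finset.sum_const, Finset.card_range, nsmul_eq_mul, ← Finset.mul_sum]
  generalize (∑ i ∈ Finset.range n, ∑ j ∈ Finset.range (i + 1),
    sqTail P (d ((i : ℤ) + 1) ((j : ℤ) + 1)) (ε * √n)) = Λ
  rw [hc₂, hc₃, hr]
  -- With `n = w²` the two sides become rational expressions in `w`, so that the powers of `n` and
  -- `√n` are matched by algebra.
  generalize √(n : ℝ) = w at *
  rw [hnw]
  field_simp
  ring

end LinearProcessESD

end

/-! ### Quantitative forms of A1-A3 and the choice of the parameters. -/

noncomputable section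

namespace LinearProcessESD

section Hypotheses

variable {Ω : Type*} {mΩ : MeasurableSpace Ω} {P : Measure Ω}
  {a : ℤ → ℤ → ℝ} {d : ℤ → ℤ → Ω → ℝ}

theorem integral_sq_eq_toReal_eLpNorm_sq {f : Ω → ℝ} (hf : MemLp f 2 P) :
    ∫ ω, f ω ^ 2 ∂P = (eLpNorm f 2 P).toReal ^ 2 := by
  have h0 : 0 ≤ ∫ ω, f ω ^ 2 ∂P := integral_nonneg fun _ => sq_nonneg _
  rw [hf.eLpNorm_eq_integral_rpow_norm (by norm_num) (by norm_num)]
  simp only [ENNReal.toReal_ofNat, Real.rpow_ofNat, Real.norm_eq_abs, sq_abs]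
  rw [ENNReal.toReal_ofReal (by positivity), ← Real.rpow_natCast, ← Real.rpow_mul h0]
  norm_num

theorem CondA2.exists_bound (hd : ∀ i j, Measurable (d i j)) (h : CondA2 d P) :
    ∃ σ : ℝ, 0 < σ ∧ (∀ i j, MemLp (d i j) 2 P) ∧ ∀ i j, ∫ ω, d i j ω ^ 2 ∂P ≤ σ ^ 2 := by
  obtain ⟨⟨σ, hσ, hlt⟩, -⟩ := h
  have hle : ∀ i j, eLpNorm (d i j) 2 P ≤ ENNReal.ofReal σ := fun i j =>
    (le_iSup₂ (f := fun i j => eLpNorm (d i j) 2 P) i j).trans hlt.le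
  have hm : ∀ i j, MemLp (d i j) 2 P := fun i j =>
    ⟨(hd i j).aestronglyMeasurable, (hle i j).trans_lt ENNReal.ofReal_lt_top⟩
  refine ⟨σ, hσ, hm, fun i j => ?_⟩
  rw [integral_sq_eq_toReal_eLpNorm_sq (hm i j)]
  exact pow_le_pow_left₀ ENNReal.toReal_nonneg (ENNReal.toReal_le_of_le_ofReal hσ.le (hle i j)) 2

theorem sum_Icc_one_eq_sum_range (f : ℕ → ℝ) (n : ℕ) :
    ∑ i ∈ Finset.Icc 1 n, f i = ∑ i ∈ Finset.range n, f (i + 1) := by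
  induction n with
  | zero => simp
  | succ n ih => rw [Finset.sum_Icc_succ_top (by omega), Finset.sum_range_succ, ih]

theorem CondA2.tendsto_sqTail (h : CondA2 d P) {ε : ℝ} (hε : 0 < ε) :
    Tendsto (fun n : ℕ => 1 / (n : ℝ) ^ 2 * ∑ i ∈ Finset.range n,
      ∑ j ∈ Finset.range (i + 1), sqTail P (d ((i : ℤ) + 1) ((j : ℤ) + 1)) (ε * √n))
      atTop (𝓝 0) := by
  refine (h.2 ε hε).congr fun n => ?_
  simp only [sum_Icc_one_eq_sum_range, sqTail, Nat.cast_add, Nat.cast_one]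

theorem CondA3.exists_lag [IsProbabilityMeasure P] (h : CondA3 d P) {η : ℝ} (hη : 0 < η) :
    ∃ p : ℕ, 1 ≤ p ∧ ∀ (i : ℕ) (k : ℤ), (p : ℤ) ≤ k →
      ∫ ω, |(P[fun ω' => d ((i : ℤ) + 1) k ω' ^ 2 | rowPast d ((i : ℤ) + 1) (k - p)]) ω
        - ∫ ω', d ((i : ℤ) + 1) k ω' ^ 2 ∂P| ∂P ≤ η := by
  obtain ⟨p, hp, hp1⟩ := ((h.2.eventually (gt_mem_nhds (ENNReal.ofReal_pos.mpr hη))).and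
    (eventually_ge_atTop 1)).exists
  refine ⟨p, hp1, fun i k hk => ?_⟩
  have h1 : eLpNorm (fun ω => (P[fun ω' => d ((i : ℤ) + 1) k ω' ^ 2 |
      rowPast d ((i : ℤ) + 1) (k - p)]) ω - ∫ ω', d ((i : ℤ) + 1) k ω' ^ 2 ∂P) 1 P
      ≤ ENNReal.ofReal η := by
    refine le_trans ?_ hp.le
    refine le_trans ?_ (le_iSup₂ ((i : ℤ) + 1) (by omega))
    exact le_iSup₂ (f := fun (j : ℤ) (_ : (p : ℤ) ≤ j) =>
      eLpNorm (fun ω => (P[fun ω' => d ((i : ℤ) + 1) j ω' ^ 2 |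
        rowPast d ((i : ℤ) + 1) (j - p)]) ω - ∫ ω', d ((i : ℤ) + 1) j ω' ^ 2 ∂P) 1 P) k hk
  have hi : Integrable (fun ω => (P[fun ω' => d ((i : ℤ) + 1) k ω' ^ 2 |
      rowPast d ((i : ℤ) + 1) (k - p)]) ω - ∫ ω', d ((i : ℤ) + 1) k ω' ^ 2 ∂P) P :=
    integrable_condExp.sub (integrable_const _)
  rw [eLpNorm_one_eq_lintegral_enorm, ← ofReal_integral_norm_eq_lintegral_enorm hi] at h1
  exact (ENNReal.ofReal_le_ofReal_iff hη.le).mp h1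

theorem CondA1.sum_range_le_of_tendsto {A : ℤ → ℝ}
    (h : TendstoUniformlyOn (fun (n : ℕ) (i : ℤ) => ∑ ℓ ∈ Finset.range (n + 1), a i (ℓ : ℤ) ^ 2) A
      atTop {i : ℤ | 1 ≤ i}) (i M : ℕ) :
    ∑ l ∈ Finset.range M, a ((i : ℤ) + 1) l ^ 2 ≤ A ((i : ℤ) + 1) := by
  have hmono : Monotone fun n : ℕ => ∑ l ∈ Finset.range (n + 1), a ((i : ℤ) + 1) l ^ 2 :=
    fun m n hmn => Finset.sum_le_sum_of_subset_of_nonneg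
      (Finset.range_mono (by omega)) fun _ _ _ => sq_nonneg _
  have hlim := h.tendsto_at (show (i : ℤ) + 1 ∈ {i : ℤ | 1 ≤ i} by
    simp only [Set.mem_ofPred_eq]; omega)
  exact (Finset.sum_le_sum_of_subset_of_nonneg (Finset.range_mono (Nat.le_succ M))
    fun _ _ _ => sq_nonneg _).trans (hmono.ge_of_tendsto hlim M)

theorem CondA1.exists_bound (h : CondA1 a) :
    ∃ K : ℝ, ∀ i M : ℕ, ∑ l ∈ Finset.range M, a ((i : ℤ) + 1) l ^ 2 ≤ K := by
  obtain ⟨A, hA, C, hC⟩ := h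
  exact ⟨C, fun i M => (CondA1.sum_range_le_of_tendsto hA i M).trans (hC _ (by omega))⟩

/-- Partial sums of squares stay below their limit, so uniform closeness of the partial sums to the
limit bounds all later blocks, uniformly in the row. -/
theorem CondA1.exists_tail_le (h : CondA1 a) {δ : ℝ} (hδ : 0 < δ) :
    ∃ N : ℕ, ∀ i M j : ℕ, N ≤ j →
      ∑ l ∈ Finset.Ico (j + 1) M, a ((i : ℤ) + 1) l ^ 2 ≤ δ := by
  obtain ⟨A, hA, -⟩ := h
  obtain ⟨N, hN⟩ := eventually_atTop.mp (Metric.tendstoUniformlyOn_iff.mp hA δ hδ)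
  refine ⟨N, fun i M j hj => ?_⟩
  have h1 := hN j hj ((i : ℤ) + 1) (by simp only [Set.mem_ofPred_eq]; omega)
  rcases le_total (j + 1) M with hM | hM
  · have h2 := CondA1.sum_range_le_of_tendsto hA i M
    rw [← Finset.sum_range_add_sum_Ico _ hM] at h2
    have h3 := (abs_lt.mp (Real.dist_eq _ _ ▸ h1)).2
    linarith
  · rw [Finset.Ico_eq_empty_of_le hM, Finset.sum_empty]
    exact hδ.le

end Hypotheses

section Comparison

variable {Ω : Type*} {mΩ : MeasurableSpace Ω} {P : Measure Ω} [IsProbabilityMeasure P]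
  {a : ℤ → ℤ → ℝ} {d : ℤ → ℤ → Ω → ℝ} {z : ℂ}

/-- The order of the choices matters: `δ` and `η` first, which determine `N` and the lag `p`; then
`ε`, depending on `p`; finally `n` large. The truncation `M` is quantified after `n`, because no
bound involves it. -/
theorem eventually_forall_norm_integral_sub_le (hz : z.im ≠ 0) (hd : ∀ i j, Measurable (d i j))
    (hA1 : CondA1 a) (hA2 : CondA2 d P) (hA3 : CondA3 d P)
    (hindep : iIndepFun (fun (i : {i : ℤ // 1 ≤ i}) (ω : Ω) (j : ℤ) => d i j ω) P)
    {θ : ℝ} (hθ : 0 < θ) :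
    ∀ᶠ n in atTop, ∀ M,
      ‖∫ ω, stieltjesArray n z (truncatedArray a M n (fun i k => d i k ω)) ∂P
      - ∫ γ, stieltjesArray n z (truncatedArray a M n (gaussianInnovations P d γ)) ∂noiseMeasure‖
      ≤ θ := by
  obtain ⟨σ, hσ0, hd2, hσ⟩ := hA2.exists_bound hd
  obtain ⟨K, hK⟩ := hA1.exists_bound
  set C₂ := 2 * (|z.im|⁻¹) ^ 3 with hC₂
  set C₃ := 3 * (|z.im|⁻¹) ^ 4 with hC₃
  set κ := √(2 * K) with hκ
  -- Three contributions do not vanish as `n` grows, those of `δ`, `η` and `ε`; each is given a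
  -- third of `θ`.
  have hθ4 : 0 < θ / 3 := by positivity
  obtain ⟨δ, hδ0, hδ⟩ := exists_pos_mul_lt hθ4 (8 * C₂ * σ ^ 2)
  obtain ⟨η, hη0, hη⟩ := exists_pos_mul_lt hθ4 (C₂ * κ ^ 2)
  obtain ⟨N, hN⟩ := hA1.exists_tail_le hδ0
  obtain ⟨p, hp1, hp⟩ := hA3.exists_lag hη0
  obtain ⟨ε, hε0, hε⟩ := exists_pos_mul_lt hθ4
    (C₃ * κ ^ 3 * σ ^ 2 + p * κ ^ 2 * (2 * C₃ * κ * σ ^ 2))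
  have hdiv : ∀ c : ℝ, Tendsto (fun n : ℕ => c / (n : ℝ)) atTop (𝓝 0) :=
    tendsto_const_div_atTop_nhds_zero_nat
  have hsqrt : Tendsto (fun n : ℕ => σ ^ 3 * gaussianThirdMoment / √n) atTop (𝓝 0) :=
    tendsto_const_nhds.div_atTop (Real.tendsto_sqrt_atTop.comp tendsto_natCast_atTop_atTop)
  have hlim := (((((((hdiv (N * K)).add_const δ).const_mul (8 * C₂ * σ ^ 2)).add
    (hdiv (4 * C₂ * σ ^ 2 * p * κ ^ 2))).add_const (C₂ * κ ^ 2 * η)).add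
    ((hsqrt.const_add (ε * σ ^ 2)).const_mul (C₃ * κ ^ 3))).add
    (((hdiv (2 * C₂ * σ ^ 4 / ε ^ 2)).const_add (2 * C₃ * ε * κ * σ ^ 2)).const_mul
      (p * κ ^ 2))).add ((hA2.tendsto_sqTail hε0).const_mul (C₂ * κ ^ 2 * (1 + 4 * p)))
  rw [show 8 * C₂ * σ ^ 2 * (0 + δ) + 0 + C₂ * κ ^ 2 * η + C₃ * κ ^ 3 * (ε * σ ^ 2 + 0) +
      p * κ ^ 2 * (2 * C₃ * ε * κ * σ ^ 2 + 0) + C₂ * κ ^ 2 * (1 + 4 * p) * 0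
      = 8 * C₂ * σ ^ 2 * δ + C₂ * κ ^ 2 * η
        + (C₃ * κ ^ 3 * σ ^ 2 + p * κ ^ 2 * (2 * C₃ * κ * σ ^ 2)) * ε by ring] at hlim
  have hlt := hlim.eventually_lt_const (u := θ) (by linarith)
  filter_upwards [hlt, eventually_ge_atTop 1] with n hn hn1 M
  have h := norm_integral_truncatedArray_sub_le hz hd hd2 hσ0.le hσ hA3.1 hindep hK hδ0.le hN hp1
    hη0.le hp hε0 M hn1 hC₂ hC₃
  refine h.trans (le_trans (le_of_eq ?_) hn.le)
  rw [div_div]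

end Comparison

end LinearProcessESD

end

/-! ### Second moments of the innovations and of the linear process. -/

noncomputable section

namespace LinearProcessESD

section L2

variable {Ω : Type*} {mΩ : MeasurableSpace Ω} {P : Measure Ω}

/-- This is continuity of the inner product of `L²`, transported to functions. -/
theorem tendsto_integral_mul_of_tendsto_eLpNorm {f g : ℕ → Ω → ℝ} {F G : Ω → ℝ}
    (hf : ∀ M, MemLp (f M) 2 P) (hg : ∀ M, MemLp (g M) 2 P) (hF : MemLp F 2 P) (hG : MemLp G 2 P)
    (hfF : Tendsto (fun M => eLpNorm (F - f M) 2 P) atTop (𝓝 0))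
    (hgG : Tendsto (fun M => eLpNorm (G - g M) 2 P) atTop (𝓝 0)) :
    Tendsto (fun M => ∫ ω, f M ω * g M ω ∂P) atTop (𝓝 (∫ ω, F ω * G ω ∂P)) := by
  have key : ∀ {u v : Ω → ℝ} (hu : MemLp u 2 P) (hv : MemLp v 2 P),
      inner ℝ (hv.toLp v) (hu.toLp u) = ∫ ω, u ω * v ω ∂P := fun {u v} hu hv => by
    rw [L2.inner_def]
    refine integral_congr_ae ?_
    filter_upwards [hu.coeFn_toLp, hv.coeFn_toLp] with ω h1 h2
    rw [h1, h2]
    simp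
  have lim : ∀ {u : ℕ → Ω → ℝ} {U : Ω → ℝ} (hu : ∀ M, MemLp (u M) 2 P) (hU : MemLp U 2 P),
      Tendsto (fun M => eLpNorm (U - u M) 2 P) atTop (𝓝 0) →
      Tendsto (fun M => (hu M).toLp (u M)) atTop (𝓝 (hU.toLp U)) := fun {u U} hu hU h => by
    rw [Lp.tendsto_Lp_iff_tendsto_eLpNorm'' _ hu _ hU]
    simpa only [eLpNorm_sub_comm] using h
  simpa only [key] using Filter.Tendsto.inner (𝕜 := ℝ) (lim hg hG hgG) (lim hf hF hfF)

theorem integral_sum_sq_of_pairwise {ι : Type*} [DecidableEq ι] (S : Finset ι) {f : ι → Ω → ℝ}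
    (hf : ∀ i, MemLp (f i) 2 P)
    (h : ∀ i ∈ S, ∀ j ∈ S, i ≠ j → ∫ ω, f i ω * f j ω ∂P = 0) :
    ∫ ω, (∑ i ∈ S, f i ω) ^ 2 ∂P = ∑ i ∈ S, ∫ ω, f i ω ^ 2 ∂P := by
  have hi : ∀ i j, Integrable (fun ω => f i ω * f j ω) P := fun i j => (hf i).integrable_mul (hf j)
  simp only [sq, Finset.sum_mul_sum]
  rw [integral_finsetSum _ fun i _ => integrable_finsetSum _ fun j _ => hi i j]
  refine Finset.sum_congr rfl fun i hiS => ?_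
  rw [integral_finsetSum _ fun j _ => hi i j, Finset.sum_eq_single_of_mem i hiS]
  exact fun j hj hne => h i hiS j hj hne.symm

theorem integral_sum_mul_sq {ι : Type*} (S : Finset ι) {f : ι → Ω → ℝ}
    (hf : ∀ i ∈ S, MemLp (f i) 2 P) (t : ι → ℝ) :
    ∫ ω, (∑ i ∈ S, t i * f i ω) ^ 2 ∂P
      = ∑ i ∈ S, ∑ j ∈ S, t i * t j * ∫ ω, f i ω * f j ω ∂P := by
  have hi : ∀ i ∈ S, ∀ j ∈ S, Integrable (fun ω => t i * f i ω * (t j * f j ω)) P :=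
      fun i hiS j hjS => by
    have := ((hf i hiS).integrable_mul (hf j hjS)).const_mul (t i * t j)
    refine this.congr (ae_of_all _ fun ω => ?_)
    simp only [Pi.mul_apply]
    ring
  simp only [sq, Finset.sum_mul_sum]
  rw [integral_finsetSum _ fun i hi' => integrable_finsetSum _ fun j hj => hi i hi' j hj]
  refine Finset.sum_congr rfl fun i hi' => ?_
  rw [integral_finsetSum _ fun j hj => hi i hi' j hj]
  refine Finset.sum_congr rfl fun j _ => ?_
  rw [← integral_const_mul]
  exact integral_congr_ae (ae_of_all _ fun ω => by ring)

end L2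

section Innovations

variable {Ω : Type*} {mΩ : MeasurableSpace Ω} {P : Measure Ω} [IsProbabilityMeasure P]
  {d : ℤ → ℤ → Ω → ℝ}

theorem integral_innovation_eq_zero (hd : ∀ i j, Measurable (d i j))
    (hmart : ∀ i j, P[d i j | rowPast d i (j - 1)] =ᵐ[P] 0) (i k : ℤ) : ∫ ω, d i k ω ∂P = 0 := by
  rw [← integral_condExp (rowPast_le hd i (k - 1)), integral_congr_ae (hmart i k)]
  simp

/-- The earlier innovation is measurable with respect to the past of the later one, whose
conditional mean is zero. -/
theorem integral_innovation_mul_of_lt (hd : ∀ i j, Measurable (d i j))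
    (hd2 : ∀ i j, MemLp (d i j) 2 P)
    (hmart : ∀ i j, P[d i j | rowPast d i (j - 1)] =ᵐ[P] 0) (i : ℤ) {k l : ℤ} (h : k < l) :
    ∫ ω, d i k ω * d i l ω ∂P = 0 := by
  have hm := rowPast_le hd i (l - 1)
  have h1 := condExp_mul_of_stronglyMeasurable_left (μ := P)
    (measurable_rowPast (d := d) (i := i) (show k ≤ l - 1 by omega)).stronglyMeasurable
    ((hd2 i k).integrable_mul (hd2 i l)) ((hd2 i l).integrable (by norm_num))
  have h2 := integral_condExp (μ := P) (f := d i k * d i l) hm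
  rw [integral_congr_ae h1] at h2
  refine h2.symm.trans (integral_eq_zero_of_ae ?_)
  filter_upwards [hmart i l] with ω hω
  simp [hω]

theorem integral_innovation_mul_of_ne (hd : ∀ i j, Measurable (d i j))
    (hd2 : ∀ i j, MemLp (d i j) 2 P)
    (hmart : ∀ i j, P[d i j | rowPast d i (j - 1)] =ᵐ[P] 0)
    (hindep : iIndepFun (fun (i : {i : ℤ // 1 ≤ i}) (ω : Ω) (j : ℤ) => d i j ω) P) {i i' k k' : ℤ}
    (hi : 1 ≤ i) (hi' : 1 ≤ i') (h : (i, k) ≠ (i', k')) :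
    ∫ ω, d i k ω * d i' k' ω ∂P = 0 := by
  by_cases hii : i = i'
  · subst hii
    rcases lt_trichotomy k k' with hk | hk | hk
    · exact integral_innovation_mul_of_lt hd hd2 hmart i hk
    · exact absurd (by rw [hk]) h
    · simp only [mul_comm (d i k _)]
      exact integral_innovation_mul_of_lt hd hd2 hmart i hk
  · have hI := (hindep.indepFun (i := ⟨i, hi⟩) (j := ⟨i', hi'⟩) (by simpa using hii)).comp
      (measurable_pi_apply k) (measurable_pi_apply k')
    have := hI.integral_fun_mul_eq_mul_integral (hd i k).aestronglyMeasurable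
      (hd i' k').aestronglyMeasurable
    refine this.trans ?_
    have h0 : ∫ ω, ((fun f : ℤ → ℝ => f k) ∘ fun ω j => d i j ω) ω ∂P = 0 :=
      integral_innovation_eq_zero hd hmart i k
    rw [show ∫ ω, ((fun f : ℤ → ℝ => f k) ∘ fun ω j => d i j ω) ω ∂P = 0 from h0, zero_mul]

/-- The second moment of a linear combination of innovations. -/
theorem integral_sum_innovation_sq (hd : ∀ i j, Measurable (d i j))
    (hd2 : ∀ i j, MemLp (d i j) 2 P)
    (hmart : ∀ i j, P[d i j | rowPast d i (j - 1)] =ᵐ[P] 0)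
    (hindep : iIndepFun (fun (i : {i : ℤ // 1 ≤ i}) (ω : Ω) (j : ℤ) => d i j ω) P)
    (S : Finset ℕ) (T : ℕ → Finset ℕ) (k : ℕ → ℤ) (hk : Function.Injective k) (c : ℕ → ℕ → ℝ) :
    ∫ ω, (∑ i ∈ S, ∑ t ∈ T i, c i t * d ((i : ℤ) + 1) (k t) ω) ^ 2 ∂P
      = ∑ i ∈ S, ∑ t ∈ T i, c i t ^ 2 * ∫ ω, d ((i : ℤ) + 1) (k t) ω ^ 2 ∂P := by
  have h := integral_sum_sq_of_pairwise (P := P) (S.sigma T)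
    (f := fun u ω => c u.1 u.2 * d ((u.1 : ℤ) + 1) (k u.2) ω)
    (fun u => (hd2 _ _).const_mul _) (fun u _ v _ huv => by
      have h0 := integral_innovation_mul_of_ne hd hd2 hmart hindep
        (i := (u.1 : ℤ) + 1) (i' := (v.1 : ℤ) + 1) (k := k u.2) (k' := k v.2) (by omega) (by omega)
        (fun h => huv (by
          simp only [Prod.mk.injEq] at h
          have h1 : u.1 = v.1 := by omega
          exact Sigma.ext h1 (heq_of_eq (hk h.2))))
      calc _ = ∫ ω, (c u.1 u.2 * c v.1 v.2) *
            (d ((u.1 : ℤ) + 1) (k u.2) ω * d ((v.1 : ℤ) + 1) (k v.2) ω) ∂P :=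
            integral_congr_ae (ae_of_all _ fun ω => by ring)
        _ = 0 := by rw [integral_const_mul, h0, mul_zero])
  simp only [Finset.sum_sigma] at h
  rw [h]
  simp only [mul_pow, integral_const_mul]

end Innovations

section LinearProcess

variable {Ω : Type*} {mΩ : MeasurableSpace Ω} {P : Measure Ω}
  {a : ℤ → ℤ → ℝ} {d : ℤ → ℤ → Ω → ℝ} {X : ℕ+ → ℕ+ → Ω → ℝ} {z : ℂ}

theorem memLp_truncatedArray (hd2 : ∀ i j, MemLp (d i j) 2 P) (M : ℕ) {n i j : ℕ} (hi : i < n)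
    (hj : j ≤ i) : MemLp (fun ω => truncatedArray a M n (fun i k => d i k ω)
      (Nat.succPNat i) (Nat.succPNat j)) 2 P := by
  simp only [truncatedArray_succPNat a M _ hi hj]
  exact memLp_finsetSum _ fun l _ => (hd2 _ _).const_mul _

theorem IsLinearProcess.tendsto_eLpNorm (hX : IsLinearProcess a d X P) {n i j : ℕ} (hi : i < n)
    (hj : j ≤ i) : Tendsto (fun M => eLpNorm (X (Nat.succPNat i) (Nat.succPNat j) - fun ω =>
      truncatedArray a M n (fun i k => d i k ω) (Nat.succPNat i) (Nat.succPNat j)) 2 P)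
      atTop (𝓝 0) := by
  refine (hX (Nat.succPNat i) (Nat.succPNat j)).2.congr fun M => ?_
  congr 1
  ext ω
  simp only [Pi.sub_apply, truncatedArray_succPNat a M _ hi hj, Nat.succPNat_coe,
    Nat.succ_eq_add_one,
    Nat.cast_add, Nat.cast_one]

/-- Some partial sum, which is square integrable, lies at finite `L²` distance from `X`. -/
theorem IsLinearProcess.memLp (hX : IsLinearProcess a d X P) (hd2 : ∀ i j, MemLp (d i j) 2 P)
    (i j : ℕ) (hj : j ≤ i) : MemLp (X (Nat.succPNat i) (Nat.succPNat j)) 2 P := by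
  obtain ⟨M, hM⟩ := ((hX.tendsto_eLpNorm (Nat.lt_succ_self i) hj).eventually
    (gt_mem_nhds ENNReal.zero_lt_top)).exists
  have h1 := memLp_truncatedArray (a := a) hd2 M (Nat.lt_succ_self i) hj
  have h2 : MemLp (X (Nat.succPNat i) (Nat.succPNat j) - fun ω =>
      truncatedArray a M (i + 1) (fun i k => d i k ω) (Nat.succPNat i) (Nat.succPNat j)) 2 P :=
    ⟨(hX _ _).1.aestronglyMeasurable.sub h1.1, hM⟩
  simpa using h2.add h1

theorem IsLinearProcess.tendsto_integral_mul (hX : IsLinearProcess a d X P)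
    (hd2 : ∀ i j, MemLp (d i j) 2 P) {n i j i' j' : ℕ} (hi : i < n) (hj : j ≤ i) (hi' : i' < n)
    (hj' : j' ≤ i') :
    Tendsto (fun M => ∫ ω, truncatedArray a M n (fun i k => d i k ω)
        (Nat.succPNat i) (Nat.succPNat j) * truncatedArray a M n (fun i k => d i k ω)
        (Nat.succPNat i') (Nat.succPNat j') ∂P) atTop
      (𝓝 (∫ ω, X (Nat.succPNat i) (Nat.succPNat j) ω
        * X (Nat.succPNat i') (Nat.succPNat j') ω ∂P)) :=
  tendsto_integral_mul_of_tendsto_eLpNorm (fun M => memLp_truncatedArray hd2 M hi hj)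
    (fun M => memLp_truncatedArray hd2 M hi' hj') (hX.memLp hd2 i j hj) (hX.memLp hd2 i' j' hj')
    (hX.tendsto_eLpNorm hi hj) (hX.tendsto_eLpNorm hi' hj')

theorem IsLinearProcess.integral_eq_zero [IsProbabilityMeasure P] (hX : IsLinearProcess a d X P)
    (hd : ∀ i j, Measurable (d i j)) (hd2 : ∀ i j, MemLp (d i j) 2 P)
    (hmart : ∀ i j, P[d i j | rowPast d i (j - 1)] =ᵐ[P] 0) (i j : ℕ) (hj : j ≤ i) :
    ∫ ω, X (Nat.succPNat i) (Nat.succPNat j) ω ∂P = 0 := by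
  -- With the constant 1 as second factor, convergence of products becomes convergence of means.
  have h := tendsto_integral_mul_of_tendsto_eLpNorm (G := fun _ => 1) (g := fun _ _ => 1)
    (fun M => memLp_truncatedArray hd2 M (Nat.lt_succ_self i) hj) (fun _ => memLp_const 1)
    (hX.memLp hd2 i j hj) (memLp_const 1) (hX.tendsto_eLpNorm (Nat.lt_succ_self i) hj) (by simp)
  simp only [mul_one] at h
  refine tendsto_nhds_unique h (tendsto_const_nhds.congr fun M => ?_)
  simp only [truncatedArray_succPNat a M _ (Nat.lt_succ_self i) hj]
  rw [integral_finsetSum _ fun l _ => ((hd2 _ _).integrable (by norm_num)).const_mul _]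
  simp only [integral_const_mul, integral_innovation_eq_zero hd hmart, mul_zero,
    Finset.sum_const_zero]

theorem IsLinearProcess.covariance_eq [IsProbabilityMeasure P] (hX : IsLinearProcess a d X P)
    (hd : ∀ i j, Measurable (d i j)) (hd2 : ∀ i j, MemLp (d i j) 2 P)
    (hmart : ∀ i j, P[d i j | rowPast d i (j - 1)] =ᵐ[P] 0) {i j i' j' : ℕ} (hj : j ≤ i)
    (hj' : j' ≤ i') :
    cov[X (Nat.succPNat i) (Nat.succPNat j), X (Nat.succPNat i') (Nat.succPNat j'); P]
      = ∫ ω, X (Nat.succPNat i) (Nat.succPNat j) ω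
        * X (Nat.succPNat i') (Nat.succPNat j') ω ∂P := by
  rw [covariance_eq_sub (hX.memLp hd2 i j hj) (hX.memLp hd2 i' j' hj'),
    hX.integral_eq_zero hd hd2 hmart i j hj, zero_mul, sub_zero]
  rfl

end LinearProcess

end LinearProcessESD

end

noncomputable section

namespace LinearProcessESD

variable {Ω : Type*} {mΩ : MeasurableSpace Ω} {P : Measure Ω}
  {a : ℤ → ℤ → ℝ} {d : ℤ → ℤ → Ω → ℝ} {X : ℕ+ → ℕ+ → Ω → ℝ} {z : ℂ}

/-! ### Identification of the Gaussian limit as the truncation is removed. -/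

section GaussianLimit

/-- The positions on and below the diagonal of an `n × n` array. -/
def lowerIndices (n : ℕ) : Finset (ℕ+ × ℕ+) :=
  ((Finset.range n).sigma fun i => Finset.range (i + 1)).image
    fun u => (Nat.succPNat u.1, Nat.succPNat u.2)

theorem mem_lowerIndices {n : ℕ} {p : ℕ+ × ℕ+} :
    p ∈ lowerIndices n ↔ ∃ i j : ℕ, i < n ∧ j ≤ i ∧ p = (Nat.succPNat i, Nat.succPNat j) := by
  simp only [lowerIndices, Finset.mem_image, Finset.mem_sigma, Finset.mem_range, Sigma.exists,
    Nat.lt_succ_iff, and_assoc, eq_comm (a := p)]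

/-- A linear combination of the entries of the truncated process is a linear combination of the
innovations. -/
theorem sum_mul_truncatedArray (a : ℤ → ℤ → ℝ) (M n : ℕ) (I : Finset (ℕ+ × ℕ+))
    (t : ℕ+ → ℕ+ → ℝ) (y : ℤ → ℤ → ℝ) :
    ∑ p ∈ I, t p.1 p.2 * truncatedArray a M n y p.1 p.2
      = ∑ i ∈ Finset.range n, ∑ u ∈ Finset.range (i + 1 + M),
        (∑ p ∈ I, t p.1 p.2 * coeffArray (fun l => a ((i : ℤ) + 1) l) M i u p.1 p.2)
          * y ((i : ℤ) + 1) ((u : ℤ) - M + 1) := by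
  simp only [truncatedArray, rowArray, Finset.sum_apply, Pi.smul_apply, smul_eq_mul,
    Finset.mul_sum, Finset.sum_mul]
  rw [Finset.sum_comm]
  refine Finset.sum_congr rfl fun i _ => ?_
  rw [Finset.sum_comm]
  refine Finset.sum_congr rfl fun u _ => Finset.sum_congr rfl fun p _ => ?_
  ring

theorem measurable_truncatedArray (a : ℤ → ℤ → ℝ) (M n : ℕ) :
    Measurable (truncatedArray a M n) :=
  Finset.measurable_fun_sum _ fun _ _ => (measurable_rowArray _ _ _).comp (measurable_pi_apply _)

theorem measurable_gaussianInnovations (P : Measure Ω) (d : ℤ → ℤ → Ω → ℝ) :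
    Measurable (gaussianInnovations P d) :=
  measurable_pi_lambda _ fun _ => measurable_pi_lambda _ fun _ =>
    (measurable_noise _ _).const_mul _

variable [IsProbabilityMeasure P]

/-- The second moment of a linear combination of innovations depends on their variances only, by
orthogonality, and the Gaussian innovations share these variances. -/
theorem map_sum_mul_truncatedArray_gaussianInnovations (hd : ∀ i j, Measurable (d i j))
    (hd2 : ∀ i j, MemLp (d i j) 2 P)
    (hmart : ∀ i j, P[d i j | rowPast d i (j - 1)] =ᵐ[P] 0)
    (hindep : iIndepFun (fun (i : {i : ℤ // 1 ≤ i}) (ω : Ω) (j : ℤ) => d i j ω) P)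
    (M n : ℕ) (I : Finset (ℕ+ × ℕ+)) (t : ℕ+ → ℕ+ → ℝ) :
    noiseMeasure.map (fun γ => ∑ p ∈ I, t p.1 p.2
        * truncatedArray a M n (gaussianInnovations P d γ) p.1 p.2)
      = gaussianReal 0 (∫ ω, (∑ p ∈ I, t p.1 p.2
        * truncatedArray a M n (fun i k => d i k ω) p.1 p.2) ^ 2 ∂P).toNNReal := by
  have hr : Function.Injective fun i : ℕ => (i : ℤ) + 1 := fun i i' h => by
    simp only at h; omega
  have hk : Function.Injective fun u : ℕ => (u : ℤ) - M + 1 := fun i i' h => by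
    simp only at h; omega
  simp only [sum_mul_truncatedArray]
  rw [integral_sum_innovation_sq hd hd2 hmart hindep (Finset.range n) _
    (fun u : ℕ => (u : ℤ) - M + 1) hk]
  simp only [gaussianInnovations, ← mul_assoc]
  rw [map_sum_noise (Finset.range n) (fun i => Finset.range (i + 1 + M)) hr hk]
  congr 1
  ext
  rw [Real.coe_toNNReal _ (Finset.sum_nonneg fun i _ => Finset.sum_nonneg fun u _ =>
    mul_nonneg (sq_nonneg _) (integral_nonneg fun _ => sq_nonneg _))]
  simp only [NNReal.coe_sum, NNReal.coe_mk, mul_pow]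
  refine Finset.sum_congr rfl fun i _ => Finset.sum_congr rfl fun u _ => ?_
  rw [Real.sq_sqrt (integral_nonneg fun _ => sq_nonneg _)]

theorem IsLinearProcess.tendsto_variance (hX : IsLinearProcess a d X P)
    (hd : ∀ i j, Measurable (d i j)) (hd2 : ∀ i j, MemLp (d i j) 2 P)
    (hmart : ∀ i j, P[d i j | rowPast d i (j - 1)] =ᵐ[P] 0) (n : ℕ) (t : ℕ+ → ℕ+ → ℝ) :
    Tendsto (fun M => ∫ ω, (∑ p ∈ lowerIndices n, t p.1 p.2
        * truncatedArray a M n (fun i k => d i k ω) p.1 p.2) ^ 2 ∂P) atTop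
      (𝓝 (∑ p ∈ lowerIndices n, ∑ q ∈ lowerIndices n, t p.1 p.2 * t q.1 q.2
        * cov[X p.1 p.2, X q.1 q.2; P])) := by
  have h : ∀ M, ∫ ω, (∑ p ∈ lowerIndices n, t p.1 p.2
        * truncatedArray a M n (fun i k => d i k ω) p.1 p.2) ^ 2 ∂P
      = ∑ p ∈ lowerIndices n, ∑ q ∈ lowerIndices n, t p.1 p.2 * t q.1 q.2
        * ∫ ω, truncatedArray a M n (fun i k => d i k ω) p.1 p.2
          * truncatedArray a M n (fun i k => d i k ω) q.1 q.2 ∂P := fun M =>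
    integral_sum_mul_sq _ (f := fun (p : ℕ+ × ℕ+) ω =>
      truncatedArray a M n (fun i k => d i k ω) p.1 p.2) (fun p hp => by
        obtain ⟨i, j, hi, hj, rfl⟩ := mem_lowerIndices.mp hp
        exact memLp_truncatedArray hd2 M hi hj) fun p => t p.1 p.2
  simp only [h]
  refine tendsto_finsetSum _ fun p hp => tendsto_finsetSum _ fun q hq => ?_
  obtain ⟨i, j, hi, hj, rfl⟩ := mem_lowerIndices.mp hp
  obtain ⟨i', j', hi', hj', rfl⟩ := mem_lowerIndices.mp hq
  rw [hX.covariance_eq hd hd2 hmart hj hj']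
  exact (hX.tendsto_integral_mul hd2 hi hj hi' hj').const_mul _

/-- The variances of linear combinations of the truncated entries converge to those of `X`, which
are those of `Y`; the dimension `n` stays fixed. -/
theorem IsLinearProcess.tendsto_integral_gaussian {Ω' : Type*} {mΩ' : MeasurableSpace Ω'}
    {P' : Measure Ω'} [IsProbabilityMeasure P'] {Y : ℕ+ → ℕ+ → Ω' → ℝ}
    (hX : IsLinearProcess a d X P) (hY : IsGaussianCounterpart X P Y P') (hz : z.im ≠ 0)
    (hd : ∀ i j, Measurable (d i j)) (hd2 : ∀ i j, MemLp (d i j) 2 P)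
    (hmart : ∀ i j, P[d i j | rowPast d i (j - 1)] =ᵐ[P] 0)
    (hindep : iIndepFun (fun (i : {i : ℤ // 1 ≤ i}) (ω : Ω) (j : ℤ) => d i j ω) P) (n : ℕ) :
    Tendsto (fun M => ∫ γ, stieltjesArray n z (truncatedArray a M n (gaussianInnovations P d γ))
      ∂noiseMeasure) atTop (𝓝 (∫ ω, stieltjesArray n z (fun i j => Y i j ω) ∂P')) := by
  refine tendsto_integral_stieltjesArray hz (I := lowerIndices n)
    (fun k l hk hl => mem_lowerIndices.mpr ⟨k, l, hk, hl, rfl⟩)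
    (fun M => (measurable_truncatedArray a M n).comp (measurable_gaussianInnovations P d)) hY.1
    hY.2.1 (fun t M => map_sum_mul_truncatedArray_gaussianInnovations hd hd2 hmart hindep M n _ t)
    fun t => ?_
  simp only [hY.2.2]
  refine (hX.tendsto_variance hd hd2 hmart n t).congr fun M => ?_
  rw [Real.coe_toNNReal _ (integral_nonneg fun _ => sq_nonneg _)]

end GaussianLimit

/-! ### Removal of the truncation for fixed dimension. -/

section Truncation

open scoped Matrix.Norms.Frobenius

/-- A deliberately wasteful bound: the truncation order tends to infinity with `n` fixed, so the
dependence on `n` is irrelevant and an `ℓ¹` distance is convenient. -/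
theorem norm_stieltjesArray_sub_le_sum (hz : z.im ≠ 0) (n : ℕ) (x y : ℕ+ → ℕ+ → ℝ) :
    ‖stieltjesArray n z x - stieltjesArray n z y‖ ≤ 2 * (|z.im|⁻¹) ^ 2 *
      ∑ i ∈ Finset.range n, ∑ j ∈ Finset.range (i + 1),
        |(x - y) (Nat.succPNat i) (Nat.succPNat j)| := by
  rcases Nat.eq_zero_or_pos n with rfl | hn
  · simp [stieltjesArray, stieltjes]
  have hn1 : (1 : ℝ) ≤ n := by exact_mod_cast hn
  set L := ∑ i ∈ Finset.range n, ∑ j ∈ Finset.range (i + 1),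
    |(x - y) (Nat.succPNat i) (Nat.succPNat j)|
  have hL0 : 0 ≤ L := Finset.sum_nonneg fun _ _ => Finset.sum_nonneg fun _ _ => abs_nonneg _
  have h1 := stieltjesArray_lipschitz hz n y (x - y)
  rw [add_sub_cancel] at h1
  have h2 : ‖wignerC n (x - y)‖ ≤ 2 * L := by
    refine abs_le_of_sq_le_sq' ?_ (by positivity) |>.2
    have h3 : ∑ i ∈ Finset.range n, ∑ j ∈ Finset.range (i + 1),
        (x - y) (Nat.succPNat i) (Nat.succPNat j) ^ 2 ≤ L ^ 2 := by
      have := Finset.sum_sq_le_sq_sum_of_nonneg (s := (Finset.range n).sigma fun i =>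
        Finset.range (i + 1)) (f := fun u => |(x - y) (Nat.succPNat u.1) (Nat.succPNat u.2)|)
        fun _ _ => abs_nonneg _
      simpa only [sq_abs, Finset.sum_sigma] using this
    have h4 : 2 / (n : ℝ) ≤ 4 := by
      rw [div_le_iff₀ (by linarith)]; linarith
    calc _ ≤ 2 / (n : ℝ) * L ^ 2 := (norm_wignerC_sq_le n (x - y)).trans
          (mul_le_mul_of_nonneg_left h3 (by positivity))
      _ ≤ 4 * L ^ 2 := mul_le_mul_of_nonneg_right h4 (by positivity)
      _ = _ := by ring
  have h5 : ‖wignerC n (x - y)‖ / √n ≤ 2 * L :=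
    (div_le_self (norm_nonneg _) (Real.one_le_sqrt.mpr hn1)).trans h2
  calc _ ≤ (|z.im|⁻¹) ^ 2 * (2 * L) := h1.trans (mul_le_mul_of_nonneg_left h5 (by positivity))
    _ = _ := by ring

theorem integrable_stieltjesArray (hz : z.im ≠ 0) (n : ℕ) [IsFiniteMeasure P]
    {A : Ω → ℕ+ → ℕ+ → ℝ} (hA : AEMeasurable A P) :
    Integrable (fun ω => stieltjesArray n z (A ω)) P :=
  Integrable.of_bound ((continuous_stieltjesArray hz n).measurable.comp_aemeasurable
    hA).aestronglyMeasurable _ (ae_of_all _ fun _ => norm_stieltjesArray_le hz n _)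

theorem measurable_truncatedArray_innovations (hd : ∀ i j, Measurable (d i j)) (a : ℤ → ℤ → ℝ)
    (M n : ℕ) : Measurable fun ω => truncatedArray a M n (fun i k => d i k ω) :=
  (measurable_truncatedArray a M n).comp
    (measurable_pi_lambda _ fun i => measurable_pi_lambda _ fun j => hd i j)

theorem IsLinearProcess.aemeasurable (hX : IsLinearProcess a d X P) :
    AEMeasurable (fun ω i j => X i j ω) P :=
  aemeasurable_pi_lambda _ fun i => aemeasurable_pi_lambda _ fun j => (hX i j).1

variable [IsProbabilityMeasure P]

theorem integral_abs_le_toReal_eLpNorm {f : Ω → ℝ} (hf : MemLp f 2 P) :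
    ∫ ω, |f ω| ∂P ≤ (eLpNorm f 2 P).toReal := by
  have hi : Integrable f P := hf.integrable (by norm_num)
  have h := eLpNorm_le_eLpNorm_of_exponent_le (p := 1) (q := 2) (by norm_num) hf.1
  have h1 := integral_norm_eq_lintegral_enorm hf.1
  rw [← eLpNorm_one_eq_lintegral_enorm] at h1
  exact h1.trans_le (ENNReal.toReal_mono hf.2.ne h)

theorem IsLinearProcess.tendsto_integral_norm_sub (hX : IsLinearProcess a d X P) (hz : z.im ≠ 0)
    (hd : ∀ i j, Measurable (d i j)) (hd2 : ∀ i j, MemLp (d i j) 2 P) (n : ℕ) :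
    Tendsto (fun M => ∫ ω, ‖stieltjesArray n z (fun i j => X i j ω)
      - stieltjesArray n z (truncatedArray a M n (fun i k => d i k ω))‖ ∂P) atTop (𝓝 0) := by
  set e : ℕ → ℕ → ℕ → Ω → ℝ := fun M i j => X (Nat.succPNat i) (Nat.succPNat j) - fun ω =>
      truncatedArray a M n (fun i k => d i k ω) (Nat.succPNat i) (Nat.succPNat j) with he
  have hmem : ∀ M, ∀ i ∈ Finset.range n, ∀ j ∈ Finset.range (i + 1), MemLp (e M i j) 2 P :=
    fun M i hi j hj => by
      rw [Finset.mem_range] at hi hj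
      exact (hX.memLp hd2 i j (by omega)).sub (memLp_truncatedArray hd2 M hi (by omega))
  have hlim : Tendsto (fun M => 2 * (|z.im|⁻¹) ^ 2 * ∑ i ∈ Finset.range n,
      ∑ j ∈ Finset.range (i + 1), (eLpNorm (e M i j) 2 P).toReal) atTop (𝓝 0) := by
    rw [show (0 : ℝ) = 2 * (|z.im|⁻¹) ^ 2 * ∑ i ∈ Finset.range n,
      ∑ j ∈ Finset.range (i + 1), (0 : ENNReal).toReal by simp]
    refine (tendsto_finsetSum _ fun i hi => tendsto_finsetSum _ fun j hj => ?_).const_mul _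
    rw [Finset.mem_range] at hi hj
    exact (ENNReal.tendsto_toReal ENNReal.zero_ne_top).comp
      (hX.tendsto_eLpNorm hi (Nat.lt_succ_iff.mp hj))
  refine squeeze_zero (fun M => integral_nonneg fun _ => norm_nonneg _) (fun M => ?_) hlim
  have hint : ∀ i ∈ Finset.range n, ∀ j ∈ Finset.range (i + 1),
      Integrable (fun ω => |e M i j ω|) P := fun i hi j hj =>
    ((hmem M i hi j hj).integrable (by norm_num)).abs
  calc _ ≤ ∫ ω, 2 * (|z.im|⁻¹) ^ 2 * ∑ i ∈ Finset.range n, ∑ j ∈ Finset.range (i + 1),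
        |e M i j ω| ∂P := by
        refine integral_mono (((integrable_stieltjesArray hz n hX.aemeasurable).sub
          (integrable_stieltjesArray hz n
            (measurable_truncatedArray_innovations hd a M n).aemeasurable)).norm)
          ((integrable_finsetSum _ fun i hi => integrable_finsetSum _ (hint i hi)).const_mul _)
          fun ω => ?_
        exact norm_stieltjesArray_sub_le_sum hz n _ _
    _ = 2 * (|z.im|⁻¹) ^ 2 * ∑ i ∈ Finset.range n, ∑ j ∈ Finset.range (i + 1),
        ∫ ω, |e M i j ω| ∂P := by
        rw [integral_const_mul, integral_finsetSum _ fun i hi => integrable_finsetSum _ (hint i hi)]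
        exact congrArg _ (Finset.sum_congr rfl fun i hi => integral_finsetSum _ (hint i hi))
    _ ≤ _ := mul_le_mul_of_nonneg_left (Finset.sum_le_sum fun i hi => Finset.sum_le_sum fun j hj =>
        integral_abs_le_toReal_eLpNorm (hmem M i hi j hj)) (by positivity)

end Truncation

/-! ### Almost sure concentration around the mean. -/

section Concentration

variable [IsProbabilityMeasure P]

/-- The concentration inequality is for real functions, hence the functional `φ`, which will be the
real or the imaginary part. The bounds do not involve the truncation, which may thus vary with `n`.
-/
theorem ae_tendsto_realPart_sub_integral (hz : z.im ≠ 0) (hd : ∀ i j, Measurable (d i j))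
    (hindep : iIndepFun (fun (i : {i : ℤ // 1 ≤ i}) (ω : Ω) (j : ℤ) => d i j ω) P)
    (M : ℕ → ℕ) (φ : ℂ →L[ℝ] ℝ) (hφ : ∀ w, |φ w| ≤ ‖w‖) :
    ∀ᵐ ω ∂P, Tendsto (fun n => φ (stieltjesArray n z (truncatedArray a (M n) n
      (fun i k => d i k ω)) - ∫ ω', stieltjesArray n z (truncatedArray a (M n) n
      (fun i k => d i k ω')) ∂P)) atTop (𝓝 0) := by
  have hz' : 0 < |z.im| := abs_pos.mpr hz
  -- For `n` rows with differences `4 / (n |Im z|)`, the variance proxy is `n (4 / (n |Im z|))² = K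
  -- / n`.
  set K : NNReal := .mk (16 * (|z.im|⁻¹) ^ 2) (by positivity) with hK
  have hK0 : 0 < K := by
    rw [← NNReal.coe_pos, hK, NNReal.coe_mk]
    positivity
  refine ae_tendsto_zero_of_hasSubgaussianMGF hK0 fun n hn => ?_
  have hn0 : (0 : ℝ) < n := by exact_mod_cast hn
  have hUi : iIndepFun (fun (i : ℕ) ω => rowArray (fun l => a ((i : ℤ) + 1) l) (M n) i
      (fun k => d ((i : ℤ) + 1) k ω)) P := by
    have hinj : Function.Injective fun i : ℕ => (⟨(i : ℤ) + 1, by omega⟩ : {i : ℤ // 1 ≤ i}) :=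
      fun i i' h => by
        have := congrArg Subtype.val h
        simp only at this
        omega
    exact (hindep.precomp hinj).comp (fun i y => rowArray (fun l => a ((i : ℤ) + 1) l) (M n) i y)
      fun i => measurable_rowArray _ _ _
  have h := hasSubgaussianMGF_sum_sub_integral (u := fun x => φ (stieltjesArray n z x))
    (φ.continuous.measurable.comp (continuous_stieltjesArray hz n).measurable)
    (fun x => (hφ _).trans (norm_stieltjesArray_le hz n x))
    (fun i => (measurable_rowArray _ (M n) i).comp (measurable_pi_lambda _ fun k => hd _ k)) hUi
    (Finset.range n) (c := 4 * |z.im|⁻¹ / n) (by positivity) (fun i _ x ω ω' => by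
      -- Passing from one value of the row to another adds the difference of the two rows, which is
      -- supported on that row.
      have h1 := stieltjesArray_sub_le_of_row hz n i
        (x + rowArray (fun l => a ((i : ℤ) + 1) l) (M n) i (fun k => d ((i : ℤ) + 1) k ω'))
        (rowArray (fun l => a ((i : ℤ) + 1) l) (M n) i (fun k => d ((i : ℤ) + 1) k ω)
          - rowArray (fun l => a ((i : ℤ) + 1) l) (M n) i (fun k => d ((i : ℤ) + 1) k ω'))
        (fun i' j h => by
          simp only [Pi.sub_apply, rowArray_of_ne _ _ _ _ h, sub_zero])
      rw [add_assoc, add_sub_cancel] at h1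
      rw [← map_sub]
      exact (hφ _).trans h1) (K := K / n) (le_of_eq (by
        rw [Finset.card_range, NNReal.coe_div, hK, NNReal.coe_mk, NNReal.coe_natCast]
        field_simp
        norm_num))
  simp only [map_sub]
  have hi := φ.integral_comp_comm (integrable_stieltjesArray (P := P) hz n
    (measurable_truncatedArray_innovations hd a (M n) n).aemeasurable)
  rw [← hi]
  exact h

theorem ae_tendsto_sub_integral (hz : z.im ≠ 0) (hd : ∀ i j, Measurable (d i j))
    (hindep : iIndepFun (fun (i : {i : ℤ // 1 ≤ i}) (ω : Ω) (j : ℤ) => d i j ω) P)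
    (M : ℕ → ℕ) :
    ∀ᵐ ω ∂P, Tendsto (fun n => stieltjesArray n z (truncatedArray a (M n) n
      (fun i k => d i k ω)) - ∫ ω', stieltjesArray n z (truncatedArray a (M n) n
      (fun i k => d i k ω')) ∂P) atTop (𝓝 0) := by
  filter_upwards [ae_tendsto_realPart_sub_integral (a := a) hz hd hindep M Complex.reCLM
    Complex.abs_re_le_norm, ae_tendsto_realPart_sub_integral (a := a) hz hd hindep M Complex.imCLM
    Complex.abs_im_le_norm] with ω h1 h2
  refine squeeze_zero_norm (fun n => Complex.norm_le_abs_re_add_abs_im _) ?_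
  simpa using h1.abs.add h2.abs

end Concentration

/-! ### The almost sure limit. -/

section Main

variable [IsProbabilityMeasure P]

/-- Four differences are summed: process minus truncation, truncation minus its mean, this mean
minus the mean for truncated Gaussian innovations, and the latter minus the mean for `Y`. -/
theorem ae_tendsto_stieltjesArray_sub {Ω' : Type*} {mΩ' : MeasurableSpace Ω'}
    {P' : Measure Ω'} [IsProbabilityMeasure P'] {Y : ℕ+ → ℕ+ → Ω' → ℝ} (hz : z.im ≠ 0)
    (hd : ∀ i j, Measurable (d i j)) (hX : IsLinearProcess a d X P)
    (hA1 : CondA1 a) (hA2 : CondA2 d P) (hA3 : CondA3 d P)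
    (hindep : iIndepFun (fun (i : {i : ℤ // 1 ≤ i}) (ω : Ω) (j : ℤ) => d i j ω) P)
    (hY : IsGaussianCounterpart X P Y P') :
    ∀ᵐ ω ∂P, Tendsto (fun n => stieltjesArray n z (fun i j => X i j ω)
      - ∫ ω', stieltjesArray n z (fun i j => Y i j ω') ∂P') atTop (𝓝 0) := by
  obtain ⟨σ, hσ0, hd2, hσ⟩ := hA2.exists_bound hd
  -- The truncation order is chosen for each `n`. The rate `2⁻ⁿ` is summable, which upgrades the
  -- first `L¹` bound to almost sure convergence.
  have hM : ∀ n : ℕ, ∃ M : ℕ,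
      ∫ ω, ‖stieltjesArray n z (fun i j => X i j ω)
        - stieltjesArray n z (truncatedArray a M n (fun i k => d i k ω))‖ ∂P ≤ (1 / 2) ^ n ∧
      ‖∫ γ, stieltjesArray n z (truncatedArray a M n (gaussianInnovations P d γ)) ∂noiseMeasure
        - ∫ ω, stieltjesArray n z (fun i j => Y i j ω) ∂P'‖ ≤ (1 / 2) ^ n := fun n => by
    have hpos : (0 : ℝ) < (1 / 2) ^ n := by positivity
    have h1 := (hX.tendsto_integral_norm_sub hz hd hd2 n).eventually_le_const hpos
    have h2 := (hX.tendsto_integral_gaussian hY hz hd hd2 hA3.1 hindep n).sub_const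
      (∫ ω, stieltjesArray n z (fun i j => Y i j ω) ∂P')
    rw [sub_self] at h2
    have h3 := h2.norm.eventually_le_const (u := (1 / 2) ^ n) (by rwa [norm_zero])
    exact (h1.and h3).exists
  choose M hM1 hM2 using hM
  have hpow : Tendsto (fun n : ℕ => (1 / 2 : ℝ) ^ n) atTop (𝓝 0) :=
    tendsto_pow_atTop_nhds_zero_of_lt_one (by norm_num) (by norm_num)
  have hT1 := ae_tendsto_zero_of_integral_le (P := P) (g := fun n ω =>
    stieltjesArray n z (fun i j => X i j ω)
      - stieltjesArray n z (truncatedArray a (M n) n (fun i k => d i k ω)))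
    (fun n => (integrable_stieltjesArray hz n hX.aemeasurable).sub (integrable_stieltjesArray hz n
      (measurable_truncatedArray_innovations hd a (M n) n).aemeasurable)) hM1
  have hT2 := ae_tendsto_sub_integral (a := a) hz hd hindep M
  have hT3 : Tendsto (fun n => ∫ ω, stieltjesArray n z (truncatedArray a (M n) n
      (fun i k => d i k ω)) ∂P - ∫ γ, stieltjesArray n z
        (truncatedArray a (M n) n (gaussianInnovations P d γ)) ∂noiseMeasure) atTop (𝓝 0) := by
    rw [Metric.tendsto_nhds]
    intro θ hθ
    filter_upwards [eventually_forall_norm_integral_sub_le hz hd hA1 hA2 hA3 hindep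
      (half_pos hθ)] with n hn
    rw [dist_zero_right]
    exact (hn (M n)).trans_lt (half_lt_self hθ)
  have hT4 := squeeze_zero_norm hM2 hpow
  filter_upwards [hT1, hT2] with ω h1 h2
  have h := ((h1.add h2).add hT3).add hT4
  simpa using h

end Main

end LinearProcessESD

end

theorem mainTheorem6 {Ω Ω' : Type*} [MeasurableSpace Ω] [MeasurableSpace Ω']
    (P : Measure Ω) [IsProbabilityMeasure P] (P' : Measure Ω') [IsProbabilityMeasure P']
    (a : ℤ → ℤ → ℝ) (d : ℤ → ℤ → Ω → ℝ) (hd : ∀ i j : ℤ, Measurable (d i j))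
    (X : ℕ+ → ℕ+ → Ω → ℝ) (hX : LinearProcessESD.IsLinearProcess a d X P)
    (hA1 : LinearProcessESD.CondA1 a) (hA2 : LinearProcessESD.CondA2 d P)
    (hA3 : LinearProcessESD.CondA3 d P)
    (hindep : iIndepFun (fun (i : {i : ℤ // 1 ≤ i}) (ω : Ω) (j : ℤ) => d i j ω) P)
    (Y : ℕ+ → ℕ+ → Ω' → ℝ) (hY : LinearProcessESD.IsGaussianCounterpart X P Y P')
    (z : ℂ) (hz : 0 < z.im) :
    ∀ᵐ ω ∂P, Tendsto
      (fun n : ℕ =>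
        LinearProcessESD.stieltjes (LinearProcessESD.wignerMatrix (fun i j => X i j ω) n) z
          - ∫ ω', LinearProcessESD.stieltjes
              (LinearProcessESD.wignerMatrix (fun i j => Y i j ω') n) z ∂P')
      atTop (𝓝 0) := by
  exact LinearProcessESD.ae_tendsto_stieltjesArray_sub hz.ne' hd hX hA1 hA2 hA3 hindep hY
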